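/- Let $(x)_n=x(x+1)\cdots(x+n-1)$, $H_n^{(s)}=\sum_{j=1}^n j^{-s}$, $H_n=H_n^{(1)}$, and $a_n=\left(-\tfrac14\right)^n\frac{(1)_n}{(1/2)_n}$. Put $$\mathsf{Dougall5F4}(a,b,c,d,k)=\frac{(a+2k)\Gamma(a+k)\Gamma(b+k)\Gamma(c+k)\Gamma(d+k)\Gamma(a-b-c+1)\Gamma(a-b-d+1)\Gamma(a-c-d+1)}{\Gamma(b)\Gamma(c)\Gamma(d)\Gamma(k+1)\Gamma(a-b+k+1)\Gamma(a-c+k+1)\Gamma(a-d+k+1)\Gamma(a-b-c-d+1)},$$ and for $n\ge1$ $$S_1(a,b,c,d,e;n)=\frac{(-1)^{n-1}P(n)\,(1-b)_{n-1}(a+e+1)_{n-1}(c+e+1)_{n-1}(a-b-c+1)_{n-1}(d+e+\frac12)_n(a-b-d+\frac12)_{n-1}}{2(e+1)_n(a-c+e+1)_n(a-d+e+\frac12)_n(a-b-c-d+\frac12)_n(a-b+e+1)_{2n}},$$ $$\begin{aligned}P(n)={}&2a^3-a^2(4b+2c+2d-6e+1)+a\left(2b^2+b(2c+2d-10e+1)+2cd-4ce+c-4de+6e^2-2e\right)\\&+e\left(4b^2+b(4c+4d-4e+2)+(c-e)(2d-2e+1)\right)\\&+n\left(10a^2-a(14b+6c+6d-22e+3)+4b^2+2b(2c+2d-8e+1)+2cd-8ce+c-8de+10e^2-4e\right)\\&+3n^2(6a-4b-2c-2d+6e-1)+10n^3,\end{aligned}$$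 and for $k\ge 0$ $$t_k(a,b,c,d,e)=\frac{(a+2e+2k+2)(a+e+1)_k(b+e+1)_k(c+e+1)_k(d+e+\frac12)_{k+1}}{(e+1)_{k+1}(a-b+e+1)_{k+1}(a-c+e+1)_{k+1}(a-d+e+\frac12)_{k+1}}.$$ Let also $$S(a,b,c,d,e;n)=\frac{(-1)^{n-1}(1-d)_{n-1}(a+e+1)_{n-1}(b+e+1)_{n-1}(c+e+1)_{n-1}(a-b-d+1)_{n-1}(a-c-d+1)_{n-1}Q(n)}{(e+1)_n(a-b+e+1)_n(a-c+e+1)_n(a-d+e+1)_{2n}(a-b-c-d+1)_n},$$ $$\begin{aligned}Q(n)={}&a^3-a^2(b+c+2d-3e)+a\left(b(c+d-2e)+cd-2ce+d^2-5de+3e^2\right)\\&+n\left(5a^2-a(3b+3c+7d-11e)+b(c+2d-4e)+2cd-4ce+2d^2-8de+5e^2\right)\\&+n^2(9a-3(b+c+2d-3e))+e\left(b(c+2d-e)+2cd-ce+2d^2-2de+e^2\right)+5n^3,\end{aligned}$$ and $S_2=a\,S$. For $T\in\{S_1,S_2\}$ let $V_N(T)$ be the $\mathbb Q$-span of the functions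 of $n\ge1$ that arise as the coefficients of the degree-$N$ monomials in the expansion of $T(a,b,c,d,e;n)$ in powers of $a,b,c,d,e$ at the origin. **(A) Five-parameter identity.** Let $a,b,c,d,e\in\mathbb C$ be such that none of $e+1$, $a-b+e+1$, $a-c+e+1$, $a-d+e+\frac12$ is a non-positive integer and $\operatorname{Re}(a-b-c-d)>-\frac12$. Then both series below converge absolutely and $$\sum_{n\ge1}S_1(a,b,c,d,e;n)=\sum_{k\ge0}t_k(a,b,c,d,e).$$ It arises from a Wilf–Zeilberger pair as follows. Let $$C(e)=\frac{\Gamma(a+e+1)\Gamma(b+e+1)\Gamma(c+e+1)\Gamma(d+e+\frac12)\Gamma(a-b-c+1)\Gamma(a-b-d+\frac12)\Gamma(a-c-d+\frac12)}{\Gamma(b)\Gamma(c)\Gamma(d+\frac12)\Gamma(e+1)\Gamma(a-b+e+1)\Gamma(a-c+e+1)\Gamma(a-d+e+\frac12)\Gamma(a-b-c-d+\frac12)},$$ and, for integers $n,k\ge0$, $F(n,k)=\mathsf{Dougall5F4}(a,b-n,c,d+\tfrac12,k+e+n+1)$ and $G(n,k)=C(e+k)\,S_1(a,b,c,d,e+k;n+1)$.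 Suppose that none of $e+1$, $a-b+e+1$, $a-c+e+1$, $a-d+e+\frac12$, $a+e+1$, $b+e+1$, $c+e+1$, $d+e+\frac12$, $a-b-c+1$, $a-b-d+\frac12$, $a-c-d+\frac12$, $a-b-c-d+\frac12$ is a non-positive integer ($1/\Gamma$ being $0$ at the poles of $\Gamma$). Then $F(n+1,k)-F(n,k)=G(n,k+1)-G(n,k)$ and $F(0,k)=C(e)\,t_k(a,b,c,d,e)$ for all $n,k\ge0$; and if $\operatorname{Re}(a-b-c-d)>-\frac12$, then $\sum_{n\ge1}G(n-1,0)=\sum_{k\ge0}F(0,k)$, both series converging absolutely. **(B) Coefficients.** The function $\sum_{k\ge0}t_k(a,b,c,d,e)$ is analytic at the origin of $\mathbb C^5$, and for every monomial $a^{r_1}b^{r_2}c^{r_3}d^{r_4}e^{r_5}$ the sum over $n\ge1$ of its coefficient in $S_1(a,b,c,d,e;n)$ converges absolutely to its coefficient in $\sum_{k\ge0}t_k(a,b,c,d,e)$. **(C) Degree 0.** $\dim_{\mathbb Q}V_0(S_1)=1$, $V_0(S_1)$ is spanned by the summand of the following series, and $$\sum_{n\ge1}a_n\frac{10n-3}{n^2(2n-1)}=-\frac{\pi^2}{3}.$$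 **(D) Degree 1.** $\dim_{\mathbb Q}V_1(S_1)=3$, $V_1(S_1)$ is spanned by the summands of the following three series, and $$\begin{aligned}&\sum_{n\ge1}a_n\frac{5}{n^3}=-2\zeta(3),\\&\sum_{n\ge1}a_n\left(\frac{(10n-3)H_n}{3n^2(2n-1)}-\frac{4(3n-1)}{3n^2(2n-1)^2}\right)=\frac{\zeta(3)}5,\\&\sum_{n\ge1}a_n\left(\frac{(10n-3)H_{2n}}{3n^2(2n-1)}-\frac{2}{3n^2(2n-1)}\right)=-\frac{16\zeta(3)}{15}.\end{aligned}$$ **(E) Higher degrees.** The following identities hold, and their summands lie in $V_N(S_1)+V_N(S_2)$, with $N=2$ for the first four, $N=3$ for the next three, $N=4$ for the next three and $N=6$ for the last: $$\begin{aligned} &\sum_{n\ge1}a_n\left(\frac{(10n-3)H_n^{(2)}}{3n^2(2n-1)}-\frac{18n-7}{3n^4(2n-1)}\right)=\frac{\pi^4}{135},\\ &\sum_{n\ge1}a_n\left(\frac{(10n-3)H_{2n}^{(2)}}{3n^2(2n-1)}-\frac{9n-4}{3n^4(2n-1)}\right)=-\frac{\pi^4}{180},\\ &\sum_{n\ge1}a_n\left(\frac{(10n-3)(H_n)^2}{3n^2(2n-1)}-\frac{8(3n-1)H_n}{3n^2(2n-1)^2}+\frac{4(34n^3-6n^2-7n+2)}{15n^4(2n-1)^3}\right)=-\frac{41\pi^4}{2700},\\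 &\sum_{n\ge1}a_n\left(\frac{(10n-3)(H_{2n})^2}{3n^2(2n-1)}-\frac{4H_{2n}}{3n^2(2n-1)}+\frac{37n-16}{15n^4(2n-1)}\right)=-\frac{19\pi^4}{900},\\ &\sum_{n\ge1}a_n\left(\frac{(10n-3)H_n^{(3)}}{3n^2(2n-1)}-\frac{38n-17}{3n^5(2n-1)}\right)=-\frac{16}3\zeta(5)+\frac23\pi^2\zeta(3),\\ &\sum_{n\ge1}a_n\left(\frac{(10n-3)H_{2n}^{(3)}}{3n^2(2n-1)}+\frac{32n-17}{12n^5(2n-1)}\right)=\frac83\zeta(5)-\frac7{18}\pi^2\zeta(3),\\ &\sum_{n\ge1}a_n\left(\frac{H_{2n}^{(2)}}{n^3}-\frac{32}{5n^5}\right)=-\frac{41}5\zeta(5)+\frac{14}{15}\pi^2\zeta(3),\\ &\sum_{n\ge1}a_n\left(\frac{(10n-3)H_n^{(4)}}{3n^2(2n-1)}-\frac{4(7n-3)}{3n^6(2n-1)}\right)=\frac{\pi^6}{1215}+\frac8{15}\zeta(3)^2,\\ &\sum_{n\ge1}a_n\left(\frac{H_{2n}^{(3)}}{n^3}+\frac{4(10n-3)H_{2n}^{(4)}}{5n^2(2n-1)}+\frac{6n-5}{20n^6(2n-1)}\right)=-\frac{3\zeta(3)^2}{10}-\frac{23\pi^6}{7560},\\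 &\sum_{n\ge1}a_n\left(\frac{10H_nH_{2n}^{(2)}}{n^3}-\frac{64H_n}{n^5}-\frac{3H_{2n}^{(2)}}{n^4}-\frac{10H_{2n}^{(3)}}{n^3}+\frac2{n^6}\right)=\frac{23\pi^6}{378}-\frac{92\zeta(3)^2}5,\\ &\sum_{n\ge1}a_n\Bigg(-\frac{2(34n-15)}{n^8(2n-1)}+\frac{2(26n-11)H_n^{(2)}}{n^6(2n-1)}-\frac{(18n-7)\left((H_n^{(2)})^2-H_n^{(4)}\right)}{n^4(2n-1)}\\ &\qquad\qquad+\frac{(10n-3)\left((H_n^{(2)})^3-3H_n^{(2)}H_n^{(4)}+2H_n^{(6)}\right)}{3n^2(2n-1)}\Bigg)=\frac{2\pi^8}{4725}. \end{aligned}$$ All these series converge absolutely. -/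

import Mathlib

namespace DougallII

noncomputable section

/-- The rising factorial `(x)_n = x (x + 1) ⋯ (x + n - 1)`. -/
def rf (x : ℂ) (n : ℕ) : ℂ := (ascPochhammer ℂ n).eval x

/-- `z` is not a pole of the Gamma function. -/
def NotPole (z : ℂ) : Prop := ∀ m : ℕ, z ≠ -(m : ℂ)

/-- The generalized harmonic number `H_n^{(s)}`. -/
def H (s n : ℕ) : ℂ := ∑ j ∈ Finset.Icc 1 n, 1 / (j : ℂ) ^ s

/-- `a_n = (-1/4)^n (1)_n / (1/2)_n`. -/
def aSeq (n : ℕ) : ℂ := (-1 / 4) ^ n * rf 1 n / rf (1 / 2) n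

/-- The WZ-seed attached to the very-well-poised `₅F₄` summation formula. -/
def dougall5F4 (a b c d k : ℂ) : ℂ :=
  (a + 2 * k) * Complex.Gamma (a + k) * Complex.Gamma (b + k) * Complex.Gamma (c + k) *
      Complex.Gamma (d + k) * Complex.Gamma (a - b - c + 1) * Complex.Gamma (a - b - d + 1) *
      Complex.Gamma (a - c - d + 1) /
    (Complex.Gamma b * Complex.Gamma c * Complex.Gamma d * Complex.Gamma (k + 1) *
      Complex.Gamma (a - b + k + 1) * Complex.Gamma (a - c + k + 1) *
      Complex.Gamma (a - d + k + 1) * Complex.Gamma (a - b - c - d + 1))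

/-- The polynomial `P(n)` in the summand `S₁`. -/
def P₁ (a b c d e n : ℂ) : ℂ :=
  2 * a ^ 3 - a ^ 2 * (4 * b + 2 * c + 2 * d - 6 * e + 1)
    + a * (2 * b ^ 2 + b * (2 * c + 2 * d - 10 * e + 1) + 2 * c * d - 4 * c * e + c
        - 4 * d * e + 6 * e ^ 2 - 2 * e)
    + e * (4 * b ^ 2 + b * (4 * c + 4 * d - 4 * e + 2) + (c - e) * (2 * d - 2 * e + 1))
    + n * (10 * a ^ 2 - a * (14 * b + 6 * c + 6 * d - 22 * e + 3) + 4 * b ^ 2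
        + 2 * b * (2 * c + 2 * d - 8 * e + 1) + 2 * c * d - 8 * c * e + c - 8 * d * e
        + 10 * e ^ 2 - 4 * e)
    + 3 * n ^ 2 * (6 * a - 4 * b - 2 * c - 2 * d + 6 * e - 1) + 10 * n ^ 3

/-- The summand `S₁(a,b,c,d,e;n)`, for `n ≥ 1`. -/
def S₁ (a b c d e : ℂ) (n : ℕ) : ℂ :=
  (-1) ^ (n - 1) * P₁ a b c d e n * rf (1 - b) (n - 1) * rf (a + e + 1) (n - 1) *
      rf (c + e + 1) (n - 1) * rf (a - b - c + 1) (n - 1) * rf (d + e + 1 / 2) n *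
      rf (a - b - d + 1 / 2) (n - 1) /
    (2 * rf (e + 1) n * rf (a - c + e + 1) n * rf (a - d + e + 1 / 2) n *
      rf (a - b - c - d + 1 / 2) n * rf (a - b + e + 1) (2 * n))

/-- The `k`-th term, `k ≥ 0`, of the very-well-poised series. -/
def wellPoisedTerm (a b c d e : ℂ) (k : ℕ) : ℂ :=
  (a + 2 * e + 2 * k + 2) * rf (a + e + 1) k * rf (b + e + 1) k * rf (c + e + 1) k *
      rf (d + e + 1 / 2) (k + 1) /
    (rf (e + 1) (k + 1) * rf (a - b + e + 1) (k + 1) * rf (a - c + e + 1) (k + 1) *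
      rf (a - d + e + 1 / 2) (k + 1))

/-- The very-well-poised series. -/
def wellPoised (a b c d e : ℂ) : ℂ := ∑' k : ℕ, wellPoisedTerm a b c d e k

/-- `F(n,k)`, obtained from the seed by shifting the parameters. -/
def F (a b c d e : ℂ) (n k : ℕ) : ℂ :=
  dougall5F4 a (b - n) c (d + 1 / 2) (k + e + n + 1)

/-- The product of Gamma values, independent of the summation index, by which `F(0,k)` differs
from the term of the very-well-poised series. -/
def gammaFactor (a b c d e : ℂ) : ℂ :=
  Complex.Gamma (a + e + 1) * Complex.Gamma (b + e + 1) * Complex.Gamma (c + e + 1) *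
      Complex.Gamma (d + e + 1 / 2) * Complex.Gamma (a - b - c + 1) *
      Complex.Gamma (a - b - d + 1 / 2) * Complex.Gamma (a - c - d + 1 / 2) /
    (Complex.Gamma b * Complex.Gamma c * Complex.Gamma (d + 1 / 2) * Complex.Gamma (e + 1) *
      Complex.Gamma (a - b + e + 1) * Complex.Gamma (a - c + e + 1) *
      Complex.Gamma (a - d + e + 1 / 2) * Complex.Gamma (a - b - c - d + 1 / 2))

/-- `G(n,k)`, the hypergeometric WZ-mate of `F(n,k)`. -/
def G (a b c d e : ℂ) (n k : ℕ) : ℂ :=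
  gammaFactor a b c d (e + k) * S₁ a b c d (e + k) (n + 1)

/-- No rising factorial in a denominator of the identity vanishes, apart from
`(a - b - c - d + 1/2)_n`. -/
def Admissible (a b c d e : ℂ) : Prop :=
  NotPole (e + 1) ∧ NotPole (a - b + e + 1) ∧ NotPole (a - c + e + 1) ∧
    NotPole (a - d + e + 1 / 2)

/-- The Gamma values in the numerators of `F(n,k)` and of `gammaFactor` are finite, and
`(a - b - c - d + 1/2)_n` does not vanish. -/
def GammaRegular (a b c d e : ℂ) : Prop :=
  NotPole (a + e + 1) ∧ NotPole (b + e + 1) ∧ NotPole (c + e + 1) ∧ NotPole (d + e + 1 / 2) ∧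
    NotPole (a - b - c + 1) ∧ NotPole (a - b - d + 1 / 2) ∧ NotPole (a - c - d + 1 / 2) ∧
    NotPole (a - b - c - d + 1 / 2)

/-- The polynomial in the summand `S`. -/
def P₀ (a b c d e n : ℂ) : ℂ :=
  a ^ 3 - a ^ 2 * (b + c + 2 * d - 3 * e)
    + a * (b * (c + d - 2 * e) + c * d - 2 * c * e + d ^ 2 - 5 * d * e + 3 * e ^ 2)
    + n * (5 * a ^ 2 - a * (3 * b + 3 * c + 7 * d - 11 * e) + b * (c + 2 * d - 4 * e)
        + 2 * c * d - 4 * c * e + 2 * d ^ 2 - 8 * d * e + 5 * e ^ 2)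
    + n ^ 2 * (9 * a - 3 * (b + c + 2 * d - 3 * e))
    + e * (b * (c + 2 * d - e) + 2 * c * d - c * e + 2 * d ^ 2 - 2 * d * e + e ^ 2)
    + 5 * n ^ 3

/-- The summand `S(a,b,c,d,e;n)`, for `n ≥ 1`, of the companion five-parameter identity. -/
def S (a b c d e : ℂ) (n : ℕ) : ℂ :=
  (-1) ^ (n - 1) * rf (1 - d) (n - 1) * rf (a + e + 1) (n - 1) * rf (b + e + 1) (n - 1) *
      rf (c + e + 1) (n - 1) * rf (a - b - d + 1) (n - 1) * rf (a - c - d + 1) (n - 1) *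
      P₀ a b c d e n /
    (rf (e + 1) n * rf (a - b + e + 1) n * rf (a - c + e + 1) n * rf (a - d + e + 1) (2 * n) *
      rf (a - b - c - d + 1) n)

/-- `S₂ = a S`. -/
def S₂ (a b c d e : ℂ) (n : ℕ) : ℂ := a * S a b c d e n

/-- The coefficient of `a^{r 0} b^{r 1} c^{r 2} d^{r 3} e^{r 4}` in the power series expansion
at the origin of a function `f(a,b,c,d,e)` that is analytic there. -/
def coeff (f : ℂ → ℂ → ℂ → ℂ → ℂ → ℂ) (r : Fin 5 → ℕ) : ℂ :=
  iteratedDeriv (r 0) (fun a =>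
    iteratedDeriv (r 1) (fun b =>
      iteratedDeriv (r 2) (fun c =>
        iteratedDeriv (r 3) (fun d =>
          iteratedDeriv (r 4) (fun e => f a b c d e) 0) 0) 0) 0) 0 /
    ((∏ i, (r i).factorial : ℕ) : ℂ)

/-- `V_N(T)`: the rational span of the coefficients of all monomials of degree `N` in
`T(a,b,c,d,e;n)`, regarded as functions of `n ≥ 1`. -/
def V (T : ℂ → ℂ → ℂ → ℂ → ℂ → ℕ → ℂ) (N : ℕ) : Submodule ℚ (ℕ+ → ℂ) :=
  Submodule.span ℚ {g | ∃ r : Fin 5 → ℕ, ∑ i, r i = N ∧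
    g = fun n : ℕ+ => coeff (fun a b c d e => T a b c d e n) r}

/-- The function `n ↦ a_n g(n)` on the positive integers. -/
def aTimes (g : ℕ → ℂ) : ℕ+ → ℂ := fun n => aSeq n * g n

/-- `∑_{n ≥ 1} a_n g(n) = s`, where the summand lies in `V_N(S₁) + V_N(S₂)`. -/
def CoeffIdentity (N : ℕ) (g : ℕ → ℂ) (s : ℂ) : Prop :=
  aTimes g ∈ V S₁ N ⊔ V S₂ N ∧ HasSum (aTimes g) s

end

end DougallII

namespace DougallII
noncomputable section

/-! ### Rising factorials -/

/-! The five-parameter identity is a Wilf–Zeilberger argument. After removal of the Gamma factors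
that do not depend on `n` and `k`, the pair `F`, `G` becomes `wzF`, `wzG`, two rational multiples of
one hypergeometric term `wzCore`, so the WZ equation is an identity of rational functions
(`wz_polynomial`). Summed over `k` its right side telescopes, and `wzG` tends to `0` in `k` because
`Re(a-b-c-d) > -1/2`. Hence the sum of `wzF n k` over `k` drops by `wzG n 0 = S₁(n+1)` when `n`
increases by one. For large `n` each step at least halves `‖wzF n k‖`, uniformly in `k`, so these
sums tend to `0` and the total drop is `wellPoised`. All sums are `HasSum` in `ℂ`, which amounts to
absolute convergence.

For the coefficients, `S₁(n+1) 2^n / (n+1)` is shown to be an analytic function of the parameters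
with values in the Banach space of bounded sequences. Summation against the weights `(n+1) 2^(-n)`
is a continuous linear functional there, so it commutes with all derivatives (`hasSum_coeff`,
`hasSum_taylor_onLine`).

The explicit evaluations come from restriction to lines through the origin with rational direction.
A Taylor coefficient of `S₁` on such a line lies in `V S₁ N`, and it is computed from a logarithmic
derivative built out of harmonic numbers. Its sum over `n` is the Taylor coefficient of `wellPoised`
on that line. For `e = 0`, `1 + b c * wellPoised` is Dougall's very-well-poised series: a contiguous
relation in `a` exhibits it as a limit of finite products of rising factorials (`dougall_finite`),
whose logarithmic derivatives converge to zeta values (`jetRec_dougall`). Symmetries of the series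
carry some other lines to `e = 0`, and on lines with `a = d = 0`, `c = -b` the terms are rational
and sum directly to a zeta value (`lineW_rational`).

Each identity is then a rational combination of lines. Its summand is a polynomial identity in
`1/n`, `1/(2n-1)` and harmonic numbers, its value an identity among zeta values. Every summand
already lies in `V S₁ N`. -/

@[simp] theorem rf_zero (x : ℂ) : rf x 0 = 1 := by simp [rf]

theorem rf_succ (x : ℂ) (n : ℕ) : rf x (n + 1) = rf x n * (x + n) := by
  simp [rf, ascPochhammer_succ_eval]

theorem rf_add (x : ℂ) (m n : ℕ) : rf x (m + n) = rf x m * rf (x + m) n := by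
  induction n with
  | zero => simp
  | succ n ih => rw [← add_assoc, rf_succ, ih, rf_succ]; push_cast; ring

theorem rf_succ' (x : ℂ) (n : ℕ) : rf x (n + 1) = x * rf (x + 1) n := by
  rw [add_comm, rf_add]; simp [rf_succ]

theorem NotPole.add_nat {z : ℂ} (h : NotPole z) (n : ℕ) : NotPole (z + n) := by
  intro m hm
  apply h (m + n)
  push_cast
  linear_combination hm

theorem NotPole.add_nat_ne {z : ℂ} (h : NotPole z) (n : ℕ) : z + n ≠ 0 := by
  intro hm
  exact h n (by linear_combination hm)

theorem NotPole.ne_zero {z : ℂ} (h : NotPole z) : z ≠ 0 := by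
  simpa using h.add_nat_ne 0

theorem NotPole.rf_ne_zero {z : ℂ} (h : NotPole z) (n : ℕ) : rf z n ≠ 0 := by
  induction n with
  | zero => simp
  | succ n ih => rw [rf_succ]; exact mul_ne_zero ih (h.add_nat_ne n)

theorem notPole_of_re_pos {z : ℂ} (h : 0 < z.re) : NotPole z := by
  intro m hm
  rw [hm] at h
  simp at h
  linarith [(Nat.cast_nonneg m : (0 : ℝ) ≤ m)]

theorem Gamma_add_nat {z : ℂ} (h : NotPole z) (n : ℕ) :
    Complex.Gamma (z + n) = Complex.Gamma z * rf z n := by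
  induction n with
  | zero => simp
  | succ n ih =>
    rw [rf_succ, ← mul_assoc, ← ih]
    push_cast
    rw [← add_assoc, Complex.Gamma_add_one _ (h.add_nat_ne n)]
    ring

/-- The reciprocal Gamma function is entire, so its functional equation excludes no poles; at a
nonpositive integer `b` both sides are `0`. This lets `F`, which contains `1/Γ(b - n)`, be treated
without a condition on `b` itself. -/
theorem inv_Gamma_sub_nat (b : ℂ) (n : ℕ) :
    (Complex.Gamma (b - n))⁻¹ = (-1) ^ n * rf (1 - b) n * (Complex.Gamma b)⁻¹ := by
  induction n with
  | zero => simp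
  | succ n ih =>
    have h := Complex.one_div_Gamma_eq_self_mul_one_div_Gamma_add_one (b - (n + 1))
    rw [show b - (n + 1 : ℂ) + 1 = b - n by ring, ih] at h
    push_cast
    rw [h, rf_succ, pow_succ]
    ring

/-! ### The Wilf–Zeilberger pair -/

/-- The common hypergeometric factor of the normalized Wilf–Zeilberger pair. -/
def wzCore (a b c d e : ℂ) (n k : ℕ) : ℂ :=
  ((-1) ^ n * rf (1 - b) n * rf (a + e + 1) (n + k) * rf (b + e + 1) k * rf (c + e + 1) (n + k) *
      rf (a - b - c + 1) n * rf (d + e + 1 / 2) (n + k + 1) * rf (a - b - d + 1 / 2) n) /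
    (rf (e + 1) (n + k + 1) * rf (a - c + e + 1) (n + k + 1) *
      rf (a - d + e + 1 / 2) (n + k + 1) * rf (a - b - c - d + 1 / 2) n *
      rf (a - b + e + 1) (2 * n + k + 1))

/-- `F(n,k)` divided by `gammaFactor`. -/
def wzF (a b c d e : ℂ) (n k : ℕ) : ℂ :=
  wzCore a b c d e n k * (a + 2 * (e + k + n + 1))

/-- `G(n,k)` divided by `gammaFactor`. -/
def wzG (a b c d e : ℂ) (n k : ℕ) : ℂ :=
  wzCore a b c d e n k *
    (P₁ a b c d (e + k) (n + 1) /
      (2 * (a - b + e + 1 + (2 * n + k + 1 : ℕ)) * (a - b - c - d + 1 / 2 + n)))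

theorem wzCore_succ_left (a b c d e : ℂ) (n k : ℕ) :
    wzCore a b c d e (n + 1) k = wzCore a b c d e n k *
      (-((1 - b + n) * (a + e + 1 + (n + k : ℕ)) * (c + e + 1 + (n + k : ℕ)) *
        (a - b - c + 1 + n) * (d + e + 1 / 2 + (n + k + 1 : ℕ)) * (a - b - d + 1 / 2 + n)) /
      ((e + 1 + (n + k + 1 : ℕ)) * (a - c + e + 1 + (n + k + 1 : ℕ)) *
        (a - d + e + 1 / 2 + (n + k + 1 : ℕ)) * (a - b - c - d + 1 / 2 + n) *
        ((a - b + e + 1 + (2 * n + k + 1 : ℕ)) * (a - b + e + 1 + (2 * n + k + 1 + 1 : ℕ))))) := by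
  unfold wzCore
  rw [show n + 1 + k = n + k + 1 by ring, show 2 * (n + 1) + k + 1 = 2 * n + k + 1 + 1 + 1 by ring,
    div_mul_div_comm]
  simp only [rf_succ _ n, rf_succ _ (n + k + 1), rf_succ (a + e + 1) (n + k),
    rf_succ (c + e + 1) (n + k), rf_succ _ (2 * n + k + 1 + 1), rf_succ _ (2 * n + k + 1)]
  -- Only the new last factors of the rising factorials matter; as atoms they are not expanded by
  -- `ring`.
  generalize 1 - b + (n : ℂ) = x₁
  generalize a + e + 1 + ((n + k : ℕ) : ℂ) = x₂
  generalize c + e + 1 + ((n + k : ℕ) : ℂ) = x₃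
  generalize a - b - c + 1 + (n : ℂ) = x₄
  generalize d + e + 1 / 2 + ((n + k + 1 : ℕ) : ℂ) = x₅
  generalize a - b - d + 1 / 2 + (n : ℂ) = x₆
  generalize e + 1 + ((n + k + 1 : ℕ) : ℂ) = y₁
  generalize a - c + e + 1 + ((n + k + 1 : ℕ) : ℂ) = y₂
  generalize a - d + e + 1 / 2 + ((n + k + 1 : ℕ) : ℂ) = y₃
  generalize a - b - c - d + 1 / 2 + (n : ℂ) = y₄
  generalize a - b + e + 1 + ((2 * n + k + 1 : ℕ) : ℂ) = y₅
  generalize a - b + e + 1 + ((2 * n + k + 1 + 1 : ℕ) : ℂ) = y₆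
  congr 1 <;> ring

theorem wzCore_succ_right (a b c d e : ℂ) (n k : ℕ) :
    wzCore a b c d e n (k + 1) = wzCore a b c d e n k *
      (((b + e + 1 + k) * (a + e + 1 + (n + k : ℕ)) * (c + e + 1 + (n + k : ℕ)) *
        (d + e + 1 / 2 + (n + k + 1 : ℕ))) /
      ((e + 1 + (n + k + 1 : ℕ)) * (a - c + e + 1 + (n + k + 1 : ℕ)) *
        (a - d + e + 1 / 2 + (n + k + 1 : ℕ)) * (a - b + e + 1 + (2 * n + k + 1 : ℕ)))) := by
  unfold wzCore
  rw [show n + (k + 1) = n + k + 1 by ring, show 2 * n + (k + 1) + 1 = 2 * n + k + 1 + 1 by ring,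
    div_mul_div_comm]
  simp only [rf_succ _ (n + k + 1), rf_succ (a + e + 1) (n + k),
    rf_succ (c + e + 1) (n + k), rf_succ _ (2 * n + k + 1), rf_succ _ k]
  generalize b + e + 1 + (k : ℂ) = x₁
  generalize a + e + 1 + ((n + k : ℕ) : ℂ) = x₂
  generalize c + e + 1 + ((n + k : ℕ) : ℂ) = x₃
  generalize d + e + 1 / 2 + ((n + k + 1 : ℕ) : ℂ) = x₅
  generalize e + 1 + ((n + k + 1 : ℕ) : ℂ) = y₁
  generalize a - c + e + 1 + ((n + k + 1 : ℕ) : ℂ) = y₂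
  generalize a - d + e + 1 / 2 + ((n + k + 1 : ℕ) : ℂ) = y₃
  generalize a - b + e + 1 + ((2 * n + k + 1 : ℕ) : ℂ) = y₅
  congr 1 <;> ring

/-- An increase of `n` can be absorbed by `b` and `e`, just as `F` depends on `b - n` and `e + n`.
The WZ equation for general `n`, `k` thereby reduces to one with last argument `1`. -/
theorem P₁_shift (a b c d e n : ℂ) (m : ℂ) :
    P₁ a b c d e (n + m) = P₁ a (b - m) c d (e + m) n := by
  unfold P₁; ring

theorem wz_fraction_aux {N M X Y p q k₁ k₂ k₃ k₄ k₅ k₆ : ℂ} (h₁ : k₁ ≠ 0) (h₂ : k₂ ≠ 0)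
    (h₃ : k₃ ≠ 0) (h₄ : k₄ ≠ 0) (h₅ : k₅ ≠ 0) (h₆ : k₆ ≠ 0)
    (h : -2 * N * X - 2 * Y * (k₁ * k₄ * k₅ * k₆ * k₂ * k₃) = M * p - q * (k₁ * k₄ * k₅ * k₃)) :
    -N / (k₁ * k₄ * k₅ * k₆ * (k₂ * k₃)) * X - Y =
      M / (k₁ * k₄ * k₅ * k₂) * (p / (2 * k₃ * k₆)) - q / (2 * k₂ * k₆) := by
  field_simp
  linear_combination h

/-- This is the WZ equation divided by `wzCore`. With `b` standing for `b - n` and `K` for `e + k +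
n + 1`, neither `n` nor `k` occurs any more, and clearing denominators leaves a polynomial identity.
-/
theorem wz_polynomial (a b c d K : ℂ) (h1 : K + 1 ≠ 0) (h2 : a - b + K + 1 ≠ 0)
    (h3 : a - b + K + 2 ≠ 0) (h4 : a - c + K + 1 ≠ 0) (h5 : a - d + K + 1 / 2 ≠ 0)
    (h6 : a - b - c - d + 1 / 2 ≠ 0) :
    -((1 - b) * (a + K) * (c + K) * (a - b - c + 1) * (d + K + 1 / 2) * (a - b - d + 1 / 2)) /
        ((K + 1) * (a - c + K + 1) * (a - d + K + 1 / 2) * (a - b - c - d + 1 / 2) *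
          ((a - b + K + 1) * (a - b + K + 2))) * (a + 2 * (K + 1)) - (a + 2 * K) =
      ((b + K) * (a + K) * (c + K) * (d + K + 1 / 2)) /
        ((K + 1) * (a - c + K + 1) * (a - d + K + 1 / 2) * (a - b + K + 1)) *
        (P₁ a b c d K 1 / (2 * (a - b + K + 2) * (a - b - c - d + 1 / 2))) -
      P₁ a b c d (K - 1) 1 / (2 * (a - b + K + 1) * (a - b - c - d + 1 / 2)) := by
  apply wz_fraction_aux h1 h2 h3 h4 h5 h6
  unfold P₁
  ring

theorem wz_identity {a b c d e : ℂ} (h : Admissible a b c d e)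
    (h' : NotPole (a - b - c - d + 1 / 2)) (n k : ℕ) :
    wzF a b c d e (n + 1) k - wzF a b c d e n k = wzG a b c d e n (k + 1) - wzG a b c d e n k := by
  obtain ⟨h1, h2, h3, h4⟩ := h
  have key := wz_polynomial a (b - n) c d (e + k + n + 1)
    (by have := h1.add_nat_ne (k + n + 1); push_cast at this; convert this using 1; ring)
    (by have := h2.add_nat_ne (k + 2 * n + 1); push_cast at this; convert this using 1; ring)
    (by have := h2.add_nat_ne (k + 2 * n + 2); push_cast at this; convert this using 1; ring)
    (by have := h3.add_nat_ne (k + n + 1); push_cast at this; convert this using 1; ring)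
    (by have := h4.add_nat_ne (k + n + 1); push_cast at this; convert this using 1; ring)
    (by have := h'.add_nat_ne n; convert this using 1; ring)
  rw [show 1 - (b - n) = 1 - b + n by ring,
    show a + (e + k + n + 1) = a + e + 1 + (n + k : ℕ) by push_cast; ring,
    show c + (e + k + n + 1) = c + e + 1 + (n + k : ℕ) by push_cast; ring,
    show a - (b - n) - c + 1 = a - b - c + 1 + n by ring,
    show d + (e + k + n + 1) + 1 / 2 = d + e + 1 / 2 + (n + k + 1 : ℕ) by push_cast; ring,
    show a - (b - n) - d + 1 / 2 = a - b - d + 1 / 2 + n by ring,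
    show e + k + n + 1 + 1 = e + 1 + (n + k + 1 : ℕ) by push_cast; ring,
    show a - c + (e + k + n + 1) + 1 = a - c + e + 1 + (n + k + 1 : ℕ) by push_cast; ring,
    show a - d + (e + k + n + 1) + 1 / 2 = a - d + e + 1 / 2 + (n + k + 1 : ℕ) by
      push_cast; ring,
    show a - (b - n) - c - d + 1 / 2 = a - b - c - d + 1 / 2 + n by ring,
    show a - (b - n) + (e + k + n + 1) + 1 = a - b + e + 1 + (2 * n + k + 1 : ℕ) by
      push_cast; ring,
    show a - (b - n) + (e + k + n + 1) + 2 = a - b + e + 1 + (2 * n + k + 1 + 1 : ℕ) by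
      push_cast; ring,
    show b - n + (e + k + n + 1) = b + e + 1 + k by ring, add_sub_cancel_right] at key
  have hP : P₁ a b c d (e + (k + 1 : ℕ)) (n + 1) = P₁ a (b - n) c d (e + k + n + 1) 1 := by
    rw [add_comm (n : ℂ), P₁_shift]
    push_cast
    ring_nf
  have hP' : P₁ a b c d (e + k) (n + 1) = P₁ a (b - n) c d (e + k + n) 1 := by
    rw [add_comm (n : ℂ), P₁_shift]
  unfold wzF wzG
  rw [wzCore_succ_left, wzCore_succ_right, hP, hP', show 2 * n + (k + 1) + 1 = 2 * n + k + 1 + 1 by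
    ring, show e + (k : ℂ) + (n + 1 : ℕ) + 1 = e + 1 + (n + k + 1 : ℕ) by push_cast; ring]
  simp only [mul_assoc (wzCore a b c d e n k), ← mul_sub]
  rw [key]

theorem wzF_zero_left (a b c d e : ℂ) (k : ℕ) :
    wzF a b c d e 0 k = wellPoisedTerm a b c d e k := by
  unfold wzF wzCore wellPoisedTerm
  rw [div_mul_eq_mul_div]
  simp only [Nat.zero_add, mul_zero, rf_zero, pow_zero, Nat.cast_zero]
  congr 1 <;> ring

theorem wzG_zero_right (a b c d e : ℂ) (n : ℕ) : wzG a b c d e n 0 = S₁ a b c d e (n + 1) := by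
  unfold wzG wzCore S₁
  rw [div_mul_div_comm, show 2 * (n + 1) = 2 * n + 1 + 1 by ring, rf_succ (a - b + e + 1) (2*n+1),
    rf_succ (a - b - c - d + 1 / 2) n]
  simp only [Nat.add_zero, Nat.add_sub_cancel, rf_zero]
  push_cast
  congr 1
  · rw [add_zero]; ring
  · ring

/-- Splitting `(x)_(k+m)` as `(x)_k (x+k)_m` moves the shift by `k` into `e`. The ratio left over is
exactly the one that `gammaFactor` acquires under `e ↦ e + k`, whence `G_eq`. -/
theorem wzG_eq_gammaFree {a b c d e : ℂ} (n k : ℕ) : wzG a b c d e n k =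
    rf (a + e + 1) k * rf (b + e + 1) k * rf (c + e + 1) k * rf (d + e + 1 / 2) k /
      (rf (e + 1) k * rf (a - b + e + 1) k * rf (a - c + e + 1) k * rf (a - d + e + 1 / 2) k) *
      S₁ a b c d (e + k) (n + 1) := by
  unfold wzG wzCore S₁
  rw [div_mul_div_comm, div_mul_div_comm]
  rw [show n + k + 1 = k + (n + 1) by ring, show n + k = k + n by ring,
    show 2 * n + k + 1 = k + (2 * n + 1) by ring, show 2 * (n + 1) = 2 * n + 1 + 1 by ring]
  simp only [rf_add _ k, Nat.add_sub_cancel]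
  rw [rf_succ (a - b - c - d + 1 / 2) n, rf_succ (a - b + (e + k) + 1) (2 * n + 1)]
  have r : ∀ x y : ℂ, x + e + y + k = x + (e + k) + y := fun x y => by ring
  simp only [r, show e + 1 + (k : ℂ) = e + k + 1 by ring]
  push_cast
  congr 1 <;> ring

theorem gammaFactor_add_nat {a b c d e : ℂ} (h : Admissible a b c d e)
    (h' : GammaRegular a b c d e) (k : ℕ) : gammaFactor a b c d (e + k) = gammaFactor a b c d e *
    (rf (a + e + 1) k * rf (b + e + 1) k * rf (c + e + 1) k * rf (d + e + 1 / 2) k /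
      (rf (e + 1) k * rf (a - b + e + 1) k * rf (a - c + e + 1) k *
        rf (a - d + e + 1 / 2) k)) := by
  obtain ⟨h1, h2, h3, h4⟩ := h
  obtain ⟨g1, g2, g3, g4, -⟩ := h'
  unfold gammaFactor
  have r : ∀ x y : ℂ, x + (e + k) + y = x + e + y + k := fun x y => by ring
  simp only [r, show e + (k : ℂ) + 1 = e + 1 + k by ring]
  rw [Gamma_add_nat h1, Gamma_add_nat h2, Gamma_add_nat h3, Gamma_add_nat h4, Gamma_add_nat g1,
    Gamma_add_nat g2, Gamma_add_nat g3, Gamma_add_nat g4, div_mul_div_comm]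
  congr 1 <;> ring

theorem G_eq {a b c d e : ℂ} (h : Admissible a b c d e) (h' : GammaRegular a b c d e) (n k : ℕ) :
    G a b c d e n k = gammaFactor a b c d e * wzG a b c d e n k := by
  unfold G
  rw [gammaFactor_add_nat h h', wzG_eq_gammaFree, mul_assoc]

theorem F_eq {a b c d e : ℂ} (h : Admissible a b c d e) (h' : GammaRegular a b c d e) (n k : ℕ) :
    F a b c d e n k = gammaFactor a b c d e * wzF a b c d e n k := by
  obtain ⟨h1, h2, h3, h4⟩ := h
  obtain ⟨g1, g2, g3, g4, g5, g6, g7, g8⟩ := h'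
  unfold F dougall5F4 gammaFactor wzF wzCore
  rw [show a + (k + e + n + 1) = a + e + 1 + (n + k : ℕ) by push_cast; ring,
    show b - n + (k + e + n + 1) = b + e + 1 + k by ring,
    show c + (k + e + n + 1) = c + e + 1 + (n + k : ℕ) by push_cast; ring,
    show d + 1 / 2 + (k + e + n + 1) = d + e + 1 / 2 + (n + k + 1 : ℕ) by push_cast; ring,
    show a - (b - n) - c + 1 = a - b - c + 1 + n by ring,
    show a - (b - n) - (d + 1 / 2) + 1 = a - b - d + 1 / 2 + n by ring,
    show a - c - (d + 1 / 2) + 1 = a - c - d + 1 / 2 by ring,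
    show k + e + n + 1 + 1 = e + 1 + (n + k + 1 : ℕ) by push_cast; ring,
    show a - (b - n) + (k + e + n + 1) + 1 = a - b + e + 1 + (2 * n + k + 1 : ℕ) by
      push_cast; ring,
    show a - c + (k + e + n + 1) + 1 = a - c + e + 1 + (n + k + 1 : ℕ) by push_cast; ring,
    show a - (d + 1 / 2) + (k + e + n + 1) + 1 = a - d + e + 1 / 2 + (n + k + 1 : ℕ) by
      push_cast; ring,
    show a - (b - n) - c - (d + 1 / 2) + 1 = a - b - c - d + 1 / 2 + n by ring]
  rw [Gamma_add_nat h1, Gamma_add_nat h2, Gamma_add_nat h3, Gamma_add_nat h4, Gamma_add_nat g1,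
    Gamma_add_nat g2, Gamma_add_nat g3, Gamma_add_nat g4, Gamma_add_nat g5, Gamma_add_nat g6,
    Gamma_add_nat g8]
  simp only [div_eq_mul_inv, mul_inv, inv_Gamma_sub_nat]
  ring

theorem F_zero_left {a b c d e : ℂ} (h : Admissible a b c d e) (h' : GammaRegular a b c d e)
    (k : ℕ) : F a b c d e 0 k = gammaFactor a b c d e * wellPoisedTerm a b c d e k := by
  rw [F_eq h h', wzF_zero_left]

theorem F_sub_F {a b c d e : ℂ} (h : Admissible a b c d e) (h' : GammaRegular a b c d e)
    (n k : ℕ) : F a b c d e (n + 1) k - F a b c d e n k =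
      G a b c d e n (k + 1) - G a b c d e n k := by
  rw [F_eq h h', F_eq h h', G_eq h h', G_eq h h', ← mul_sub, ← mul_sub,
    wz_identity h h'.2.2.2.2.2.2.2]

end

noncomputable section

open Filter Topology Asymptotics

/-! ### Growth of rising factorials -/

theorem GammaSeq_eq (x : ℂ) (n : ℕ) :
    Complex.GammaSeq x n = (n : ℂ) ^ x * n.factorial / rf x (n + 1) := by
  have h : ∀ m : ℕ, ∏ j ∈ Finset.range m, (x + j) = rf x m := by
    intro m
    induction m with
    | zero => simp
    | succ m ih => rw [Finset.prod_range_succ, ih, rf_succ]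
  rw [Complex.GammaSeq, h]

/-- Away from the poles this is Euler's limit for `1/Γ(x)`; at a pole the rising factorial is
eventually `0`. Numerator parameters are therefore unrestricted in the growth bounds. -/
theorem exists_tendsto_rf_div (x : ℂ) : ∃ l : ℂ,
    Tendsto (fun n : ℕ => rf x (n + 1) / ((n : ℂ) ^ x * n.factorial)) atTop (𝓝 l) := by
  by_cases hx : NotPole x
  · refine ⟨(Complex.Gamma x)⁻¹, ?_⟩
    have := (Complex.GammaSeq_tendsto_Gamma x).inv₀ (Complex.Gamma_ne_zero hx)
    refine this.congr fun n => ?_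
    rw [GammaSeq_eq, inv_div]
  · refine ⟨0, ?_⟩
    simp only [NotPole, not_forall, not_not] at hx
    obtain ⟨m, hm⟩ := hx
    refine tendsto_const_nhds.congr' ?_
    filter_upwards [eventually_ge_atTop m] with n hn
    obtain ⟨j, rfl⟩ := Nat.exists_eq_add_of_le hn
    rw [show m + j + 1 = m + 1 + j by ring, rf_add, rf_succ, hm]
    simp

theorem rf_div_isBigO (x : ℂ) {y : ℂ} (hy : NotPole y) :
    (fun n : ℕ => rf x n / rf y n) =O[atTop] fun n : ℕ => (n : ℝ) ^ (x.re - y.re) := by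
  obtain ⟨l, hl⟩ := exists_tendsto_rf_div x
  have h1 := (hl.mul (Complex.GammaSeq_tendsto_Gamma y)).isBigO_one ℝ
  -- Euler's limit concerns `(x)_(n+1)`; this bounded quotient takes off the last factors.
  have h2 : (fun n : ℕ => (y + n) / (x + n)) =O[atTop] fun _ : ℕ => (1 : ℝ) := by
    have h0 : ∀ z : ℂ, Tendsto (fun n : ℕ => z / n) atTop (𝓝 0) := fun z =>
      tendsto_const_div_atTop_nhds_zero_nat z
    have : Tendsto (fun n : ℕ => (y / n + 1) / (x / n + 1)) atTop (𝓝 ((0 + 1) / (0 + 1))) :=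
      ((h0 y).add_const 1).div ((h0 x).add_const 1) (by norm_num)
    refine (this.congr' ?_).isBigO_one ℝ
    filter_upwards [eventually_ne_atTop 0] with n hn
    have hn' : (n : ℂ) ≠ 0 := by exact_mod_cast hn
    rw [div_add_one hn', div_add_one hn', div_div_div_cancel_right₀ hn']
  have h3 : (fun n : ℕ => (n : ℂ) ^ (x - y)) =O[atTop] fun n : ℕ => (n : ℝ) ^ (x.re - y.re) := by
    refine IsBigO.of_bound 1 ?_
    filter_upwards [eventually_gt_atTop 0] with n hn
    rw [Complex.norm_natCast_cpow_of_pos hn, one_mul, Complex.sub_re, Real.norm_of_nonneg]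
    positivity
  have h := (h1.mul h2).mul h3
  refine (h.congr' ?_ ?_)
  · have hx : ∀ᶠ n : ℕ in atTop, x + n ≠ 0 := by
      by_cases hx : NotPole x
      · exact Eventually.of_forall hx.add_nat_ne
      · simp only [NotPole, not_forall, not_not] at hx
        obtain ⟨m, rfl⟩ := hx
        filter_upwards [eventually_gt_atTop m] with n hn h0
        have : (n : ℂ) = m := by linear_combination h0
        have : n = m := by exact_mod_cast this
        omega
    filter_upwards [eventually_gt_atTop 0, hx] with n hn hx
    have hn' : (n : ℂ) ≠ 0 := by exact_mod_cast hn.ne'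
    have hy' := hy.add_nat_ne n
    have hr := hy.rf_ne_zero n
    have hf : (n.factorial : ℂ) ≠ 0 := by exact_mod_cast n.factorial_ne_zero
    have hc : (n : ℂ) ^ x ≠ 0 := by simp [Complex.cpow_eq_zero_iff, hn']
    have hc' : (n : ℂ) ^ y ≠ 0 := by simp [Complex.cpow_eq_zero_iff, hn']
    rw [GammaSeq_eq, rf_succ, rf_succ, Complex.cpow_sub _ _ hn']
    field_simp
  · filter_upwards with n
    simp

/-- The quotient `(y)_n / (y+1)_n` telescopes to `y / (y+n)`, so `rf_div_isBigO` applies. -/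
theorem inv_add_nat_isBigO {y : ℂ} (hy : NotPole y) :
    (fun n : ℕ => (y + n)⁻¹) =O[atTop] fun n : ℕ => (n : ℝ) ^ (-1 : ℝ) := by
  have hy1 : NotPole (y + 1) := by simpa using hy.add_nat 1
  have h := (rf_div_isBigO y hy1).const_mul_left y⁻¹
  have h' : (fun n : ℕ => (n : ℝ) ^ (y.re - (y + 1).re)) = fun n : ℕ => (n : ℝ) ^ (-1 : ℝ) := by
    simp
  rw [h'] at h
  refine h.congr_left fun n => ?_
  have e : y * rf (y + 1) n = rf y n * (y + n) := by rw [← rf_succ', rf_succ]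
  have h1 := hy1.rf_ne_zero n
  have h2 := hy.rf_ne_zero n
  have h3 := hy.ne_zero
  have h4 := hy.add_nat_ne n
  field_simp
  linear_combination -e

theorem rpow_mul_rpow_eventuallyEq (s t : ℝ) :
    (fun n : ℕ => (n : ℝ) ^ s * (n : ℝ) ^ t) =ᶠ[atTop] fun n : ℕ => (n : ℝ) ^ (s + t) := by
  filter_upwards [eventually_gt_atTop 0] with n hn
  rw [Real.rpow_add (by exact_mod_cast hn)]

theorem isBigO_mul_rpow {f g : ℕ → ℂ} {s t : ℝ} (hf : f =O[atTop] fun n : ℕ => (n : ℝ) ^ s)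
    (hg : g =O[atTop] fun n : ℕ => (n : ℝ) ^ t) :
    (fun n => f n * g n) =O[atTop] fun n : ℕ => (n : ℝ) ^ (s + t) :=
  (hf.mul hg).trans (rpow_mul_rpow_eventuallyEq s t).isBigO

theorem isBigO_rpow_of_le {s t : ℝ} (h : s ≤ t) :
    (fun n : ℕ => (n : ℝ) ^ s) =O[atTop] fun n : ℕ => (n : ℝ) ^ t := by
  refine IsBigO.of_bound 1 ?_
  filter_upwards [eventually_ge_atTop 1] with n hn
  have hn' : (1 : ℝ) ≤ n := by exact_mod_cast hn
  rw [Real.norm_of_nonneg (by positivity), Real.norm_of_nonneg (by positivity), one_mul]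
  exact Real.rpow_le_rpow_of_exponent_le hn' h

theorem natCast_pow_isBigO (j : ℕ) :
    (fun n : ℕ => (n : ℂ) ^ j) =O[atTop] fun n : ℕ => (n : ℝ) ^ (j : ℝ) := by
  refine IsBigO.of_bound 1 (Eventually.of_forall fun n => ?_)
  simp

theorem cubic_isBigO (p₀ p₁ p₂ p₃ : ℂ) :
    (fun n : ℕ => p₀ + p₁ * n + p₂ * (n : ℂ) ^ 2 + p₃ * (n : ℂ) ^ 3) =O[atTop]
      fun n : ℕ => (n : ℝ) ^ (3 : ℝ) := by
  have h : ∀ (p : ℂ) (j : ℕ), j ≤ 3 → (fun n : ℕ => p * (n : ℂ) ^ j) =O[atTop]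
      fun n : ℕ => (n : ℝ) ^ (3 : ℝ) := fun p j hj =>
    ((natCast_pow_isBigO j).const_mul_left p).trans (isBigO_rpow_of_le (by exact_mod_cast hj))
  simpa using (((h p₀ 0 (by omega)).add (h p₁ 1 (by omega))).add (h p₂ 2 (by omega))).add
    (h p₃ 3 (by omega))

theorem P₁_isBigO_right (a b c d e m : ℂ) :
    (fun n : ℕ => P₁ a b c d e (n + m)) =O[atTop] fun n : ℕ => (n : ℝ) ^ (3 : ℝ) := by
  -- A cubic is recovered from its values at `-1`, `0`, `1` and its leading coefficient, which is
  -- `10` in the variable `n`.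
  have h := cubic_isBigO (P₁ a b c d e m)
    ((P₁ a b c d e (m + 1) - P₁ a b c d e (m - 1)) / 2 - 10)
    ((P₁ a b c d e (m + 1) + P₁ a b c d e (m - 1)) / 2 - P₁ a b c d e m) 10
  refine h.congr_left fun n => ?_
  unfold P₁
  ring

theorem P₁_isBigO_left (a b c d e m : ℂ) :
    (fun k : ℕ => P₁ a b c d (e + k) m) =O[atTop] fun n : ℕ => (n : ℝ) ^ (3 : ℝ) := by
  -- The same interpolation in the variable `e`, where the leading coefficient is `2`.
  have h := cubic_isBigO (P₁ a b c d e m)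
    ((P₁ a b c d (e + 1) m - P₁ a b c d (e - 1) m) / 2 - 2)
    ((P₁ a b c d (e + 1) m + P₁ a b c d (e - 1) m) / 2 - P₁ a b c d e m) 2
  refine h.congr_left fun n => ?_
  unfold P₁
  ring

/-! ### Convergence in the direction of `k` -/

/-- Each of the four numerator factors that vary with `k` is paired with a denominator factor, and
the exponent is the sum of the four differences of real parts. Everything else is constant in `k`.
-/
theorem wzCore_isBigO {a b c d e : ℂ} (h : Admissible a b c d e) (n : ℕ) :
    (fun k : ℕ => wzCore a b c d e n k) =O[atTop]
      fun k : ℕ => (k : ℝ) ^ (-2 * (a - b - c - d).re - 2 * n - 3) := by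
  obtain ⟨h1, h2, h3, h4⟩ := h
  have H := isBigO_mul_rpow (isBigO_mul_rpow
    (isBigO_mul_rpow (rf_div_isBigO (a + e + 1 + n) (h1.add_nat (n + 1)))
      (rf_div_isBigO (b + e + 1) (h2.add_nat (2 * n + 1))))
    (rf_div_isBigO (c + e + 1 + n) (h3.add_nat (n + 1))))
    (rf_div_isBigO (d + e + 1 / 2 + (n + 1 : ℕ)) (h4.add_nat (n + 1)))
  have H' := H.const_mul_left ((-1) ^ n * rf (1 - b) n * rf (a + e + 1) n * rf (c + e + 1) n *
      rf (a - b - c + 1) n * rf (d + e + 1 / 2) (n + 1) * rf (a - b - d + 1 / 2) n /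
    (rf (e + 1) (n + 1) * rf (a - c + e + 1) (n + 1) *
      rf (a - d + e + 1 / 2) (n + 1) * rf (a - b - c - d + 1 / 2) n *
      rf (a - b + e + 1) (2 * n + 1)))
  refine (H'.congr_left fun k => ?_).trans (EventuallyEq.of_eq ?_).isBigO
  · unfold wzCore
    rw [show n + k + 1 = n + 1 + k by ring, show 2 * n + k + 1 = 2 * n + 1 + k by ring]
    simp only [rf_add _ n k, rf_add _ (n + 1) k, rf_add _ (2 * n + 1) k]
    rw [div_mul_div_comm, div_mul_div_comm, div_mul_div_comm, div_mul_div_comm]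
    congr 1 <;> ring
  · funext k
    congr 1
    simp
    ring

theorem linear_isBigO (x y : ℂ) :
    (fun k : ℕ => x + y * k) =O[atTop] fun k : ℕ => (k : ℝ) ^ (1 : ℝ) := by
  have h0 := ((natCast_pow_isBigO 0).const_mul_left x).trans
    (isBigO_rpow_of_le (show ((0 : ℕ) : ℝ) ≤ 1 by norm_num))
  have h1 := ((natCast_pow_isBigO 1).const_mul_left y).trans
    (isBigO_rpow_of_le (show ((1 : ℕ) : ℝ) ≤ 1 by norm_num))
  simpa using h0.add h1

/-- The linear factor raises the exponent to `-2 Re(a-b-c-d) - 2n - 2`, which is below `-1` for all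
`n ≥ 0` exactly under the assumption on the real part. -/
theorem summable_wzF {a b c d e : ℂ} (h : Admissible a b c d e)
    (hre : -(1 / 2) < (a - b - c - d).re) (n : ℕ) : Summable fun k : ℕ => wzF a b c d e n k := by
  have H := isBigO_mul_rpow (wzCore_isBigO h n) (linear_isBigO (a + 2 * (e + n + 1)) 2)
  refine summable_of_isBigO_nat (g := fun k : ℕ => (k : ℝ) ^ _) ?_ (H.congr_left fun k => ?_)
  · rw [Real.summable_nat_rpow]
    have : (0 : ℝ) ≤ n := n.cast_nonneg
    linarith
  · unfold wzF
    ring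

/-- The cubic and the linear denominator change the exponent by `3 - 1`, to `-2 Re(a-b-c-d) - 2n -
1`; the threshold for decay is the same as for summability of `wzF`. -/
theorem tendsto_wzG {a b c d e : ℂ} (h : Admissible a b c d e)
    (hre : -(1 / 2) < (a - b - c - d).re) (n : ℕ) :
    Tendsto (fun k : ℕ => wzG a b c d e n k) atTop (𝓝 0) := by
  have h2 := h.2.1.add_nat (2 * n + 1)
  have H := (isBigO_mul_rpow (isBigO_mul_rpow (wzCore_isBigO h n)
    (P₁_isBigO_left a b c d e (n + 1))) (inv_add_nat_isBigO h2)).const_mul_left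
      (2 * (a - b - c - d + 1 / 2 + n))⁻¹
  have H' := H.congr_left (f₂ := fun k : ℕ => wzG a b c d e n k) fun k => by
    unfold wzG
    simp only [div_eq_mul_inv, mul_inv]
    push_cast
    ring_nf
  refine H'.trans_tendsto ?_
  have hs : 0 < 2 * (a - b - c - d).re + 2 * n + 1 := by
    have : (0 : ℝ) ≤ n := n.cast_nonneg
    linarith
  refine ((tendsto_rpow_neg_atTop hs).comp tendsto_natCast_atTop_atTop).congr fun k => ?_
  simp only [Function.comp_apply]
  congr 1
  ring

/-! ### Geometric decay in the direction of `n` -/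

/-- The bound is required for all `j ≥ m` so that it can be used at `j = n + k` for every `k`
simultaneously. -/
theorem eventually_norm_add_le (x y : ℂ) :
    ∀ᶠ m : ℕ in atTop, ∀ j : ℕ, m ≤ j → ‖x + j‖ ≤ 11 / 10 * ‖y + j‖ := by
  obtain ⟨M, hM⟩ := exists_nat_gt (10 * ‖x‖ + 11 * ‖y‖)
  filter_upwards [eventually_ge_atTop M] with m hm j hj
  have hj' : 10 * ‖x‖ + 11 * ‖y‖ ≤ j := hM.le.trans (by exact_mod_cast hm.trans hj)
  have h1 : ‖x + j‖ ≤ ‖x‖ + j := by simpa using norm_add_le x (j : ℂ)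
  have h2 : (j : ℝ) - ‖y‖ ≤ ‖y + j‖ := by
    have := norm_sub_norm_le (j : ℂ) (-y)
    rw [sub_neg_eq_add, norm_neg, add_comm] at this
    simpa using this
  linarith

theorem eventually_norm_add_le' (x y : ℂ) :
    ∀ᶠ m : ℕ in atTop, ∀ k : ℕ, ‖x + m‖ ≤ 11 / 20 * ‖y + (2 * m + k : ℕ)‖ := by
  obtain ⟨M, hM⟩ := exists_nat_gt (10 * ‖x‖ + 11 / 2 * ‖y‖)
  filter_upwards [eventually_ge_atTop M] with m hm k
  have hm' : 10 * ‖x‖ + 11 / 2 * ‖y‖ ≤ m := hM.le.trans (by exact_mod_cast hm)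
  have h1 : ‖x + m‖ ≤ ‖x‖ + m := by simpa using norm_add_le x (m : ℂ)
  have h2 : ((2 * m + k : ℕ) : ℝ) - ‖y‖ ≤ ‖y + (2 * m + k : ℕ)‖ := by
    have := norm_sub_norm_le ((2 * m + k : ℕ) : ℂ) (-y)
    rw [sub_neg_eq_add, norm_neg, add_comm _ y, Complex.norm_natCast] at this
    exact this
  push_cast at h2
  have : (0 : ℝ) ≤ k := k.cast_nonneg
  push_cast
  linarith

/-- The ratio of consecutive terms is a product of five quotients close to `1` in norm and two of
the shape `n / (2n + k)`, at most about `1/2`. With ten percent of slack in each factor the bound is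
`(11/10)^5 (11/20)^2 < 1/2`, uniformly in `k`. -/
theorem eventually_norm_wzF_le {a b c d e : ℂ} (h : Admissible a b c d e)
    (h' : NotPole (a - b - c - d + 1 / 2)) :
    ∀ᶠ n : ℕ in atTop, ∀ k : ℕ, ‖wzF a b c d e (n + 1) k‖ ≤ 1 / 2 * ‖wzF a b c d e n k‖ := by
  filter_upwards [eventually_norm_add_le (a + e + 1) (e + 1 + 1),
    eventually_norm_add_le (c + e + 1) (a - c + e + 1 + 1),
    eventually_norm_add_le (d + e + 1 / 2 + 1) (a - d + e + 1 / 2 + 1),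
    eventually_norm_add_le (a - b - c + 1) (a - b - c - d + 1 / 2),
    eventually_norm_add_le (a / 2 + e + 2) (a / 2 + e + 1),
    eventually_norm_add_le' (1 - b) (a - b + e + 1 + 1),
    eventually_norm_add_le' (a - b - d + 1 / 2) (a - b + e + 1 + 2)] with n e1 e2 e3 e4 e5 e6 e7 k
  obtain ⟨h1, h2, h3, h4⟩ := h
  have d1 := e1 (n + k) (by omega)
  have d2 := e2 (n + k) (by omega)
  have d3 := e3 (n + k) (by omega)
  have d4 := e4 n le_rfl
  have d5 := e5 (n + k) (by omega)
  have d6 := e6 k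
  have d7 := e7 k
  have n1 : e + 1 + 1 + (n + k : ℕ) ≠ 0 := by
    convert h1.add_nat_ne (n + k + 1) using 1; push_cast; ring
  have n2 : a - c + e + 1 + 1 + (n + k : ℕ) ≠ 0 := by
    convert h3.add_nat_ne (n + k + 1) using 1; push_cast; ring
  have n3 : a - d + e + 1 / 2 + 1 + (n + k : ℕ) ≠ 0 := by
    convert h4.add_nat_ne (n + k + 1) using 1; push_cast; ring
  have n4 := h'.add_nat_ne n
  have n6 : a - b + e + 1 + 1 + (2 * n + k : ℕ) ≠ 0 := by
    convert h2.add_nat_ne (2 * n + k + 1) using 1; push_cast; ring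
  have n7 : a - b + e + 1 + 2 + (2 * n + k : ℕ) ≠ 0 := by
    convert h2.add_nat_ne (2 * n + k + 2) using 1; push_cast; ring
  unfold wzF
  rw [wzCore_succ_left]
  rw [show d + e + 1 / 2 + ((n + k + 1 : ℕ) : ℂ) = d + e + 1 / 2 + 1 + (n + k : ℕ) by
      push_cast; ring,
    show e + 1 + ((n + k + 1 : ℕ) : ℂ) = e + 1 + 1 + (n + k : ℕ) by push_cast; ring,
    show a - c + e + 1 + ((n + k + 1 : ℕ) : ℂ) = a - c + e + 1 + 1 + (n + k : ℕ) by
      push_cast; ring,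
    show a - d + e + 1 / 2 + ((n + k + 1 : ℕ) : ℂ) = a - d + e + 1 / 2 + 1 + (n + k : ℕ) by
      push_cast; ring,
    show a - b + e + 1 + ((2 * n + k + 1 : ℕ) : ℂ) = a - b + e + 1 + 1 + (2 * n + k : ℕ) by
      push_cast; ring,
    show a - b + e + 1 + ((2 * n + k + 1 + 1 : ℕ) : ℂ) = a - b + e + 1 + 2 + (2 * n + k : ℕ) by
      push_cast; ring,
    show a + 2 * (e + k + (n + 1 : ℕ) + 1) = 2 * (a / 2 + e + 2 + (n + k : ℕ)) by push_cast; ring,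
    show a + 2 * (e + k + n + 1) = 2 * (a / 2 + e + 1 + (n + k : ℕ)) by push_cast; ring]
  generalize a + e + 1 + ((n + k : ℕ) : ℂ) = x1 at *
  generalize c + e + 1 + ((n + k : ℕ) : ℂ) = x2 at *
  generalize d + e + 1 / 2 + 1 + ((n + k : ℕ) : ℂ) = x3 at *
  generalize a - b - c + 1 + (n : ℂ) = x4 at *
  generalize a / 2 + e + 2 + ((n + k : ℕ) : ℂ) = x5 at *
  generalize 1 - b + (n : ℂ) = x6 at *
  generalize a - b - d + 1 / 2 + (n : ℂ) = x7 at *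
  generalize e + 1 + 1 + ((n + k : ℕ) : ℂ) = y1 at *
  generalize a - c + e + 1 + 1 + ((n + k : ℕ) : ℂ) = y2 at *
  generalize a - d + e + 1 / 2 + 1 + ((n + k : ℕ) : ℂ) = y3 at *
  generalize a - b - c - d + 1 / 2 + (n : ℂ) = y4 at *
  generalize a / 2 + e + 1 + ((n + k : ℕ) : ℂ) = y5 at *
  generalize a - b + e + 1 + 1 + ((2 * n + k : ℕ) : ℂ) = y6 at *
  generalize a - b + e + 1 + 2 + ((2 * n + k : ℕ) : ℂ) = y7 at *
  have hD : 0 < ‖y1 * y2 * y3 * y4 * (y6 * y7)‖ := by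
    rw [norm_pos_iff]; simp [*]
  rw [norm_mul, norm_mul, norm_div, norm_mul (wzCore a b c d e n k), mul_div_assoc',
    div_mul_eq_mul_div, div_le_iff₀ hD]
  simp only [norm_neg, norm_mul]
  calc ‖wzCore a b c d e n k‖ * (‖x6‖ * ‖x1‖ * ‖x2‖ * ‖x4‖ * ‖x3‖ * ‖x7‖) * (‖(2 : ℂ)‖ * ‖x5‖)
      ≤ ‖wzCore a b c d e n k‖ * ((11 / 20 * ‖y6‖) * (11 / 10 * ‖y1‖) * (11 / 10 * ‖y2‖) *
        (11 / 10 * ‖y4‖) * (11 / 10 * ‖y3‖) * (11 / 20 * ‖y7‖)) * (‖(2 : ℂ)‖ * (11 / 10 * ‖y5‖)) := by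
        gcongr
    _ = (11 / 10) ^ 5 * (11 / 20) ^ 2 * (‖wzCore a b c d e n k‖ * (‖(2 : ℂ)‖ * ‖y5‖) *
        (‖y1‖ * ‖y2‖ * ‖y3‖ * ‖y4‖ * (‖y6‖ * ‖y7‖))) := by ring
    _ ≤ 1 / 2 * (‖wzCore a b c d e n k‖ * (‖(2 : ℂ)‖ * ‖y5‖) *
        (‖y1‖ * ‖y2‖ * ‖y3‖ * ‖y4‖ * (‖y6‖ * ‖y7‖))) := by
        gcongr; norm_num
    _ = _ := by ring

theorem exists_norm_wzF_le {a b c d e : ℂ} (h : Admissible a b c d e)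
    (h' : NotPole (a - b - c - d + 1 / 2)) :
    ∃ N : ℕ, ∀ j k : ℕ, ‖wzF a b c d e (N + j) k‖ ≤ (1 / 2) ^ j * ‖wzF a b c d e N k‖ := by
  obtain ⟨N, hN⟩ := eventually_atTop.mp (eventually_norm_wzF_le h h')
  refine ⟨N, fun j k => ?_⟩
  induction j with
  | zero => simp
  | succ j ih =>
    calc ‖wzF a b c d e (N + (j + 1)) k‖ ≤ 1 / 2 * ‖wzF a b c d e (N + j) k‖ :=
          hN (N + j) (by omega) k
      _ ≤ 1 / 2 * ((1 / 2) ^ j * ‖wzF a b c d e N k‖) := by gcongr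
      _ = _ := by ring

theorem tendsto_tsum_wzF {a b c d e : ℂ} (h : Admissible a b c d e)
    (h' : NotPole (a - b - c - d + 1 / 2)) (hre : -(1 / 2) < (a - b - c - d).re) :
    Tendsto (fun n : ℕ => ∑' k : ℕ, wzF a b c d e n k) atTop (𝓝 0) := by
  obtain ⟨N, hN⟩ := exists_norm_wzF_le h h'
  rw [← tendsto_add_atTop_iff_nat N]
  have hs := (summable_wzF h hre N).norm
  refine squeeze_zero_norm (a := fun j : ℕ => (1 / 2 : ℝ) ^ j * ∑' k, ‖wzF a b c d e N k‖)
    (fun j => ?_) ?_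
  · rw [← tsum_mul_left, add_comm]
    exact tsum_of_norm_bounded (hs.mul_left _).hasSum fun k => hN j k
  · simpa using (tendsto_pow_atTop_nhds_zero_of_lt_one (r := (1 / 2 : ℝ)) (by norm_num)
      (by norm_num)).mul_const (∑' k, ‖wzF a b c d e N k‖)

theorem tsum_wzF_succ {a b c d e : ℂ} (h : Admissible a b c d e)
    (h' : NotPole (a - b - c - d + 1 / 2)) (hre : -(1 / 2) < (a - b - c - d).re) (n : ℕ) :
    ∑' k : ℕ, wzF a b c d e (n + 1) k = ∑' k : ℕ, wzF a b c d e n k - wzG a b c d e n 0 := by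
  have hs := (summable_wzF h hre (n + 1)).sub (summable_wzF h hre n)
  have hl : HasSum (fun k : ℕ => wzF a b c d e (n + 1) k - wzF a b c d e n k)
      (0 - wzG a b c d e n 0) := by
    rw [hs.hasSum_iff_tendsto_nat]
    simp_rw [wz_identity h h']
    simp_rw [Finset.sum_range_sub (fun k => wzG a b c d e n k)]
    exact (tendsto_wzG h hre n).sub_const _
  have := hl.tsum_eq
  rw [(summable_wzF h hre (n + 1)).tsum_sub (summable_wzF h hre n)] at this
  linear_combination this

theorem sum_wzG {a b c d e : ℂ} (h : Admissible a b c d e)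
    (h' : NotPole (a - b - c - d + 1 / 2)) (hre : -(1 / 2) < (a - b - c - d).re) (n : ℕ) :
    ∑ i ∈ Finset.range n, wzG a b c d e i 0 =
      wellPoised a b c d e - ∑' k : ℕ, wzF a b c d e n k := by
  induction n with
  | zero => simp [wellPoised, wzF_zero_left]
  | succ n ih => rw [Finset.sum_range_succ, ih, tsum_wzF_succ h h' hre]; ring

/-- `wzG n 0` is `wzF n 0` times a cubic over three linear factors, hence `O(n^3 2^(-n))`. Only `k =
0` is involved, so no condition on the real part enters. -/
theorem summable_wzG_zero {a b c d e : ℂ} (h : Admissible a b c d e)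
    (h' : NotPole (a - b - c - d + 1 / 2)) : Summable fun n : ℕ => wzG a b c d e n 0 := by
  obtain ⟨N, hN⟩ := exists_norm_wzF_le h h'
  rw [← summable_nat_add_iff N]
  have hA : (fun n : ℕ => P₁ a b c d (e + (0 : ℕ)) (((n + N : ℕ) : ℂ) + 1)) =O[atTop]
      fun n : ℕ => (n : ℝ) ^ (3 : ℝ) := by
    refine (P₁_isBigO_right a b c d (e + (0 : ℕ)) (N + 1)).congr_left fun n => ?_
    push_cast
    ring_nf
  -- The linear factors in the denominator eventually have norm at least `1`, so they may simply be
  -- dropped.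
  have hinv : ∀ x y : ℂ, y ≠ 0 → ∀ᶠ n : ℕ in atTop, 1 ≤ ‖x + y * (n : ℂ)‖ := by
    intro x y hy
    obtain ⟨M, hM⟩ := exists_nat_gt ((1 + ‖x‖) / ‖y‖)
    filter_upwards [eventually_ge_atTop M] with n hn
    have hn' : (1 + ‖x‖) / ‖y‖ ≤ n := hM.le.trans (by exact_mod_cast hn)
    rw [div_le_iff₀ (norm_pos_iff.mpr hy)] at hn'
    have := norm_sub_norm_le (y * (n : ℂ)) (-x)
    rw [sub_neg_eq_add, norm_neg, add_comm, norm_mul, Complex.norm_natCast] at this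
    linarith
  have hB : (fun j : ℕ => wzG a b c d e (j + N) 0) =O[atTop]
      fun j : ℕ => (j : ℝ) ^ (3 : ℝ) * (1 / 2 : ℝ) ^ j := by
    have h1 : (fun j : ℕ => wzF a b c d e (N + j) 0) =O[atTop] fun j : ℕ => (1 / 2 : ℝ) ^ j := by
      refine IsBigO.of_bound ‖wzF a b c d e N 0‖ (Eventually.of_forall fun j => ?_)
      rw [Real.norm_of_nonneg (by positivity), mul_comm]
      exact hN j 0
    have h2 := hA.mul h1
    refine IsBigO.trans (IsBigO.of_bound 1 ?_) h2
    filter_upwards [hinv (a + 2 * (e + (0 : ℕ) + N + 1)) 2 two_ne_zero,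
      hinv (2 * (a - b + e + 1 + (2 * N + 0 + 1 : ℕ))) 4 (by norm_num),
      hinv (a - b - c - d + 1 / 2 + N) 1 one_ne_zero] with j i1 i2 i3
    unfold wzG wzF
    rw [show a + 2 * (e + (0 : ℕ) + ((N + j : ℕ) : ℂ) + 1) =
        a + 2 * (e + (0 : ℕ) + N + 1) + 2 * (j : ℂ) by push_cast; ring,
      show 2 * (a - b + e + 1 + ((2 * (j + N) + 0 + 1 : ℕ) : ℂ)) =
        2 * (a - b + e + 1 + (2 * N + 0 + 1 : ℕ)) + 4 * (j : ℂ) by push_cast; ring,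
      show a - b - c - d + 1 / 2 + ((j + N : ℕ) : ℂ) = a - b - c - d + 1 / 2 + N + 1 * (j : ℂ) by
        push_cast; ring, add_comm j N]
    simp only [norm_mul, norm_div, one_mul]
    set w := ‖wzCore a b c d e (N + j) 0‖
    set p := ‖P₁ a b c d (e + (0 : ℕ)) (((N + j : ℕ) : ℂ) + 1)‖
    have hp : p / (‖2 * (a - b + e + 1 + ((2 * N + 0 + 1 : ℕ) : ℂ)) + 4 * (j : ℂ)‖ *
        ‖a - b - c - d + 1 / 2 + N + 1 * (j : ℂ)‖) ≤ p :=
      div_le_self (norm_nonneg _) (by nlinarith)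
    simp only [one_mul] at hp
    calc _ ≤ w * p := by gcongr
      _ = p * (w * 1) := by ring
      _ ≤ _ := by gcongr
  refine summable_of_isBigO_nat ?_ hB
  have := summable_pow_mul_geometric_of_norm_lt_one (R := ℝ) 3 (r := 1 / 2) (by norm_num)
  refine this.congr fun j => ?_
  norm_cast

theorem hasSum_wzG {a b c d e : ℂ} (h : Admissible a b c d e)
    (hre : -(1 / 2) < (a - b - c - d).re) :
    HasSum (fun n : ℕ => wzG a b c d e n 0) (wellPoised a b c d e) := by
  have h' : NotPole (a - b - c - d + 1 / 2) := notPole_of_re_pos (by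
    rw [Complex.add_re]
    have : (1 / 2 : ℂ).re = 1 / 2 := by norm_num
    linarith)
  rw [(summable_wzG_zero h h').hasSum_iff_tendsto_nat]
  simp_rw [sum_wzG h h' hre]
  simpa using (tendsto_tsum_wzF h h' hre).const_sub (wellPoised a b c d e)

theorem summable_wellPoisedTerm {a b c d e : ℂ} (h : Admissible a b c d e)
    (hre : -(1 / 2) < (a - b - c - d).re) :
    Summable fun k : ℕ => wellPoisedTerm a b c d e k := by
  simpa only [wzF_zero_left] using summable_wzF h hre 0

theorem hasSum_pnat_iff {f : ℕ → ℂ} {s : ℂ} :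
    HasSum (fun n : ℕ+ => f n) s ↔ HasSum (fun n : ℕ => f (n + 1)) s := by
  rw [← Equiv.pnatEquivNat.symm.hasSum_iff]
  rfl

theorem hasSum_S₁ {a b c d e : ℂ} (h : Admissible a b c d e)
    (hre : -(1 / 2) < (a - b - c - d).re) :
    HasSum (fun n : ℕ+ => S₁ a b c d e n) (wellPoised a b c d e) := by
  rw [hasSum_pnat_iff (f := S₁ a b c d e)]
  simpa only [wzG_zero_right] using hasSum_wzG h hre

theorem hasSum_G {a b c d e : ℂ} (h : Admissible a b c d e) (h' : GammaRegular a b c d e)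
    (hre : -(1 / 2) < (a - b - c - d).re) :
    Summable (fun k : ℕ => F a b c d e 0 k) ∧
      HasSum (fun n : ℕ+ => G a b c d e ((n : ℕ) - 1) 0) (∑' k : ℕ, F a b c d e 0 k) := by
  simp_rw [F_zero_left h h', tsum_mul_left]
  refine ⟨(summable_wellPoisedTerm h hre).mul_left _, ?_⟩
  rw [hasSum_pnat_iff (f := fun n => G a b c d e (n - 1) 0)]
  simp only [Nat.add_sub_cancel, G_eq h h']
  exact (hasSum_wzG h hre).mul_left _

end

noncomputable section

open Filter Topology

/-! ### Partial derivatives of analytic functions of five variables -/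

section Partial

set_option linter.unusedSectionVars false

variable {W : Type*} [NormedAddCommGroup W] [NormedSpace ℂ W] [CompleteSpace W]

/-- The derivative of `f` in the direction `v`. -/
def dirDeriv (v : Fin 5 → ℂ) (f : (Fin 5 → ℂ) → W) (p : Fin 5 → ℂ) : W := fderiv ℂ f p v

/-- The partial derivative of `f` in the `i`-th variable. -/
def partialDeriv (i : Fin 5) (f : (Fin 5 → ℂ) → W) : (Fin 5 → ℂ) → W :=
  dirDeriv (Pi.single i 1) f

/-- Iterated partial derivatives in the variables of a list, with orders given by `r`. -/
def partialsList (l : List (Fin 5)) (r : Fin 5 → ℕ) (f : (Fin 5 → ℂ) → W) : (Fin 5 → ℂ) → W :=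
  l.foldr (fun i g => (partialDeriv i)^[r i] g) f

theorem analyticAt_dirDeriv {f : (Fin 5 → ℂ) → W} {p : Fin 5 → ℂ} (hf : AnalyticAt ℂ f p)
    (v : Fin 5 → ℂ) : AnalyticAt ℂ (dirDeriv v f) p :=
  ((ContinuousLinearMap.apply ℂ W v).analyticAt _).comp hf.fderiv

theorem analyticAt_iterate_dirDeriv {f : (Fin 5 → ℂ) → W} {p : Fin 5 → ℂ}
    (hf : AnalyticAt ℂ f p) (v : Fin 5 → ℂ) (k : ℕ) : AnalyticAt ℂ ((dirDeriv v)^[k] f) p := by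
  induction k with
  | zero => exact hf
  | succ k ih => rw [Function.iterate_succ_apply']; exact analyticAt_dirDeriv ih v

theorem analyticAt_partialsList {f : (Fin 5 → ℂ) → W} {p : Fin 5 → ℂ} (hf : AnalyticAt ℂ f p)
    (l : List (Fin 5)) (r : Fin 5 → ℕ) : AnalyticAt ℂ (partialsList l r f) p := by
  induction l with
  | nil => exact hf
  | cons i l ih => exact analyticAt_iterate_dirDeriv ih _ _

theorem dirDeriv_congr {f g : (Fin 5 → ℂ) → W} {p : Fin 5 → ℂ} (h : f =ᶠ[𝓝 p] g)
    (v : Fin 5 → ℂ) : dirDeriv v f =ᶠ[𝓝 p] dirDeriv v g := by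
  filter_upwards [h.fderiv (𝕜 := ℂ)] with q hq
  simp [dirDeriv, hq]

theorem iterate_dirDeriv_congr {f g : (Fin 5 → ℂ) → W} {p : Fin 5 → ℂ} (h : f =ᶠ[𝓝 p] g)
    (v : Fin 5 → ℂ) (k : ℕ) : (dirDeriv v)^[k] f =ᶠ[𝓝 p] (dirDeriv v)^[k] g := by
  induction k with
  | zero => exact h
  | succ k ih => simp only [Function.iterate_succ_apply']; exact dirDeriv_congr ih v

theorem partialsList_congr {f g : (Fin 5 → ℂ) → W} {p : Fin 5 → ℂ} (h : f =ᶠ[𝓝 p] g)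
    (l : List (Fin 5)) (r : Fin 5 → ℕ) : partialsList l r f =ᶠ[𝓝 p] partialsList l r g := by
  induction l with
  | nil => exact h
  | cons i l ih => exact iterate_dirDeriv_congr ih _ _

/-- Symmetry of the second derivative. It is asserted near `p`, not just at `p`, so that it can be
differentiated again. -/
theorem dirDeriv_comm {f : (Fin 5 → ℂ) → W} {p : Fin 5 → ℂ} (hf : AnalyticAt ℂ f p)
    (v w : Fin 5 → ℂ) : dirDeriv v (dirDeriv w f) =ᶠ[𝓝 p] dirDeriv w (dirDeriv v f) := by
  filter_upwards [hf.eventually_analyticAt] with q hq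
  have h : ∀ v w : Fin 5 → ℂ, dirDeriv v (dirDeriv w f) q = fderiv ℂ (fderiv ℂ f) q v w := by
    intro v w
    have := ((ContinuousLinearMap.apply ℂ W w).hasFDerivAt.comp q
      hq.fderiv.differentiableAt.hasFDerivAt).fderiv
    change fderiv ℂ (⇑(ContinuousLinearMap.apply ℂ W w) ∘ fderiv ℂ f) q v = _
    rw [this]
    rfl
  rw [h, h]
  exact (hq.contDiffAt (n := ⊤)).isSymmSndFDerivAt (by simp) v w

theorem iterate_dirDeriv_comm {f : (Fin 5 → ℂ) → W} {p : Fin 5 → ℂ} (hf : AnalyticAt ℂ f p)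
    (v w : Fin 5 → ℂ) (k : ℕ) :
    (dirDeriv v)^[k] (dirDeriv w f) =ᶠ[𝓝 p] dirDeriv w ((dirDeriv v)^[k] f) := by
  induction k with
  | zero => rfl
  | succ k ih =>
    simp only [Function.iterate_succ_apply']
    exact (dirDeriv_congr ih v).trans (dirDeriv_comm (analyticAt_iterate_dirDeriv hf v k) v w)

theorem partialsList_dirDeriv {f : (Fin 5 → ℂ) → W} {p : Fin 5 → ℂ} (hf : AnalyticAt ℂ f p)
    (l : List (Fin 5)) (r : Fin 5 → ℕ) (w : Fin 5 → ℂ) :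
    partialsList l r (dirDeriv w f) =ᶠ[𝓝 p] dirDeriv w (partialsList l r f) := by
  induction l with
  | nil => rfl
  | cons i l ih =>
    exact (iterate_dirDeriv_congr ih _ _).trans
      (iterate_dirDeriv_comm (analyticAt_partialsList hf l r) _ _ _)

/-- The extra derivative arises at the position of `j` and is commuted outwards past the variables
listed before it; as the list has no repetition, it arises only once. -/
theorem partialsList_add_single {f : (Fin 5 → ℂ) → W} {p : Fin 5 → ℂ} (hf : AnalyticAt ℂ f p)
    (l : List (Fin 5)) (hl : l.Nodup) (r : Fin 5 → ℕ) (j : Fin 5) :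
    partialsList l (r + Pi.single j 1) f =ᶠ[𝓝 p]
      if j ∈ l then partialDeriv j (partialsList l r f) else partialsList l r f := by
  induction l with
  | nil => rfl
  | cons i l ih =>
    rw [List.nodup_cons] at hl
    have ih := ih hl.2
    change (dirDeriv (Pi.single i 1))^[(r + Pi.single j 1 : Fin 5 → ℕ) i] (partialsList l _ f) =ᶠ[𝓝 p] _
    by_cases hij : j = i
    · subst hij
      rw [if_neg hl.1] at ih
      rw [if_pos (by simp)]
      refine (iterate_dirDeriv_congr ih _ _).trans ?_
      simp only [Pi.add_apply, Pi.single_eq_same, Function.iterate_succ_apply']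
      rfl
    · have e : (r + Pi.single j 1 : Fin 5 → ℕ) i = r i := by
        simp [Pi.single_eq_of_ne (Ne.symm hij)]
      rw [e]
      by_cases hjl : j ∈ l
      · rw [if_pos hjl] at ih
        rw [if_pos (by simp [hjl])]
        exact (iterate_dirDeriv_congr ih _ _).trans
          (iterate_dirDeriv_comm (analyticAt_partialsList hf l r) _ _ _)
      · rw [if_neg hjl] at ih
        rw [if_neg (by simp [hjl, hij])]
        exact iterate_dirDeriv_congr ih _ _

/-- The mixed partial derivative of multi-order `r`. -/
def partials (r : Fin 5 → ℕ) (f : (Fin 5 → ℂ) → W) : (Fin 5 → ℂ) → W :=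
  partialsList [0, 1, 2, 3, 4] r f

theorem partials_partialDeriv {f : (Fin 5 → ℂ) → W} {p : Fin 5 → ℂ} (hf : AnalyticAt ℂ f p)
    (r : Fin 5 → ℕ) (j : Fin 5) :
    partials r (partialDeriv j f) =ᶠ[𝓝 p] partials (r + Pi.single j 1) f := by
  refine (partialsList_dirDeriv hf _ r _).trans
    (EventuallyEq.trans ?_ (partialsList_add_single hf _ (by decide) r j).symm)
  rw [if_pos (by fin_cases j <;> decide)]
  rfl

theorem dirDeriv_clm {W' : Type*} [NormedAddCommGroup W'] [NormedSpace ℂ W'] [CompleteSpace W']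
    (L : W →L[ℂ] W') {f : (Fin 5 → ℂ) → W} {p : Fin 5 → ℂ} (hf : AnalyticAt ℂ f p)
    (v : Fin 5 → ℂ) : dirDeriv v (fun q => L (f q)) =ᶠ[𝓝 p] fun q => L (dirDeriv v f q) := by
  filter_upwards [hf.eventually_analyticAt] with q hq
  have := (L.hasFDerivAt.comp q hq.differentiableAt.hasFDerivAt).fderiv
  change fderiv ℂ (⇑L ∘ f) q v = _
  rw [this]
  rfl

theorem iterate_dirDeriv_clm {W' : Type*} [NormedAddCommGroup W'] [NormedSpace ℂ W']
    [CompleteSpace W'] (L : W →L[ℂ] W') {f : (Fin 5 → ℂ) → W} {p : Fin 5 → ℂ}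
    (hf : AnalyticAt ℂ f p) (v : Fin 5 → ℂ) (k : ℕ) :
    (dirDeriv v)^[k] (fun q => L (f q)) =ᶠ[𝓝 p] fun q => L ((dirDeriv v)^[k] f q) := by
  induction k with
  | zero => rfl
  | succ k ih =>
    simp only [Function.iterate_succ_apply']
    exact (dirDeriv_congr ih v).trans (dirDeriv_clm L (analyticAt_iterate_dirDeriv hf v k) v)

theorem partialsList_clm {W' : Type*} [NormedAddCommGroup W'] [NormedSpace ℂ W']
    [CompleteSpace W'] (L : W →L[ℂ] W') {f : (Fin 5 → ℂ) → W} {p : Fin 5 → ℂ}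
    (hf : AnalyticAt ℂ f p) (l : List (Fin 5)) (r : Fin 5 → ℕ) :
    partialsList l r (fun q => L (f q)) =ᶠ[𝓝 p] fun q => L (partialsList l r f q) := by
  induction l with
  | nil => rfl
  | cons i l ih =>
    exact (iterate_dirDeriv_congr ih _ _).trans
      (iterate_dirDeriv_clm L (analyticAt_partialsList hf l r) _ _)

theorem iteratedDeriv_comp_line {f : (Fin 5 → ℂ) → W} (p v : Fin 5 → ℂ) {z : ℂ}
    (hf : AnalyticAt ℂ f (p + z • v)) (k : ℕ) :
    iteratedDeriv k (fun x : ℂ => f (p + x • v)) z = (dirDeriv v)^[k] f (p + z • v) := by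
  induction k generalizing z with
  | zero => simp
  | succ k ih =>
    have hl : HasDerivAt (fun x : ℂ => p + x • v) v z := by
      simpa using ((hasDerivAt_id z).smul_const v).const_add p
    have hU : ∀ᶠ x in 𝓝 z, AnalyticAt ℂ f (p + x • v) :=
      hl.continuousAt.eventually hf.eventually_analyticAt
    rw [iteratedDeriv_succ, Function.iterate_succ_apply']
    have h1 : iteratedDeriv k (fun x : ℂ => f (p + x • v)) =ᶠ[𝓝 z]
        fun x => (dirDeriv v)^[k] f (p + x • v) := by
      filter_upwards [hU] with x hx using ih hx
    rw [h1.deriv_eq]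
    have hd := (analyticAt_iterate_dirDeriv hf v k).differentiableAt.hasFDerivAt
    exact (hd.comp_hasDerivAt z hl).deriv

theorem iteratedDeriv_update {f : (Fin 5 → ℂ) → W} {p : Fin 5 → ℂ} (hf : AnalyticAt ℂ f p)
    {i : Fin 5} (hi : p i = 0) (k : ℕ) :
    iteratedDeriv k (fun x : ℂ => f (Function.update p i x)) 0 = (partialDeriv i)^[k] f p := by
  have h := iteratedDeriv_comp_line p (Pi.single i 1) (z := 0) (by simpa using hf) k
  rw [zero_smul, add_zero] at h
  refine Eq.trans ?_ h
  congr 1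
  funext x
  congr 1
  funext j
  by_cases hj : j = i
  · subst hj; simp [hi]
  · simp [hj]

end Partial

/-- The function of five variables as a function on `ℂ⁵`. -/
def uncurry5 {W : Type*} (f : ℂ → ℂ → ℂ → ℂ → ℂ → W) (p : Fin 5 → ℂ) : W :=
  f (p 0) (p 1) (p 2) (p 3) (p 4)

/-- `coeff` is a nest of one-variable derivatives. The Fréchet form is what commutes with continuous
linear maps and decomposes directional derivatives. Variables are peeled off from `e` outwards, each
identity being needed in a neighbourhood because the next variable is still to be differentiated. -/
theorem coeff_eq_partials {f : ℂ → ℂ → ℂ → ℂ → ℂ → ℂ} (hf : AnalyticAt ℂ (uncurry5 f) 0)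
    (r : Fin 5 → ℕ) :
    coeff f r = partials r (uncurry5 f) 0 / ((∏ i, (r i).factorial : ℕ) : ℂ) := by
  unfold coeff
  congr 1
  set φ := uncurry5 f
  have c4 : ∀ a b c d : ℂ, AnalyticAt ℂ φ ![a, b, c, d, 0] →
      iteratedDeriv (r 4) (fun e => f a b c d e) 0 = (partialDeriv 4)^[r 4] φ ![a, b, c, d, 0] := by
    intro a b c d h
    rw [← iteratedDeriv_update h rfl]
    congr 1
  have c3 : ∀ a b c : ℂ, AnalyticAt ℂ φ ![a, b, c, 0, 0] →
      iteratedDeriv (r 3) (fun d => iteratedDeriv (r 4) (fun e => f a b c d e) 0) 0 =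
        partialsList [3, 4] r φ ![a, b, c, 0, 0] := by
    intro a b c h
    have hc : ContinuousAt (fun d : ℂ => (![a, b, c, d, 0] : Fin 5 → ℂ)) 0 := by
      refine Continuous.continuousAt (continuous_pi fun i => ?_)
      fin_cases i <;> simp <;> fun_prop
    change _ = (partialDeriv 3)^[r 3] (partialsList [4] r φ) _
    rw [← iteratedDeriv_update (analyticAt_partialsList h [4] r) rfl]
    refine Filter.EventuallyEq.iteratedDeriv_eq _ ?_
    filter_upwards [hc.eventually h.eventually_analyticAt] with d hd
    rw [c4 a b c d hd]
    change partialsList [4] r φ _ = _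
    congr 1
    funext j; fin_cases j <;> rfl
  have c2 : ∀ a b : ℂ, AnalyticAt ℂ φ ![a, b, 0, 0, 0] →
      iteratedDeriv (r 2) (fun c =>
        iteratedDeriv (r 3) (fun d => iteratedDeriv (r 4) (fun e => f a b c d e) 0) 0) 0 =
        partialsList [2, 3, 4] r φ ![a, b, 0, 0, 0] := by
    intro a b h
    have hc : ContinuousAt (fun c : ℂ => (![a, b, c, 0, 0] : Fin 5 → ℂ)) 0 := by
      refine Continuous.continuousAt (continuous_pi fun i => ?_)
      fin_cases i <;> simp <;> fun_prop
    change _ = (partialDeriv 2)^[r 2] (partialsList [3, 4] r φ) _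
    rw [← iteratedDeriv_update (analyticAt_partialsList h [3, 4] r) rfl]
    refine Filter.EventuallyEq.iteratedDeriv_eq _ ?_
    filter_upwards [hc.eventually h.eventually_analyticAt] with d hd
    rw [c3 a b d hd]
    congr 1
    funext j; fin_cases j <;> rfl
  have c1 : ∀ a : ℂ, AnalyticAt ℂ φ ![a, 0, 0, 0, 0] →
      iteratedDeriv (r 1) (fun b => iteratedDeriv (r 2) (fun c =>
        iteratedDeriv (r 3) (fun d => iteratedDeriv (r 4) (fun e => f a b c d e) 0) 0) 0) 0 =
        partialsList [1, 2, 3, 4] r φ ![a, 0, 0, 0, 0] := by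
    intro a h
    have hc : ContinuousAt (fun b : ℂ => (![a, b, 0, 0, 0] : Fin 5 → ℂ)) 0 := by
      refine Continuous.continuousAt (continuous_pi fun i => ?_)
      fin_cases i <;> simp <;> fun_prop
    change _ = (partialDeriv 1)^[r 1] (partialsList [2, 3, 4] r φ) _
    rw [← iteratedDeriv_update (analyticAt_partialsList h [2, 3, 4] r) rfl]
    refine Filter.EventuallyEq.iteratedDeriv_eq _ ?_
    filter_upwards [hc.eventually h.eventually_analyticAt] with d hd
    rw [c2 a d hd]
    congr 1
    funext j; fin_cases j <;> rfl
  have e0 : (![0, 0, 0, 0, 0] : Fin 5 → ℂ) = 0 := by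
    funext j; fin_cases j <;> rfl
  have hc : ContinuousAt (fun a : ℂ => (![a, 0, 0, 0, 0] : Fin 5 → ℂ)) 0 := by
    refine Continuous.continuousAt (continuous_pi fun i => ?_)
    fin_cases i <;> simp <;> fun_prop
  have h : AnalyticAt ℂ φ ![0, 0, 0, 0, 0] := by rwa [e0]
  rw [← e0]
  change _ = (partialDeriv 0)^[r 0] (partialsList [1, 2, 3, 4] r φ) _
  rw [← iteratedDeriv_update (analyticAt_partialsList h [1, 2, 3, 4] r) rfl]
  refine Filter.EventuallyEq.iteratedDeriv_eq _ ?_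
  filter_upwards [hc.eventually h.eventually_analyticAt] with d hd
  rw [c1 d hd]
  congr 1
  funext j; fin_cases j <;> rfl

theorem dirDeriv_eq_sum (v : Fin 5 → ℂ) (f : (Fin 5 → ℂ) → ℂ) :
    dirDeriv v f = fun p => ∑ i, v i * partialDeriv i f p := by
  funext p
  unfold partialDeriv dirDeriv
  conv_lhs => rw [pi_eq_sum_univ' v]
  simp [map_sum, Pi.single]

theorem partialsList_sum_mul {f : Fin 5 → (Fin 5 → ℂ) → ℂ} {p : Fin 5 → ℂ}
    (hf : ∀ i, AnalyticAt ℂ (f i) p) (v : Fin 5 → ℂ) (l : List (Fin 5)) (r : Fin 5 → ℕ) :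
    partialsList l r (fun q => ∑ i, v i * f i q) =ᶠ[𝓝 p]
      fun q => ∑ i, v i * partialsList l r (f i) q := by
  -- The sum is one linear functional applied to the vector-valued function with components `f i`,
  -- so `partialsList_clm` covers it.
  let L : (Fin 5 → ℂ) →L[ℂ] ℂ := ∑ i, v i • ContinuousLinearMap.proj i
  have hL : ∀ x, L x = ∑ i, v i * x i := by intro x; simp [L]
  have hF : AnalyticAt ℂ (fun q => fun i => f i q) p := AnalyticAt.pi hf
  have h1 := partialsList_clm L hF l r
  simp only [hL] at h1
  refine h1.trans ?_
  have h2 : ∀ᶠ q in 𝓝 p, ∀ i, partialsList l r (fun q => f i q) q =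
      partialsList l r (fun q => fun i => f i q) q i :=
    eventually_all.mpr fun i =>
      partialsList_clm (ContinuousLinearMap.proj (R := ℂ) (φ := fun _ : Fin 5 => ℂ) i) hF l r
  filter_upwards [h2] with q hq
  simp [hq]

/-- One derivative along `v` is the combination of partial derivatives with weights `v i`; iteration
yields the multinomial expansion, whose coefficients need not be known beyond being rational. The
index `n` is carried along because the same coefficients must serve for every `n`. -/
theorem iterate_dirDeriv_mem_span {ι : Type*} (f : ι → (Fin 5 → ℂ) → ℂ)
    (hf : ∀ n, AnalyticAt ℂ (f n) 0) (v : Fin 5 → ℚ) (N : ℕ) :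
    (fun n => (dirDeriv (fun i => (v i : ℂ)))^[N] (f n) 0) ∈
      Submodule.span ℚ {g : ι → ℂ | ∃ r : Fin 5 → ℕ, ∑ i, r i = N ∧
        g = fun n => partials r (f n) 0} := by
  induction N generalizing f with
  | zero => exact Submodule.subset_span ⟨0, by simp, rfl⟩
  | succ N ih =>
    simp only [Function.iterate_succ_apply]
    refine Submodule.span_induction (p := fun x _ => x ∈ _) ?_ (zero_mem _)
      (fun x y _ _ => add_mem) (fun q x _ => Submodule.smul_mem _ q)
      (ih _ fun n => analyticAt_dirDeriv (hf n) _)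
    rintro _ ⟨r, hr, rfl⟩
    have e : (fun n => partials r (dirDeriv (fun i => (v i : ℂ)) (f n)) 0) =
        ∑ i, v i • fun n => partials (r + Pi.single i 1) (f n) 0 := by
      funext n
      rw [dirDeriv_eq_sum]
      have := (partialsList_sum_mul (fun i => analyticAt_dirDeriv (hf n) (Pi.single i 1))
        (fun i => (v i : ℂ)) [0, 1, 2, 3, 4] r).eq_of_nhds
      refine this.trans ?_
      rw [Finset.sum_apply]
      refine Finset.sum_congr rfl fun i _ => ?_
      rw [Pi.smul_apply, Rat.smul_def, ← (partials_partialDeriv (hf n) r i).eq_of_nhds]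
      rfl
    rw [e]
    refine Submodule.sum_mem _ fun i _ => Submodule.smul_mem _ _ (Submodule.subset_span ?_)
    exact ⟨r + Pi.single i 1, by simp [Finset.sum_add_distrib, hr], rfl⟩

theorem line_coeff_mem_V {T : ℂ → ℂ → ℂ → ℂ → ℂ → ℕ → ℂ}
    (hT : ∀ n : ℕ+, AnalyticAt ℂ (uncurry5 fun a b c d e => T a b c d e n) 0) (v : Fin 5 → ℚ)
    (N : ℕ) : (fun n : ℕ+ => iteratedDeriv N (fun x : ℂ => T (x * v 0) (x * v 1) (x * v 2)
      (x * v 3) (x * v 4) n) 0 / (N.factorial : ℂ)) ∈ V T N := by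
  have h := iterate_dirDeriv_mem_span (fun n : ℕ+ => uncurry5 fun a b c d e => T a b c d e n) hT v N
  have h' : (fun n : ℕ+ => (dirDeriv (fun i => (v i : ℂ)))^[N]
      (uncurry5 fun a b c d e => T a b c d e n) 0) ∈ V T N := by
    refine Submodule.span_induction (p := fun x _ => x ∈ V T N) ?_ (zero_mem _)
      (fun x y _ _ => add_mem) (fun q x _ => Submodule.smul_mem _ q) h
    rintro _ ⟨r, hr, rfl⟩
    have e : (fun n : ℕ+ => partials r (uncurry5 fun a b c d e => T a b c d e n) 0) =
        ((∏ i, (r i).factorial : ℕ) : ℚ) • fun n : ℕ+ => coeff (fun a b c d e => T a b c d e n) r := by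
      funext n
      rw [Pi.smul_apply, coeff_eq_partials (hT n), Rat.smul_def, Rat.cast_natCast,
        mul_div_cancel₀]
      exact_mod_cast Finset.prod_ne_zero_iff.mpr fun i _ => (r i).factorial_ne_zero
    rw [e]
    exact Submodule.smul_mem _ _ (Submodule.subset_span ⟨r, hr, rfl⟩)
  have e : (fun n : ℕ+ => iteratedDeriv N (fun x : ℂ => T (x * v 0) (x * v 1) (x * v 2)
      (x * v 3) (x * v 4) n) 0 / (N.factorial : ℂ)) = ((N.factorial : ℚ)⁻¹) •
      (fun n : ℕ+ => (dirDeriv (fun i => (v i : ℂ)))^[N]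
        (uncurry5 fun a b c d e => T a b c d e n) 0) := by
    funext n
    have := iteratedDeriv_comp_line 0 (fun i => (v i : ℂ)) (z := 0) (by simpa using hT n) N
    rw [zero_smul, add_zero] at this
    rw [Pi.smul_apply, Rat.smul_def, ← this, div_eq_inv_mul]
    push_cast
    congr 2
    funext x
    simp [uncurry5]
  rw [e]
  exact Submodule.smul_mem _ _ h'

end

noncomputable section

open Filter Topology BoundedContinuousFunction

/-! ### Analytic families of bounded sequences -/

/-- The sequences `g p` form, for `p` near `0`, a family of bounded sequences that is analytic
in the uniform norm at `p = 0`. -/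
def AnalyticSeq (g : (Fin 5 → ℂ) → ℕ → ℂ) : Prop :=
  ∃ Φ : (Fin 5 → ℂ) → (ℕ →ᵇ ℂ), AnalyticAt ℂ Φ 0 ∧ ∀ᶠ p in 𝓝 0, ∀ n, Φ p n = g p n

theorem AnalyticSeq.congr {g h : (Fin 5 → ℂ) → ℕ → ℂ} (hg : AnalyticSeq g)
    (e : ∀ p n, g p n = h p n) : AnalyticSeq h := by
  have : g = h := by funext p n; exact e p n
  rwa [← this]

theorem AnalyticSeq.mul {g h : (Fin 5 → ℂ) → ℕ → ℂ} (hg : AnalyticSeq g) (hh : AnalyticSeq h) :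
    AnalyticSeq fun p n => g p n * h p n := by
  obtain ⟨Φ, a1, e1⟩ := hg
  obtain ⟨Ψ, a2, e2⟩ := hh
  refine ⟨fun p => Φ p * Ψ p, a1.mul a2, ?_⟩
  filter_upwards [e1, e2] with p h1 h2 n
  rw [BoundedContinuousFunction.mul_apply, h1, h2]

theorem AnalyticSeq.add {g h : (Fin 5 → ℂ) → ℕ → ℂ} (hg : AnalyticSeq g) (hh : AnalyticSeq h) :
    AnalyticSeq fun p n => g p n + h p n := by
  obtain ⟨Φ, a1, e1⟩ := hg
  obtain ⟨Ψ, a2, e2⟩ := hh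
  refine ⟨fun p => Φ p + Ψ p, a1.add a2, ?_⟩
  filter_upwards [e1, e2] with p h1 h2 n
  rw [BoundedContinuousFunction.add_apply, h1, h2]

theorem AnalyticSeq.of_analyticAt {l : (Fin 5 → ℂ) → ℂ} (hl : AnalyticAt ℂ l 0) :
    AnalyticSeq fun p _ => l p := by
  refine ⟨fun p => l p • (1 : ℕ →ᵇ ℂ), hl.smul analyticAt_const, Eventually.of_forall ?_⟩
  intro p n
  simp

/-- The bounded sequence `1 / (n + 1)`. -/
def invSeq : ℕ →ᵇ ℂ :=
  BoundedContinuousFunction.ofNormedAddCommGroupDiscrete (fun n : ℕ => ((n : ℂ) + 1)⁻¹) 1 (by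
    intro n
    rw [norm_inv]
    apply inv_le_one_of_one_le₀
    have : ((n : ℂ) + 1) = ((n + 1 : ℕ) : ℂ) := by push_cast; ring
    rw [this, Complex.norm_natCast]
    exact_mod_cast Nat.le_add_left 1 n)

theorem invSeq_apply (n : ℕ) : invSeq n = ((n : ℂ) + 1)⁻¹ := rfl

theorem AnalyticSeq.inv_nat : AnalyticSeq fun _ n => ((n : ℂ) + 1)⁻¹ :=
  ⟨fun _ => invSeq, analyticAt_const, Eventually.of_forall fun _ n => invSeq_apply n⟩

theorem AnalyticSeq.affine {l : (Fin 5 → ℂ) → ℂ} (hl : AnalyticAt ℂ l 0) :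
    AnalyticSeq fun p n => 1 + l p * ((n : ℂ) + 1)⁻¹ :=
  (AnalyticSeq.of_analyticAt analyticAt_const).add
    ((AnalyticSeq.of_analyticAt hl).mul AnalyticSeq.inv_nat)

/-- The inverse sequence `(n+1)/(n+1+y)` is bounded by `2`. The threshold `-1/2` is dictated by the
factor `n + 1/2 = (n+1)(1 - (1/2)/(n+1))` of the summand at the origin. -/
theorem isUnit_one_add_smul_invSeq {y : ℝ} (hy : -(1 / 2) ≤ y) :
    IsUnit (1 + (y : ℂ) • invSeq) := by
  rw [isUnit_iff_exists_inv]
  have hpos : ∀ n : ℕ, (0 : ℝ) < n + 1 + y := fun n => by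
    have : (0 : ℝ) ≤ n := n.cast_nonneg
    linarith
  refine ⟨BoundedContinuousFunction.ofNormedAddCommGroupDiscrete
    (fun n : ℕ => (((n + 1) / (n + 1 + y) : ℝ) : ℂ)) 2 ?_, ?_⟩
  · intro n
    have : (0 : ℝ) ≤ n := n.cast_nonneg
    rw [Complex.norm_real, Real.norm_of_nonneg (by have := hpos n; positivity),
      div_le_iff₀ (hpos n)]
    linarith
  · ext n
    have h1 : (n : ℂ) + 1 ≠ 0 := by exact_mod_cast n.succ_ne_zero
    have h2 : (n : ℂ) + 1 + y ≠ 0 := by exact_mod_cast (hpos n).ne'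
    change (1 + (y : ℂ) • ((n : ℂ) + 1)⁻¹) * (((n + 1) / (n + 1 + y) : ℝ) : ℂ) = 1
    push_cast
    rw [smul_eq_mul]
    field_simp

/-- Inversion is analytic near a unit of the Banach algebra of bounded sequences, so invertibility
has to be checked at `p = 0` only. -/
theorem AnalyticSeq.affine_inv {l : (Fin 5 → ℂ) → ℂ} (hl : AnalyticAt ℂ l 0) {y : ℝ}
    (h0 : l 0 = y) (hy : -(1 / 2) ≤ y) :
    AnalyticSeq fun p n => (1 + l p * ((n : ℂ) + 1)⁻¹)⁻¹ := by
  have hA : AnalyticAt ℂ (fun p => 1 + l p • invSeq) 0 :=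
    analyticAt_const.add (hl.smul analyticAt_const)
  have hu : IsUnit (1 + l 0 • invSeq) := by rw [h0]; exact isUnit_one_add_smul_invSeq hy
  obtain ⟨u, hu'⟩ := hu
  have hI := analyticAt_inverse (𝕜 := ℂ) u
  rw [hu'] at hI
  refine ⟨fun p => Ring.inverse (1 + l p • invSeq),
    AnalyticAt.comp (f := fun p => 1 + l p • invSeq) hI hA, ?_⟩
  have hev : ∀ᶠ p in 𝓝 (0 : Fin 5 → ℂ), IsUnit (1 + l p • invSeq) :=
    hA.continuousAt.eventually (Units.isOpen.mem_nhds ⟨u, hu'⟩)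
  filter_upwards [hev] with p hp n
  have := congrArg (fun f : ℕ →ᵇ ℂ => f n) (Ring.mul_inverse_cancel _ hp)
  simp only [BoundedContinuousFunction.mul_apply, BoundedContinuousFunction.add_apply,
    BoundedContinuousFunction.smul_apply, BoundedContinuousFunction.coe_one, Pi.one_apply, invSeq_apply,
    smul_eq_mul] at this
  exact eq_inv_of_mul_eq_one_right this

/-- The right shift on bounded sequences. -/
def shiftSeq : (ℕ →ᵇ ℂ) →L[ℂ] (ℕ →ᵇ ℂ) :=
  LinearMap.mkContinuous
    { toFun := fun y => BoundedContinuousFunction.ofNormedAddCommGroupDiscrete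
        (fun n : ℕ => Nat.casesOn n 0 fun m => y m) ‖y‖ (by
          intro n
          cases n with
          | zero => simp
          | succ m => exact y.norm_coe_le_norm m)
      map_add' := fun x y => by
        ext n
        cases n with
        | zero => simp
        | succ m => rfl
      map_smul' := fun c y => by
        ext n
        cases n with
        | zero => simp
        | succ m => rfl } 1 (by
    intro y
    rw [one_mul]
    refine (BoundedContinuousFunction.norm_le (norm_nonneg _)).mpr fun n => ?_
    cases n with
    | zero => exact norm_zero.le.trans (norm_nonneg y)
    | succ m => exact y.norm_coe_le_norm m)

theorem shiftSeq_zero (y : ℕ →ᵇ ℂ) : shiftSeq y 0 = 0 := rfl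

theorem shiftSeq_succ (y : ℕ →ᵇ ℂ) (n : ℕ) : shiftSeq y (n + 1) = y n := rfl

theorem norm_shiftSeq_le : ‖shiftSeq‖ ≤ 1 := LinearMap.mkContinuous_norm_le _ zero_le_one _

/-- The recurrence reads `g = g(0) δ + R g`, where `R` multiplies by `ρ` and shifts right and `δ` is
the first unit sequence. Since `‖R‖ ≤ 1/2` at `p = 0`, `1 - R` is invertible near `0` with inverse
analytic in `p`, and `g = g(0) (1 - R)⁻¹ δ`. -/
theorem AnalyticSeq.of_recurrence {g ρ : (Fin 5 → ℂ) → ℕ → ℂ}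
    (h0 : AnalyticAt ℂ (fun p => g p 0) 0) (hρ : AnalyticSeq ρ) (hb : ∀ n, ‖ρ 0 n‖ ≤ 1 / 2)
    (hg : ∀ p n, g p (n + 1) = ρ p n * g p n) : AnalyticSeq g := by
  obtain ⟨Φ, ha, he⟩ := hρ
  let R : (Fin 5 → ℂ) → ((ℕ →ᵇ ℂ) →L[ℂ] (ℕ →ᵇ ℂ)) := fun p =>
    shiftSeq.comp (ContinuousLinearMap.mul ℂ (ℕ →ᵇ ℂ) (Φ p))
  have hR : AnalyticAt ℂ R 0 :=
    (((ContinuousLinearMap.compL ℂ (ℕ →ᵇ ℂ) (ℕ →ᵇ ℂ) (ℕ →ᵇ ℂ) shiftSeq).comp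
      (ContinuousLinearMap.mul ℂ (ℕ →ᵇ ℂ))).analyticAt _).comp ha
  have hΦ : ‖Φ 0‖ ≤ 1 / 2 := by
    rw [BoundedContinuousFunction.norm_le (by norm_num)]
    intro n
    rw [he.self_of_nhds n]
    exact hb n
  have hR0 : ‖R 0‖ < 1 := by
    refine lt_of_le_of_lt (ContinuousLinearMap.opNorm_comp_le _ _) ?_
    calc ‖shiftSeq‖ * ‖ContinuousLinearMap.mul ℂ (ℕ →ᵇ ℂ) (Φ 0)‖ ≤ 1 * (1 / 2) := by
          gcongr
          · exact norm_shiftSeq_le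
          · exact (ContinuousLinearMap.opNorm_mul_apply_le ℂ _ _).trans hΦ
      _ < 1 := by norm_num
  have hA : AnalyticAt ℂ (fun p => 1 - R p) 0 := analyticAt_const.sub hR
  obtain ⟨u, hu⟩ := isUnit_one_sub_of_norm_lt_one (R := (ℕ →ᵇ ℂ) →L[ℂ] (ℕ →ᵇ ℂ)) (x := R 0) hR0
  have hI := analyticAt_inverse (𝕜 := ℂ) u
  rw [hu] at hI
  have hinv : AnalyticAt ℂ (fun p => Ring.inverse (1 - R p)) 0 :=
    AnalyticAt.comp (f := fun p => 1 - R p) hI hA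
  let δ : ℕ →ᵇ ℂ := BoundedContinuousFunction.ofNormedAddCommGroupDiscrete
    (fun n : ℕ => if n = 0 then 1 else 0) 1 (by intro n; split_ifs <;> simp)
  have hδ : ∀ n, δ n = if n = 0 then 1 else 0 := fun _ => rfl
  refine ⟨fun p => g p 0 • Ring.inverse (1 - R p) δ,
    h0.smul (((ContinuousLinearMap.apply ℂ (ℕ →ᵇ ℂ) δ).analyticAt _).comp hinv), ?_⟩
  have hev : ∀ᶠ p in 𝓝 (0 : Fin 5 → ℂ), IsUnit (1 - R p) :=
    hA.continuousAt.eventually (Units.isOpen.mem_nhds ⟨u, hu⟩)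
  filter_upwards [hev, he] with p hp hρ n
  -- Read entry by entry, the resolvent equation is the recurrence with initial value `1`.
  have key : ∀ m, Ring.inverse (1 - R p) δ m - shiftSeq (Φ p * Ring.inverse (1 - R p) δ) m =
      δ m := by
    intro m
    have := congrArg (fun A : (ℕ →ᵇ ℂ) →L[ℂ] (ℕ →ᵇ ℂ) => A δ m) (Ring.mul_inverse_cancel _ hp)
    exact this
  induction n with
  | zero =>
    have := key 0
    rw [shiftSeq_zero, hδ, if_pos rfl, sub_zero] at this
    rw [BoundedContinuousFunction.smul_apply, this, smul_eq_mul, mul_one]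
  | succ n ih =>
    have := key (n + 1)
    rw [shiftSeq_succ, hδ, if_neg n.succ_ne_zero, sub_eq_zero,
      BoundedContinuousFunction.mul_apply] at this
    rw [BoundedContinuousFunction.smul_apply, this, hg, ← ih, hρ,
      BoundedContinuousFunction.smul_apply, smul_eq_mul, smul_eq_mul]
    ring

/-! ### The summand as an analytic family -/

theorem summable_weight : Summable fun n : ℕ => ((n : ℝ) + 1) * (1 / 2) ^ n := by
  have h1 := summable_pow_mul_geometric_of_norm_lt_one (R := ℝ) 1 (r := 1 / 2) (by norm_num)
  have h0 := summable_pow_mul_geometric_of_norm_lt_one (R := ℝ) 0 (r := 1 / 2) (by norm_num)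
  refine (h1.add h0).congr fun n => ?_
  ring

theorem summable_weight_mul (y : ℕ →ᵇ ℂ) :
    Summable fun n : ℕ => (((n : ℂ) + 1) * (1 / 2) ^ n) * y n := by
  refine Summable.of_norm_bounded (summable_weight.mul_right ‖y‖) fun n => ?_
  rw [norm_mul]
  gcongr
  · rw [norm_mul, norm_pow]
    gcongr
    · refine (norm_add_le _ _).trans ?_
      simp
    · norm_num
  · exact y.norm_coe_le_norm n

/-- The weighted sum `∑ (n + 1) 2⁻ⁿ y n` of a bounded sequence. -/
def weightedSum : (ℕ →ᵇ ℂ) →L[ℂ] ℂ :=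
  LinearMap.mkContinuous
    { toFun := fun y => ∑' n : ℕ, (((n : ℂ) + 1) * (1 / 2) ^ n) * y n
      map_add' := fun x y => by
        rw [← (summable_weight_mul x).tsum_add (summable_weight_mul y)]
        refine tsum_congr fun n => ?_
        rw [BoundedContinuousFunction.add_apply]; ring
      map_smul' := fun c y => by
        rw [RingHom.id_apply, smul_eq_mul, ← tsum_mul_left]
        refine tsum_congr fun n => ?_
        rw [BoundedContinuousFunction.smul_apply, smul_eq_mul]; ring }
    (∑' n : ℕ, ((n : ℝ) + 1) * (1 / 2) ^ n) (by
      intro y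
      rw [← tsum_mul_right]
      refine tsum_of_norm_bounded (summable_weight.mul_right ‖y‖).hasSum fun n => ?_
      rw [norm_mul]
      gcongr
      · rw [norm_mul, norm_pow]
        gcongr
        · refine (norm_add_le _ _).trans ?_
          simp
        · norm_num
      · exact y.norm_coe_le_norm n)

theorem hasSum_weightedSum (y : ℕ →ᵇ ℂ) :
    HasSum (fun n : ℕ => (((n : ℂ) + 1) * (1 / 2) ^ n) * y n) (weightedSum y) :=
  (summable_weight_mul y).hasSum

theorem analyticAt_coord (i : Fin 5) : AnalyticAt ℂ (fun p : Fin 5 → ℂ => p i) 0 :=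
  (ContinuousLinearMap.proj (R := ℂ) (φ := fun _ : Fin 5 => ℂ) i).analyticAt 0

theorem analyticAt_linear (a b c d e y : ℂ) : AnalyticAt ℂ
    (fun p : Fin 5 → ℂ => a * p 0 + b * p 1 + c * p 2 + d * p 3 + e * p 4 + y) 0 := by
  have h : ∀ (c : ℂ) i, AnalyticAt ℂ (fun p : Fin 5 → ℂ => c * p i) 0 := fun c i =>
    analyticAt_const.mul (analyticAt_coord i)
  exact (((((h a 0).add (h b 1)).add (h c 2)).add (h d 3)).add (h e 4)).add analyticAt_const

/-- The ratio of consecutive terms of `wzCore` in `n` tends to `-1/4`. The factor `2^n` leaves room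
for uniform boundedness near the origin, while the doubled ratio at `p = 0` still has norm at most
`1/2`, as `AnalyticSeq.of_recurrence` demands. -/
theorem analyticSeq_wzCore :
    AnalyticSeq fun p n => 2 ^ n * wzCore (p 0) (p 1) (p 2) (p 3) (p 4) n 0 := by
  have N : ∀ a b c d e y : ℂ, AnalyticSeq fun p n =>
      1 + (a * p 0 + b * p 1 + c * p 2 + d * p 3 + e * p 4 + y) * ((n : ℂ) + 1)⁻¹ :=
    fun a b c d e y => AnalyticSeq.affine (analyticAt_linear a b c d e y)
  have D : ∀ (a b c d e : ℂ) (y : ℝ), -(1 / 2) ≤ y → AnalyticSeq fun p n =>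
      (1 + (a * p 0 + b * p 1 + c * p 2 + d * p 3 + e * p 4 + y) * ((n : ℂ) + 1)⁻¹)⁻¹ :=
    fun a b c d e y hy => AnalyticSeq.affine_inv (analyticAt_linear a b c d e y) (by simp) hy
  refine AnalyticSeq.of_recurrence
    (ρ := fun p n => 2 * (-((1 - p 1 + n) * (p 0 + p 4 + 1 + (n + 0 : ℕ)) *
      (p 2 + p 4 + 1 + (n + 0 : ℕ)) * (p 0 - p 1 - p 2 + 1 + n) *
      (p 3 + p 4 + 1 / 2 + (n + 0 + 1 : ℕ)) * (p 0 - p 1 - p 3 + 1 / 2 + n)) /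
      ((p 4 + 1 + (n + 0 + 1 : ℕ)) * (p 0 - p 2 + p 4 + 1 + (n + 0 + 1 : ℕ)) *
        (p 0 - p 3 + p 4 + 1 / 2 + (n + 0 + 1 : ℕ)) * (p 0 - p 1 - p 2 - p 3 + 1 / 2 + n) *
        ((p 0 - p 1 + p 4 + 1 + (2 * n + 0 + 1 : ℕ)) *
          (p 0 - p 1 + p 4 + 1 + (2 * n + 0 + 1 + 1 : ℕ)))))) ?_ ?_ ?_ ?_
  · have e : (fun p : Fin 5 → ℂ => 2 ^ 0 * wzCore (p 0) (p 1) (p 2) (p 3) (p 4) 0 0) =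
        fun p => (p 3 + p 4 + 1 / 2) / ((p 4 + 1) * (p 0 - p 2 + p 4 + 1) *
          (p 0 - p 3 + p 4 + 1 / 2) * (p 0 - p 1 + p 4 + 1)) := by
      funext p
      simp [wzCore, rf_succ]
    rw [e]
    have h0 := analyticAt_coord 0
    have h1 := analyticAt_coord 1
    have h2 := analyticAt_coord 2
    have h3 := analyticAt_coord 3
    have h4 := analyticAt_coord 4
    refine ((h3.add h4).add analyticAt_const).div ((((h4.add analyticAt_const).mul
      (((h0.sub h2).add h4).add analyticAt_const)).mul
      (((h0.sub h3).add h4).add analyticAt_const)).mul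
      (((h0.sub h1).add h4).add analyticAt_const)) ?_
    simp
  -- Every linear factor is `(n+1)(1 + l(p)/(n+1))`, with an additional factor `2` for the last two
  -- in the denominator. The powers of `n+1` cancel and the constant `-2/4 = -1/2` remains.
  · refine (((AnalyticSeq.of_analyticAt (analyticAt_const (v := -(1 / 2 : ℂ)))).mul
      ((((((N 0 (-1) 0 0 0 0).mul (N 1 0 0 0 1 0)).mul (N 0 0 1 0 1 0)).mul
        (N 1 (-1) (-1) 0 0 0)).mul (N 0 0 0 1 1 (1 / 2))).mul
        (N 1 (-1) 0 (-1) 0 (-(1 / 2))))).mul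
      ((((((D 0 0 0 0 1 1 (by norm_num)).mul (D 1 0 (-1) 0 1 1 (by norm_num))).mul
        (D 1 0 0 (-1) 1 (1 / 2) (by norm_num))).mul
        (D 1 (-1) (-1) (-1) 0 (-(1 / 2)) (by norm_num))).mul
        (D (1 / 2) (-(1 / 2)) 0 0 (1 / 2) 0 (by norm_num))).mul
        (D (1 / 2) (-(1 / 2)) 0 0 (1 / 2) (1 / 2) (by norm_num)))).congr fun p n => ?_
    have hm : (n : ℂ) + 1 ≠ 0 := by exact_mod_cast n.succ_ne_zero
    have r : ∀ x y : ℂ, x = y + (n + 1) → x = (n + 1) * (1 + y * ((n : ℂ) + 1)⁻¹) := by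
      intro x y h
      rw [h]
      field_simp
      ring
    rw [r (1 - p 1 + n) (0 * p 0 + -1 * p 1 + 0 * p 2 + 0 * p 3 + 0 * p 4 + 0) (by ring),
      r (p 0 + p 4 + 1 + (n + 0 : ℕ)) (1 * p 0 + 0 * p 1 + 0 * p 2 + 0 * p 3 + 1 * p 4 + 0)
        (by push_cast; ring),
      r (p 2 + p 4 + 1 + (n + 0 : ℕ)) (0 * p 0 + 0 * p 1 + 1 * p 2 + 0 * p 3 + 1 * p 4 + 0)
        (by push_cast; ring),
      r (p 0 - p 1 - p 2 + 1 + n) (1 * p 0 + -1 * p 1 + -1 * p 2 + 0 * p 3 + 0 * p 4 + 0) (by ring),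
      r (p 3 + p 4 + 1 / 2 + (n + 0 + 1 : ℕ))
        (0 * p 0 + 0 * p 1 + 0 * p 2 + 1 * p 3 + 1 * p 4 + 1 / 2) (by push_cast; ring),
      r (p 0 - p 1 - p 3 + 1 / 2 + n)
        (1 * p 0 + -1 * p 1 + 0 * p 2 + -1 * p 3 + 0 * p 4 + -(1 / 2)) (by ring),
      r (p 4 + 1 + (n + 0 + 1 : ℕ)) (0 * p 0 + 0 * p 1 + 0 * p 2 + 0 * p 3 + 1 * p 4 + (1 : ℝ))
        (by push_cast; ring),
      r (p 0 - p 2 + p 4 + 1 + (n + 0 + 1 : ℕ))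
        (1 * p 0 + 0 * p 1 + -1 * p 2 + 0 * p 3 + 1 * p 4 + (1 : ℝ)) (by push_cast; ring),
      r (p 0 - p 3 + p 4 + 1 / 2 + (n + 0 + 1 : ℕ))
        (1 * p 0 + 0 * p 1 + 0 * p 2 + -1 * p 3 + 1 * p 4 + (1 / 2 : ℝ)) (by push_cast; ring),
      r (p 0 - p 1 - p 2 - p 3 + 1 / 2 + n)
        (1 * p 0 + -1 * p 1 + -1 * p 2 + -1 * p 3 + 0 * p 4 + (-(1 / 2) : ℝ))
        (by push_cast; ring),
      show p 0 - p 1 + p 4 + 1 + (2 * n + 0 + 1 : ℕ) = 2 * ((n + 1) *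
        (1 + (1 / 2 * p 0 + -(1 / 2) * p 1 + 0 * p 2 + 0 * p 3 + 1 / 2 * p 4 + (0 : ℝ)) *
          ((n : ℂ) + 1)⁻¹)) by push_cast; field_simp; ring,
      show p 0 - p 1 + p 4 + 1 + (2 * n + 0 + 1 + 1 : ℕ) = 2 * ((n + 1) *
        (1 + (1 / 2 * p 0 + -(1 / 2) * p 1 + 0 * p 2 + 0 * p 3 + 1 / 2 * p 4 + (1 / 2 : ℝ)) *
          ((n : ℂ) + 1)⁻¹)) by push_cast; field_simp; ring]
    have f : ∀ m x1 x2 x3 x4 x5 x6 y1 y2 y3 y4 y5 y6 : ℂ, m ≠ 0 →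
        -(1 / 2) * (x1 * x2 * x3 * x4 * x5 * x6) *
          (y1⁻¹ * y2⁻¹ * y3⁻¹ * y4⁻¹ * y5⁻¹ * y6⁻¹) =
        2 * (-(m * x1 * (m * x2) * (m * x3) * (m * x4) * (m * x5) * (m * x6)) /
          (m * y1 * (m * y2) * (m * y3) * (m * y4) * (2 * (m * y5) * (2 * (m * y6))))) := by
      intro m x1 x2 x3 x4 x5 x6 y1 y2 y3 y4 y5 y6 hm
      rw [show -(m * x1 * (m * x2) * (m * x3) * (m * x4) * (m * x5) * (m * x6)) =
          m ^ 6 * -(x1 * x2 * x3 * x4 * x5 * x6) by ring,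
        show m * y1 * (m * y2) * (m * y3) * (m * y4) * (2 * (m * y5) * (2 * (m * y6))) =
          m ^ 6 * (4 * (y1 * y2 * y3 * y4 * y5 * y6)) by ring,
        mul_div_mul_left _ _ (pow_ne_zero 6 hm)]
      simp only [div_eq_mul_inv, mul_inv]
      ring
    exact f _ _ _ _ _ _ _ _ _ _ _ _ _ hm
  · intro n
    have hn : (0 : ℝ) ≤ n := n.cast_nonneg
    -- At the origin the factors `n + 1/2` and `n + 3/2` cancel between numerator and denominator.
    have e : (2 * (-((1 - 0 + n) * (0 + 0 + 1 + (n + 0 : ℕ)) *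
      (0 + 0 + 1 + (n + 0 : ℕ)) * (0 - 0 - 0 + 1 + n) *
      (0 + 0 + 1 / 2 + (n + 0 + 1 : ℕ)) * (0 - 0 - 0 + 1 / 2 + n)) /
      ((0 + 1 + (n + 0 + 1 : ℕ)) * (0 - 0 + 0 + 1 + (n + 0 + 1 : ℕ)) *
        (0 - 0 + 0 + 1 / 2 + (n + 0 + 1 : ℕ)) * (0 - 0 - 0 - 0 + 1 / 2 + n) *
        ((0 - 0 + 0 + 1 + (2 * n + 0 + 1 : ℕ)) *
          (0 - 0 + 0 + 1 + (2 * n + 0 + 1 + 1 : ℕ))))) : ℂ) =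
        ((-((n + 1) ^ 3 / ((n + 2) ^ 2 * (2 * n + 3))) : ℝ) : ℂ) := by
      have i1 : (n : ℂ) + 1 ≠ 0 := by exact_mod_cast n.succ_ne_zero
      have i2 : (n : ℂ) + 2 ≠ 0 := by exact_mod_cast (n + 1).succ_ne_zero
      have i3 : 2 * (n : ℂ) + 3 ≠ 0 := by exact_mod_cast (2 * n + 2).succ_ne_zero
      have i4 : 2 * (n : ℂ) + 1 ≠ 0 := by exact_mod_cast (2 * n).succ_ne_zero
      push_cast
      rw [show (0 - 0 - 0 - 0 + 1 / 2 + n : ℂ) = (2 * n + 1) / 2 by ring,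
        show (0 - 0 + 0 + 1 / 2 + (n + 0 + 1) : ℂ) = (2 * n + 3) / 2 by ring,
        show (0 + 1 + (n + 0 + 1) : ℂ) = n + 2 by ring,
        show (0 - 0 + 0 + 1 + (n + 0 + 1) : ℂ) = n + 2 by ring,
        show (0 - 0 + 0 + 1 + (2 * n + 0 + 1) : ℂ) = 2 * (n + 1) by ring,
        show (0 - 0 + 0 + 1 + (2 * n + 0 + 1 + 1) : ℂ) = 2 * n + 3 by ring]
      field_simp
      ring
    simp only [Pi.zero_apply]
    rw [e, Complex.norm_real, norm_neg, Real.norm_of_nonneg (by positivity),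
      div_le_iff₀ (by positivity)]
    nlinarith [mul_nonneg hn hn, mul_nonneg hn (mul_nonneg hn hn)]
  · intro p n
    have f : ∀ t w r : ℂ, t * 2 * (w * r) = 2 * r * (t * w) := by intros; ring
    rw [wzCore_succ_left, pow_succ]
    exact f _ _ _

theorem analyticAt_P₁ (m : ℂ) :
    AnalyticAt ℂ (fun p : Fin 5 → ℂ => P₁ (p 0) (p 1) (p 2) (p 3) (p 4) m) 0 := by
  have h0 := analyticAt_coord 0
  have h1 := analyticAt_coord 1
  have h2 := analyticAt_coord 2
  have h3 := analyticAt_coord 3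
  have h4 := analyticAt_coord 4
  unfold P₁
  repeat' first
    | exact h0 | exact h1 | exact h2 | exact h3 | exact h4
    | exact analyticAt_const
    | apply AnalyticAt.fun_add | apply AnalyticAt.fun_sub | apply AnalyticAt.fun_mul

theorem P₁_interpolation (a b c d e m : ℂ) : P₁ a b c d e m = P₁ a b c d e 0 +
    ((P₁ a b c d e 1 - P₁ a b c d e (-1)) / 2 - 10) * m +
    ((P₁ a b c d e 1 + P₁ a b c d e (-1)) / 2 - P₁ a b c d e 0) * m ^ 2 + 10 * m ^ 3 := by
  unfold P₁
  ring

/-- `S₁` at `n + 1` is `wzCore` times a cubic over two linear factors, so it exceeds `wzCore` by one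
power of `n`. This is the reason for the extra weight `(n+1)⁻¹`. -/
theorem analyticSeq_S₁ : AnalyticSeq fun p n =>
    S₁ (p 0) (p 1) (p 2) (p 3) (p 4) (n + 1) * 2 ^ n * ((n : ℂ) + 1)⁻¹ := by
  have N : AnalyticSeq fun p n => P₁ (p 0) (p 1) (p 2) (p 3) (p 4) (n + 1) *
      (((n : ℂ) + 1)⁻¹) ^ 3 := by
    have A0 := AnalyticSeq.of_analyticAt (analyticAt_P₁ 0)
    have A1 := AnalyticSeq.of_analyticAt (analyticAt_P₁ 1)
    have A2 := AnalyticSeq.of_analyticAt (analyticAt_P₁ (-1))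
    have C : ∀ c : ℂ, AnalyticSeq fun _ _ => c := fun c =>
      AnalyticSeq.of_analyticAt analyticAt_const
    have I := AnalyticSeq.inv_nat
    refine ((((A0.mul I).mul I).mul I).add ((((((A1.add ((C (-1)).mul A2)).mul (C (1 / 2))).add
      (C (-10))).mul I).mul I).add (((((A1.add A2).mul (C (1 / 2))).add
      ((C (-1)).mul A0)).mul I).add (C 10)))).congr fun p n => ?_
    have hm : (n : ℂ) + 1 ≠ 0 := by exact_mod_cast n.succ_ne_zero
    rw [P₁_interpolation _ _ _ _ _ ((n : ℂ) + 1)]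
    generalize P₁ _ _ _ _ _ 0 = A
    generalize P₁ _ _ _ _ _ 1 = B
    generalize P₁ _ _ _ _ _ (-1) = C
    field_simp
    ring
  have D : ∀ (a b c d e : ℂ) (y : ℝ), -(1 / 2) ≤ y → AnalyticSeq fun p n =>
      (1 + (a * p 0 + b * p 1 + c * p 2 + d * p 3 + e * p 4 + y) * ((n : ℂ) + 1)⁻¹)⁻¹ :=
    fun a b c d e y hy => AnalyticSeq.affine_inv (analyticAt_linear a b c d e y) (by simp) hy
  refine (((AnalyticSeq.of_analyticAt (analyticAt_const (v := (1 / 4 : ℂ)))).mul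
    (analyticSeq_wzCore.mul N)).mul ((D (1 / 2) (-(1 / 2)) 0 0 (1 / 2) 0 (by norm_num)).mul
    (D 1 (-1) (-1) (-1) 0 (-(1 / 2)) (by norm_num)))).congr fun p n => ?_
  have hm : (n : ℂ) + 1 ≠ 0 := by exact_mod_cast n.succ_ne_zero
  rw [← wzG_zero_right]
  unfold wzG
  rw [show 2 * (p 0 - p 1 + p 4 + 1 + ((2 * n + 0 + 1 : ℕ) : ℂ)) = 4 * ((n + 1) *
        (1 + (1 / 2 * p 0 + -(1 / 2) * p 1 + 0 * p 2 + 0 * p 3 + 1 / 2 * p 4 + (0 : ℝ)) *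
          ((n : ℂ) + 1)⁻¹)) by push_cast; field_simp; ring,
    show p 0 - p 1 - p 2 - p 3 + 1 / 2 + n = (n + 1) *
        (1 + (1 * p 0 + -1 * p 1 + -1 * p 2 + -1 * p 3 + 0 * p 4 + (-(1 / 2) : ℝ)) *
          ((n : ℂ) + 1)⁻¹) by push_cast; field_simp; ring, Nat.cast_zero, add_zero]
  generalize 1 + (1 / 2 * p 0 + -(1 / 2) * p 1 + 0 * p 2 + 0 * p 3 + 1 / 2 * p 4 + ((0 : ℝ) : ℂ)) *
    ((n : ℂ) + 1)⁻¹ = x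
  generalize 1 + (1 * p 0 + -1 * p 1 + -1 * p 2 + -1 * p 3 + 0 * p 4 + ((-(1 / 2) : ℝ) : ℂ)) *
    ((n : ℂ) + 1)⁻¹ = y
  generalize wzCore _ _ _ _ _ _ _ = w
  generalize P₁ _ _ _ _ _ _ = q
  simp only [div_eq_mul_inv, mul_inv]
  ring

theorem eventually_admissible : ∀ᶠ p : Fin 5 → ℂ in 𝓝 0,
    Admissible (p 0) (p 1) (p 2) (p 3) (p 4) ∧ -(1 / 2) < (p 0 - p 1 - p 2 - p 3).re := by
  have h : ∀ (f : (Fin 5 → ℂ) → ℂ), Continuous f → 0 < (f 0).re → ∀ᶠ p in 𝓝 0, 0 < (f p).re :=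
    fun f hf h0 => (Complex.continuous_re.comp hf).continuousAt.eventually (lt_mem_nhds h0)
  filter_upwards [h (fun p => p 4 + 1) (by fun_prop) (by simp),
    h (fun p => p 0 - p 1 + p 4 + 1) (by fun_prop) (by simp),
    h (fun p => p 0 - p 2 + p 4 + 1) (by fun_prop) (by simp),
    h (fun p => p 0 - p 3 + p 4 + 1 / 2) (by fun_prop) (by simp),
    h (fun p => p 0 - p 1 - p 2 - p 3 + 1 / 2) (by fun_prop) (by simp)] with p h1 h2 h3 h4 h5
  refine ⟨⟨notPole_of_re_pos h1, notPole_of_re_pos h2, notPole_of_re_pos h3,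
    notPole_of_re_pos h4⟩, ?_⟩
  rw [Complex.add_re] at h5
  have : (1 / 2 : ℂ).re = 1 / 2 := by norm_num
  linarith

/-- An analytic family of bounded sequences that represents both the summand and the sum. -/
theorem exists_analytic_family : ∃ Φ : (Fin 5 → ℂ) → (ℕ →ᵇ ℂ), AnalyticAt ℂ Φ 0 ∧
    (∀ n : ℕ, (uncurry5 fun a b c d e => S₁ a b c d e (n + 1)) =ᶠ[𝓝 0]
      fun p => (((n : ℂ) + 1) * (1 / 2) ^ n) * Φ p n) ∧
    uncurry5 wellPoised =ᶠ[𝓝 0] fun p => weightedSum (Φ p) := by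
  obtain ⟨Φ, ha, he⟩ := analyticSeq_S₁
  have hS : ∀ p, (∀ n, Φ p n = S₁ (p 0) (p 1) (p 2) (p 3) (p 4) (n + 1) * 2 ^ n *
      ((n : ℂ) + 1)⁻¹) → ∀ n : ℕ, S₁ (p 0) (p 1) (p 2) (p 3) (p 4) (n + 1) =
        (((n : ℂ) + 1) * (1 / 2) ^ n) * Φ p n := by
    intro p hp n
    have hm : (n : ℂ) + 1 ≠ 0 := by exact_mod_cast n.succ_ne_zero
    rw [hp, one_div, inv_pow]
    field_simp
  refine ⟨Φ, ha, fun n => ?_, ?_⟩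
  · filter_upwards [he] with p hp using hS p hp n
  · filter_upwards [he, eventually_admissible] with p hp had
    have h1 := hasSum_S₁ had.1 had.2
    rw [hasSum_pnat_iff (f := fun n => S₁ (p 0) (p 1) (p 2) (p 3) (p 4) n)] at h1
    have h2 := hasSum_weightedSum (Φ p)
    simp only [← hS p hp] at h2
    exact h1.unique h2

/-! ### Analyticity of the series and termwise comparison of Taylor coefficients. -/

theorem analyticAt_wellPoised : AnalyticAt ℂ (uncurry5 wellPoised) 0 := by
  obtain ⟨Φ, ha, -, hW⟩ := exists_analytic_family
  exact ((weightedSum.analyticAt _).comp ha).congr hW.symm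

/-- Evaluation of a bounded sequence, as a continuous linear functional. -/
def evalSeq (n : ℕ) : (ℕ →ᵇ ℂ) →L[ℂ] ℂ := BoundedContinuousFunction.evalCLM ℂ n

theorem analyticAt_S₁ (n : ℕ) :
    AnalyticAt ℂ (uncurry5 fun a b c d e => S₁ a b c d e (n + 1)) 0 := by
  obtain ⟨Φ, ha, hS, -⟩ := exists_analytic_family
  exact (analyticAt_const.mul (((evalSeq n).analyticAt _).comp ha)).congr (hS n).symm

/-- Evaluation at `n` and the weighted sum are both continuous linear functionals, so summands and
sum are read off from one and the same partial derivative of the family `Φ`. -/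
theorem hasSum_coeff (r : Fin 5 → ℕ) :
    HasSum (fun n : ℕ+ => coeff (fun a b c d e => S₁ a b c d e n) r) (coeff wellPoised r) := by
  obtain ⟨Φ, ha, hS, hW⟩ := exists_analytic_family
  rw [hasSum_pnat_iff (f := fun n => coeff (fun a b c d e => S₁ a b c d e n) r),
    coeff_eq_partials analyticAt_wellPoised]
  simp_rw [coeff_eq_partials (analyticAt_S₁ _)]
  refine HasSum.div_const ?_ _
  have h1 : partials r (uncurry5 wellPoised) 0 = weightedSum (partials r Φ 0) :=
    ((partialsList_congr hW _ r).trans (partialsList_clm weightedSum ha _ r)).eq_of_nhds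
  have h2 : ∀ n : ℕ, partials r (uncurry5 fun a b c d e => S₁ a b c d e (n + 1)) 0 =
      (((n : ℂ) + 1) * (1 / 2) ^ n) * partials r Φ 0 n := fun n =>
    ((partialsList_congr (hS n) _ r).trans
      (partialsList_clm ((((n : ℂ) + 1) * (1 / 2) ^ n) • evalSeq n) ha _ r)).eq_of_nhds
  rw [h1]
  simp_rw [h2]
  exact hasSum_weightedSum _

/-- The `N`-th Taylor coefficient at `0` of a function of one variable. -/
def taylor (f : ℂ → ℂ) (N : ℕ) : ℂ := iteratedDeriv N f 0 / (N.factorial : ℂ)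

/-- The restriction of a function of five variables to the line through `0` with direction `v`. -/
def onLine (f : ℂ → ℂ → ℂ → ℂ → ℂ → ℂ) (v : Fin 5 → ℚ) (x : ℂ) : ℂ :=
  f (x * v 0) (x * v 1) (x * v 2) (x * v 3) (x * v 4)

theorem taylor_onLine {f : ℂ → ℂ → ℂ → ℂ → ℂ → ℂ} (hf : AnalyticAt ℂ (uncurry5 f) 0)
    (v : Fin 5 → ℚ) (N : ℕ) : taylor (onLine f v) N =
      (dirDeriv (fun i => (v i : ℂ)))^[N] (uncurry5 f) 0 / (N.factorial : ℂ) := by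
  have := iteratedDeriv_comp_line 0 (fun i => (v i : ℂ)) (z := 0) (by simpa using hf) N
  rw [zero_smul, add_zero] at this
  rw [← this]
  unfold taylor
  congr 2
  funext x
  simp [uncurry5, onLine]

theorem hasSum_taylor_onLine (v : Fin 5 → ℚ) (N : ℕ) :
    HasSum (fun n : ℕ+ => taylor (onLine (fun a b c d e => S₁ a b c d e n) v) N)
      (taylor (onLine wellPoised v) N) := by
  obtain ⟨Φ, ha, hS, hW⟩ := exists_analytic_family
  rw [hasSum_pnat_iff (f := fun n => taylor (onLine (fun a b c d e => S₁ a b c d e n) v) N),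
    taylor_onLine analyticAt_wellPoised]
  simp_rw [taylor_onLine (analyticAt_S₁ _)]
  refine HasSum.div_const ?_ _
  rw [((iterate_dirDeriv_congr hW _ N).trans
    (iterate_dirDeriv_clm weightedSum ha _ N)).eq_of_nhds]
  have h2 : ∀ n : ℕ, (dirDeriv fun i => (v i : ℂ))^[N]
      (uncurry5 fun a b c d e => S₁ a b c d e (n + 1)) 0 =
      (((n : ℂ) + 1) * (1 / 2) ^ n) * (dirDeriv fun i => (v i : ℂ))^[N] Φ 0 n := fun n =>
    ((iterate_dirDeriv_congr (hS n) _ N).trans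
      (iterate_dirDeriv_clm ((((n : ℂ) + 1) * (1 / 2) ^ n) • evalSeq n) ha _ N)).eq_of_nhds
  simp_rw [h2]
  exact hasSum_weightedSum _

theorem taylor_onLine_mem_V (v : Fin 5 → ℚ) (N : ℕ) :
    (fun n : ℕ+ => taylor (onLine (fun a b c d e => S₁ a b c d e n) v) N) ∈ V S₁ N :=
  line_coeff_mem_V (T := S₁) (fun n => by
    obtain ⟨m, hm⟩ := Nat.exists_eq_succ_of_ne_zero n.ne_zero
    rw [hm]
    exact analyticAt_S₁ m) v N

end

noncomputable section

open Filter Topology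

/-! ### Taylor coefficients of products -/

theorem taylor_zero (f : ℂ → ℂ) : taylor f 0 = f 0 := by simp [taylor]

theorem taylor_congr {f g : ℂ → ℂ} (h : f =ᶠ[𝓝 0] g) (N : ℕ) : taylor f N = taylor g N := by
  unfold taylor
  rw [h.iteratedDeriv_eq]

theorem taylor_deriv (f : ℂ → ℂ) (N : ℕ) : taylor (deriv f) N = (N + 1) * taylor f (N + 1) := by
  unfold taylor
  rw [iteratedDeriv_succ', Nat.factorial_succ]
  have h1 : ((N : ℂ) + 1) ≠ 0 := by exact_mod_cast N.succ_ne_zero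
  push_cast
  field_simp

theorem taylor_mul {f g : ℂ → ℂ} (hf : AnalyticAt ℂ f 0) (hg : AnalyticAt ℂ g 0) (N : ℕ) :
    taylor (fun x => f x * g x) N =
      ∑ i ∈ Finset.range (N + 1), taylor f i * taylor g (N - i) := by
  unfold taylor
  have := iteratedDeriv_mul (n := N) (x := 0) hf.contDiffAt hg.contDiffAt
  change iteratedDeriv N (f * g) 0 / _ = _
  rw [this, Finset.sum_div]
  refine Finset.sum_congr rfl fun i hi => ?_
  rw [Finset.mem_range] at hi
  have h4 : ((N.choose i * i.factorial * (N - i).factorial : ℕ) : ℂ) = N.factorial :=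
    congrArg _ (Nat.choose_mul_factorial_mul_factorial (by omega))
  push_cast at h4
  have h1 : (N.factorial : ℂ) ≠ 0 := by exact_mod_cast N.factorial_ne_zero
  have h2 : (i.factorial : ℂ) ≠ 0 := by exact_mod_cast i.factorial_ne_zero
  have h3 : ((N - i).factorial : ℂ) ≠ 0 := by exact_mod_cast (N - i).factorial_ne_zero
  rw [div_mul_div_comm, div_eq_div_iff h1 (mul_ne_zero h2 h3), ← h4]
  ring

theorem taylor_const_mul (c : ℂ) (f : ℂ → ℂ) (N : ℕ) :
    taylor (fun x => c * f x) N = c * taylor f N := by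
  unfold taylor
  rw [iteratedDeriv_const_mul_field]
  ring

theorem taylor_const (c : ℂ) (N : ℕ) : taylor (fun _ => c) N = if N = 0 then c else 0 := by
  cases N with
  | zero => simp [taylor]
  | succ N => simp [taylor, iteratedDeriv_const]

theorem taylor_neg (f : ℂ → ℂ) (N : ℕ) : taylor (fun x => -f x) N = -taylor f N := by
  simpa using taylor_const_mul (-1) f N

theorem taylor_add {f g : ℂ → ℂ} (hf : AnalyticAt ℂ f 0) (hg : AnalyticAt ℂ g 0) (N : ℕ) :
    taylor (fun x => f x + g x) N = taylor f N + taylor g N := by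
  unfold taylor
  have := iteratedDeriv_add (n := N) (x := 0) hf.contDiffAt hg.contDiffAt
  rw [← add_div, ← this]
  rfl

theorem taylor_id_mul {f : ℂ → ℂ} (hf : AnalyticAt ℂ f 0) (N : ℕ) :
    taylor (fun x => x * f x) (N + 1) = taylor f N := by
  rw [taylor_mul (f := fun x => x) analyticAt_id hf, Finset.sum_range_succ', Finset.sum_range_succ']
  have h : ∀ i, taylor (fun x : ℂ => x) (i + 1 + 1) = 0 := by
    intro i
    have := taylor_deriv (fun x : ℂ => x) (i + 1)
    simp only [deriv_id''] at this
    rw [taylor_const, if_neg i.succ_ne_zero] at this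
    have h1 : (((i + 1 : ℕ) : ℂ) + 1) ≠ 0 := by exact_mod_cast (i + 1).succ_ne_zero
    exact (mul_eq_zero.mp this.symm).resolve_left h1
  have h1 : taylor (fun x : ℂ => x) 1 = 1 := by simp [taylor]
  simp [h, h1, taylor_zero]

theorem taylor_id_mul_zero (f : ℂ → ℂ) : taylor (fun x => x * f x) 0 = 0 := by simp [taylor_zero]

/-! ### Functions with a prescribed logarithmic derivative -/

/-- `f` is analytic at `0`, and `L` lists the Taylor coefficients of `f' / f`. -/
def LogJet (f : ℂ → ℂ) (L : ℕ → ℂ) : Prop :=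
  AnalyticAt ℂ f 0 ∧ ∃ g : ℂ → ℂ, AnalyticAt ℂ g 0 ∧ (deriv f =ᶠ[𝓝 0] fun x => g x * f x) ∧
    ∀ k, taylor g k = L k

theorem LogJet.const (c : ℂ) : LogJet (fun _ => c) fun _ => 0 := by
  refine ⟨analyticAt_const, fun _ => 0, analyticAt_const, ?_, fun k => ?_⟩
  · simp only [deriv_const', zero_mul]
    rfl
  · rw [taylor_const]; simp

theorem LogJet.mul {f₁ f₂ : ℂ → ℂ} {L₁ L₂ : ℕ → ℂ} (h₁ : LogJet f₁ L₁) (h₂ : LogJet f₂ L₂) :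
    LogJet (fun x => f₁ x * f₂ x) fun k => L₁ k + L₂ k := by
  obtain ⟨a₁, g₁, b₁, d₁, t₁⟩ := h₁
  obtain ⟨a₂, g₂, b₂, d₂, t₂⟩ := h₂
  refine ⟨a₁.mul a₂, fun x => g₁ x + g₂ x, b₁.add b₂, ?_, fun k => ?_⟩
  · filter_upwards [d₁, d₂, a₁.eventually_analyticAt, a₂.eventually_analyticAt] with x e₁ e₂ i₁ i₂
    have := (i₁.differentiableAt.hasDerivAt.mul i₂.differentiableAt.hasDerivAt).deriv
    refine (Eq.trans this ?_)
    rw [e₁, e₂]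
    ring
  · rw [taylor_add b₁ b₂, t₁, t₂]

theorem LogJet.inv {f : ℂ → ℂ} {L : ℕ → ℂ} (h : LogJet f L) (h0 : f 0 ≠ 0) :
    LogJet (fun x => (f x)⁻¹) fun k => -L k := by
  obtain ⟨a, g, b, d, t⟩ := h
  refine ⟨a.inv h0, fun x => -g x, b.neg, ?_, fun k => by rw [taylor_neg, t]⟩
  filter_upwards [d, a.eventually_analyticAt, a.continuousAt.eventually_ne h0] with x e i hx
  have := (i.differentiableAt.hasDerivAt.inv hx).deriv
  refine Eq.trans this ?_
  rw [e]
  field_simp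

theorem LogJet.div {f₁ f₂ : ℂ → ℂ} {L₁ L₂ : ℕ → ℂ} (h₁ : LogJet f₁ L₁) (h₂ : LogJet f₂ L₂)
    (h0 : f₂ 0 ≠ 0) : LogJet (fun x => f₁ x / f₂ x) fun k => L₁ k - L₂ k := by
  simpa only [div_eq_mul_inv, sub_eq_add_neg] using h₁.mul (h₂.inv h0)

/-- Comparing coefficients in `(c + α x) (c + α x)⁻¹ = 1` gives `c t_(k+1) + α t_k = 0`. -/
theorem taylor_inv_linear {c : ℂ} (hc : c ≠ 0) (α : ℂ) (k : ℕ) :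
    taylor (fun x => (c + α * x)⁻¹) k = (-1) ^ k * α ^ k / c ^ (k + 1) := by
  have ha : AnalyticAt ℂ (fun x : ℂ => c + α * x) 0 :=
    analyticAt_const.add (analyticAt_const.mul analyticAt_id)
  have hi : AnalyticAt ℂ (fun x : ℂ => (c + α * x)⁻¹) 0 := ha.inv (by simpa using hc)
  have h1 : (fun x : ℂ => (c + α * x) * (c + α * x)⁻¹) =ᶠ[𝓝 0] fun _ => 1 := by
    filter_upwards [ha.continuousAt.eventually_ne (by simpa using hc : c + α * 0 ≠ 0)] with x hx
    exact mul_inv_cancel₀ hx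
  have h2 : (fun x : ℂ => (c + α * x) * (c + α * x)⁻¹) =
      fun x => c * (c + α * x)⁻¹ + α * (x * (c + α * x)⁻¹) := by
    funext x; ring
  have key : ∀ k, taylor (fun x : ℂ => c * (c + α * x)⁻¹ + α * (x * (c + α * x)⁻¹)) k =
      if k = 0 then 1 else 0 := by
    intro k
    rw [← h2, taylor_congr h1, taylor_const]
  have hx : AnalyticAt ℂ (fun x : ℂ => x * (c + α * x)⁻¹) 0 := analyticAt_id.mul hi
  induction k with
  | zero => simp [taylor_zero]
  | succ k ih =>
    have := key (k + 1)
    rw [taylor_add (analyticAt_const.fun_mul hi) (analyticAt_const.fun_mul hx),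
      taylor_const_mul, taylor_const_mul, taylor_id_mul hi, ih, if_neg k.succ_ne_zero] at this
    have h3 : taylor (fun x => (c + α * x)⁻¹) (k + 1) =
        -(α * ((-1) ^ k * α ^ k / c ^ (k + 1))) / c := by
      rw [eq_div_iff hc]
      linear_combination this
    rw [h3]
    field_simp
    ring

theorem LogJet.linear {c : ℂ} (hc : c ≠ 0) (α : ℂ) :
    LogJet (fun x => c + α * x) fun k => (-1) ^ k * α ^ (k + 1) * (1 / c ^ (k + 1)) := by
  have ha : AnalyticAt ℂ (fun x : ℂ => c + α * x) 0 :=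
    analyticAt_const.add (analyticAt_const.mul analyticAt_id)
  refine ⟨ha, fun x => α * (c + α * x)⁻¹, analyticAt_const.mul (ha.inv (by simpa using hc)),
    ?_, fun k => ?_⟩
  · filter_upwards [ha.continuousAt.eventually_ne (by simpa using hc : c + α * 0 ≠ 0)] with x hx
    have : HasDerivAt (fun x : ℂ => c + α * x) α x := by
      simpa using ((hasDerivAt_id x).const_mul α).const_add c
    rw [this.deriv]
    field_simp
  · rw [taylor_const_mul, taylor_inv_linear hc]
    ring

/-- The power sum `∑_{j < n} (c + j)⁻ˢ`. -/
def shiftedHarmonic (c : ℂ) (n s : ℕ) : ℂ := ∑ j ∈ Finset.range n, 1 / (c + j) ^ s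

theorem LogJet.rf {c : ℂ} (hc : NotPole c) (α : ℂ) (n : ℕ) : LogJet (fun x => rf (c + α * x) n)
    fun k => (-1) ^ k * α ^ (k + 1) * shiftedHarmonic c n (k + 1) := by
  induction n with
  | zero => simpa [shiftedHarmonic] using LogJet.const 1
  | succ n ih =>
    have := ih.mul (LogJet.linear (hc.add_nat_ne n) α)
    convert this using 1
    · funext x
      rw [rf_succ]
      ring
    · funext k
      rw [shiftedHarmonic, Finset.sum_range_succ, mul_add]
      rfl

/-- The recursion satisfied by the Taylor coefficients `t` of a function in terms of the Taylor
coefficients `L` of its logarithmic derivative. -/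
def JetRec (t L : ℕ → ℂ) : Prop :=
  ∀ k : ℕ, (k + 1) * t (k + 1) = ∑ i ∈ Finset.range (k + 1), L i * t (k - i)

/-- Coefficients of `x^k` in `f' = g f`. -/
theorem LogJet.jetRec {f : ℂ → ℂ} {L : ℕ → ℂ} (h : LogJet f L) : JetRec (taylor f) L := by
  intro k
  obtain ⟨a, g, b, d, t⟩ := h
  rw [← taylor_deriv, taylor_congr d, taylor_mul b a]
  simp only [t]

theorem JetRec.one {t L : ℕ → ℂ} (h : JetRec t L) :
    t 1 = t 0 * L 0 := by
  have := h 0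
  simp at this
  linear_combination this

/-- These closed forms are the coefficients of `t 0 * exp (∑ L k x^(k+1) / (k+1))`. -/
theorem JetRec.two {t L : ℕ → ℂ} (h : JetRec t L) :
    t 2 = t 0 * ((L 0 ^ 2 + L 1) / 2) := by
  have := h 1
  simp [Finset.sum_range_succ, h.one] at this
  linear_combination this / 2

theorem JetRec.three {t L : ℕ → ℂ} (h : JetRec t L) :
    t 3 = t 0 * ((L 0 ^ 3 + 3 * L 0 * L 1 + 2 * L 2) / 6) := by
  have := h 2
  simp [Finset.sum_range_succ, h.one, h.two] at this
  linear_combination this / 3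

theorem JetRec.four {t L : ℕ → ℂ} (h : JetRec t L) :
    t 4 = t 0 * ((L 0 ^ 4 + 6 * L 0 ^ 2 * L 1 + 3 * L 1 ^ 2 + 8 * L 0 * L 2 +
      6 * L 3) / 24) := by
  have := h 3
  simp [Finset.sum_range_succ, h.one, h.two, h.three] at this
  linear_combination this / 4

/-- From here on the linear term is assumed to vanish, as it does for Dougall's sum and for the line
used in degree `6`. -/
theorem JetRec.five {t L : ℕ → ℂ} (h : JetRec t L) (h0 : L 0 = 0) :
    t 5 = t 0 * (L 4 / 5 + L 1 * L 2 / 6) := by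
  have := h 4
  simp [Finset.sum_range_succ, h.one, h.two, h.three,
    h.four, h0] at this
  linear_combination this / 5

theorem JetRec.six {t L : ℕ → ℂ} (h : JetRec t L) (h0 : L 0 = 0) :
    t 6 = t 0 * (L 5 / 6 + L 1 * L 3 / 8 + L 2 ^ 2 / 18 + L 1 ^ 3 / 48) := by
  have := h 5
  simp [Finset.sum_range_succ, h.one, h.two, h.three,
    h.four, h.five h0, h0] at this
  linear_combination this / 6

/-- On a line `P₁` is a cubic in the line parameter, so only four consecutive coefficients of the
hypergeometric part enter. -/
theorem taylor_cubic_mul {f : ℂ → ℂ} (hf : AnalyticAt ℂ f 0) (p₀ p₁ p₂ p₃ : ℂ) (N : ℕ) :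
    taylor (fun x => (p₀ + p₁ * x + p₂ * x ^ 2 + p₃ * x ^ 3) * f x) (N + 3) =
      p₀ * taylor f (N + 3) + p₁ * taylor f (N + 2) + p₂ * taylor f (N + 1) +
        p₃ * taylor f N := by
  have h1 : AnalyticAt ℂ (fun x => x * f x) 0 := analyticAt_id.mul hf
  have h2 : AnalyticAt ℂ (fun x => x * (x * f x)) 0 := analyticAt_id.mul h1
  have h3 : AnalyticAt ℂ (fun x => x * (x * (x * f x))) 0 := analyticAt_id.mul h2
  have e : (fun x => (p₀ + p₁ * x + p₂ * x ^ 2 + p₃ * x ^ 3) * f x) = fun x =>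
      p₀ * f x + p₁ * (x * f x) + p₂ * (x * (x * f x)) + p₃ * (x * (x * (x * f x))) := by
    funext x; ring
  have c : ∀ {g : ℂ → ℂ} (p : ℂ), AnalyticAt ℂ g 0 → AnalyticAt ℂ (fun x => p * g x) 0 :=
    fun p hg => analyticAt_const.mul hg
  rw [e, taylor_add (((c p₀ hf).fun_add (c p₁ h1)).fun_add (c p₂ h2)) (c p₃ h3),
    taylor_add ((c p₀ hf).fun_add (c p₁ h1)) (c p₂ h2), taylor_add (c p₀ hf) (c p₁ h1)]
  simp only [taylor_const_mul]
  rw [taylor_id_mul hf (N + 2), taylor_id_mul h1 (N + 2), taylor_id_mul hf (N + 1),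
    taylor_id_mul h2 (N + 2), taylor_id_mul h1 (N + 1), taylor_id_mul hf N]

theorem taylor_cubic_mul_low {f : ℂ → ℂ} (hf : AnalyticAt ℂ f 0) (p₀ p₁ p₂ p₃ : ℂ) :
    taylor (fun x => (p₀ + p₁ * x + p₂ * x ^ 2 + p₃ * x ^ 3) * f x) 0 = p₀ * taylor f 0 ∧
    taylor (fun x => (p₀ + p₁ * x + p₂ * x ^ 2 + p₃ * x ^ 3) * f x) 1 =
      p₀ * taylor f 1 + p₁ * taylor f 0 ∧
    taylor (fun x => (p₀ + p₁ * x + p₂ * x ^ 2 + p₃ * x ^ 3) * f x) 2 =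
      p₀ * taylor f 2 + p₁ * taylor f 1 + p₂ * taylor f 0 := by
  have h1 : AnalyticAt ℂ (fun x => x * f x) 0 := analyticAt_id.mul hf
  have h2 : AnalyticAt ℂ (fun x => x * (x * f x)) 0 := analyticAt_id.mul h1
  have h3 : AnalyticAt ℂ (fun x => x * (x * (x * f x))) 0 := analyticAt_id.mul h2
  have e : (fun x => (p₀ + p₁ * x + p₂ * x ^ 2 + p₃ * x ^ 3) * f x) = fun x =>
      p₀ * f x + p₁ * (x * f x) + p₂ * (x * (x * f x)) + p₃ * (x * (x * (x * f x))) := by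
    funext x; ring
  have c : ∀ {g : ℂ → ℂ} (p : ℂ), AnalyticAt ℂ g 0 → AnalyticAt ℂ (fun x => p * g x) 0 :=
    fun p hg => analyticAt_const.mul hg
  rw [e]
  refine ⟨by simp [taylor_zero], ?_, ?_⟩ <;>
  rw [taylor_add (((c p₀ hf).fun_add (c p₁ h1)).fun_add (c p₂ h2)) (c p₃ h3),
    taylor_add ((c p₀ hf).fun_add (c p₁ h1)) (c p₂ h2), taylor_add (c p₀ hf) (c p₁ h1)] <;>
  simp only [taylor_const_mul]
  · rw [taylor_id_mul hf 0, taylor_id_mul h1 0, taylor_id_mul h2 0, taylor_id_mul_zero,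
      taylor_id_mul_zero]
    ring
  · rw [taylor_id_mul hf 1, taylor_id_mul h1 1, taylor_id_mul h2 1, taylor_id_mul hf 0,
      taylor_id_mul h1 0, taylor_id_mul_zero]
    ring

/-! ### Harmonic numbers -/

theorem notPole_one : NotPole 1 := notPole_of_re_pos (by simp)

theorem notPole_half : NotPole (1 / 2) := notPole_of_re_pos (by norm_num)

theorem H_succ (s n : ℕ) : H s (n + 1) = H s n + 1 / ((n : ℂ) + 1) ^ s := by
  rw [H, Finset.sum_Icc_succ_top (by omega), H]
  push_cast
  rfl

theorem shiftedHarmonic_one (n s : ℕ) : shiftedHarmonic 1 n s = H s n := by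
  induction n with
  | zero => simp [shiftedHarmonic, H]
  | succ n ih => rw [shiftedHarmonic, Finset.sum_range_succ, H_succ, ← ih, shiftedHarmonic,
      add_comm 1 (n : ℂ)]

/-- Up to `2^s` this is the sum over odd denominators below `2n`; the even denominators in `H s (2 *
n)` contribute `2^(-s) H s n`. -/
theorem shiftedHarmonic_half (n s : ℕ) :
    shiftedHarmonic (1 / 2) n s = 2 ^ s * H s (2 * n) - H s n := by
  induction n with
  | zero => simp [shiftedHarmonic, H]
  | succ n ih =>
    rw [shiftedHarmonic, Finset.sum_range_succ]
    change shiftedHarmonic (1 / 2) n s + _ = _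
    rw [ih, show 2 * (n + 1) = 2 * n + 1 + 1 by ring, H_succ, H_succ, H_succ]
    push_cast
    have e1 : (1 / 2 + (n : ℂ)) ^ s = (2 * n + 1) ^ s / 2 ^ s := by
      rw [← div_pow]; congr 1; ring
    have e2 : (2 * (n : ℂ) + 1 + 1) ^ s = 2 ^ s * (n + 1) ^ s := by
      rw [← mul_pow]; congr 1; ring
    have i1 : (2 * (n : ℂ) + 1) ^ s ≠ 0 := pow_ne_zero _ (by exact_mod_cast (2 * n).succ_ne_zero)
    have i2 : ((n : ℂ) + 1) ^ s ≠ 0 := pow_ne_zero _ (by exact_mod_cast n.succ_ne_zero)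
    have i3 : (2 : ℂ) ^ s ≠ 0 := pow_ne_zero _ two_ne_zero
    rw [e1, e2]
    field_simp
    ring

end

noncomputable section

open Filter Topology

/-! ### The summand on a line through the origin -/

theorem rf_one_two_mul (n : ℕ) : rf 1 (2 * n) = 4 ^ n * rf (1 / 2) n * rf 1 n := by
  induction n with
  | zero => simp
  | succ n ih =>
    rw [show 2 * (n + 1) = 2 * n + 1 + 1 by ring]
    simp only [rf_succ, ih]
    push_cast
    ring

/-- The coefficient of `x` in `P₁` on the line spanned by `(a, b, c, d, e)`. -/
def P₁coeffOne (a b c d e n : ℂ) : ℂ :=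
  n * (-3 * a + 2 * b + c - 4 * e) + 3 * n ^ 2 * (6 * a - 4 * b - 2 * c - 2 * d + 6 * e)

/-- The coefficient of `x ^ 2` in `P₁` on the line spanned by `(a, b, c, d, e)`. -/
def P₁coeffTwo (a b c d e n : ℂ) : ℂ :=
  -a ^ 2 + a * (b + c - 2 * e) + e * (2 * b + c - e) +
    n * (10 * a ^ 2 - a * (14 * b + 6 * c + 6 * d - 22 * e) + 4 * b ^ 2 +
      2 * b * (2 * c + 2 * d - 8 * e) + 2 * c * d - 8 * c * e - 8 * d * e + 10 * e ^ 2)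

/-- The coefficient of `x ^ 3` in `P₁` on the line spanned by `(a, b, c, d, e)`. -/
def P₁coeffThree (a b c d e : ℂ) : ℂ :=
  2 * a ^ 3 - a ^ 2 * (4 * b + 2 * c + 2 * d - 6 * e) +
    a * (2 * b ^ 2 + b * (2 * c + 2 * d - 10 * e) + 2 * c * d - 4 * c * e - 4 * d * e +
      6 * e ^ 2) +
    e * (4 * b ^ 2 + b * (4 * c + 4 * d - 4 * e) + (c - e) * (2 * d - 2 * e))

/-- The Taylor coefficients of the logarithmic derivative of the hypergeometric part of `S₁` on
the line spanned by `(a, b, c, d, e)`. -/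
def logJetS₁ (a b c d e : ℂ) (n k : ℕ) : ℂ :=
  (-1) ^ k *
    (((-b) ^ (k + 1) + (a + e) ^ (k + 1) + (c + e) ^ (k + 1) + (a - b - c) ^ (k + 1)) *
        (H (k + 1) n - 1 / (n : ℂ) ^ (k + 1)) +
      ((d + e) ^ (k + 1) - (a - d + e) ^ (k + 1) - (a - b - c - d) ^ (k + 1)) *
        (2 ^ (k + 1) * H (k + 1) (2 * n) - H (k + 1) n) +
      (a - b - d) ^ (k + 1) *
        (2 ^ (k + 1) * H (k + 1) (2 * n) - H (k + 1) n - 2 ^ (k + 1) / (2 * n - 1) ^ (k + 1)) -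
      (e ^ (k + 1) + (a - c + e) ^ (k + 1)) * H (k + 1) n -
      (a - b + e) ^ (k + 1) * H (k + 1) (2 * n))

theorem shiftedHarmonic_one_pred (m s : ℕ) :
    shiftedHarmonic 1 m s = H s (m + 1) - 1 / ((m + 1 : ℕ) : ℂ) ^ s := by
  rw [shiftedHarmonic_one, H_succ]
  push_cast
  ring

theorem shiftedHarmonic_half_pred (m s : ℕ) :
    shiftedHarmonic (1 / 2) m s = 2 ^ s * H s (2 * (m + 1)) - H s (m + 1) -
      2 ^ s / (2 * ((m + 1 : ℕ) : ℂ) - 1) ^ s := by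
  rw [← shiftedHarmonic_half, shiftedHarmonic, shiftedHarmonic, Finset.sum_range_succ]
  have : (1 / 2 + (m : ℂ)) ^ s = (2 * ((m + 1 : ℕ) : ℂ) - 1) ^ s / 2 ^ s := by
    rw [← div_pow]; push_cast; congr 1; ring
  rw [this]
  field_simp
  ring

/-- The hypergeometric part of `S₁` on the line spanned by `(a, b, c, d, e)`. -/
def hyperS₁ (a b c d e : ℂ) (m : ℕ) (x : ℂ) : ℂ :=
  (-1) ^ m / 2 * rf (1 + -b * x) m * rf (1 + (a + e) * x) m * rf (1 + (c + e) * x) m *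
    rf (1 + (a - b - c) * x) m * rf (1 / 2 + (d + e) * x) (m + 1) *
    rf (1 / 2 + (a - b - d) * x) m / rf (1 + e * x) (m + 1) /
    rf (1 + (a - c + e) * x) (m + 1) / rf (1 / 2 + (a - d + e) * x) (m + 1) /
    rf (1 / 2 + (a - b - c - d) * x) (m + 1) / rf (1 + (a - b + e) * x) (2 * (m + 1))

theorem S₁_line (a b c d e x : ℂ) (m : ℕ) :
    S₁ (x * a) (x * b) (x * c) (x * d) (x * e) (m + 1) =
      ((10 * ((m + 1 : ℕ) : ℂ) ^ 3 - 3 * ((m + 1 : ℕ) : ℂ) ^ 2) +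
        P₁coeffOne a b c d e (m + 1 : ℕ) * x + P₁coeffTwo a b c d e (m + 1 : ℕ) * x ^ 2 +
        P₁coeffThree a b c d e * x ^ 3) * hyperS₁ a b c d e m x := by
  rw [S₁, hyperS₁, show 1 - x * b = 1 + -b * x by ring,
    show x * a + x * e + 1 = 1 + (a + e) * x by ring,
    show x * c + x * e + 1 = 1 + (c + e) * x by ring,
    show x * a - x * b - x * c + 1 = 1 + (a - b - c) * x by ring,
    show x * d + x * e + 1 / 2 = 1 / 2 + (d + e) * x by ring,
    show x * a - x * b - x * d + 1 / 2 = 1 / 2 + (a - b - d) * x by ring,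
    show x * e + 1 = 1 + e * x by ring,
    show x * a - x * c + x * e + 1 = 1 + (a - c + e) * x by ring,
    show x * a - x * d + x * e + 1 / 2 = 1 / 2 + (a - d + e) * x by ring,
    show x * a - x * b - x * c - x * d + 1 / 2 = 1 / 2 + (a - b - c - d) * x by ring,
    show x * a - x * b + x * e + 1 = 1 + (a - b + e) * x by ring, Nat.add_sub_cancel]
  have hP : P₁ (x * a) (x * b) (x * c) (x * d) (x * e) (m + 1 : ℕ) =
      (10 * ((m + 1 : ℕ) : ℂ) ^ 3 - 3 * ((m + 1 : ℕ) : ℂ) ^ 2) +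
        P₁coeffOne a b c d e (m + 1 : ℕ) * x + P₁coeffTwo a b c d e (m + 1 : ℕ) * x ^ 2 +
        P₁coeffThree a b c d e * x ^ 3 := by
    simp only [P₁, P₁coeffOne, P₁coeffTwo, P₁coeffThree]
    ring
  rw [hP]
  generalize (10 * ((m + 1 : ℕ) : ℂ) ^ 3 - 3 * ((m + 1 : ℕ) : ℂ) ^ 2) +
        P₁coeffOne a b c d e (m + 1 : ℕ) * x + P₁coeffTwo a b c d e (m + 1 : ℕ) * x ^ 2 +
        P₁coeffThree a b c d e * x ^ 3 = p
  simp only [div_eq_mul_inv, mul_inv]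
  ring

/-- The product becomes a sum of power sums. Numerator factors of length `m = n - 1` rather than `n`
produce the corrections `1/n^s` and `2^s/(2n-1)^s`. -/
theorem logJet_hyperS₁ (a b c d e : ℂ) (m : ℕ) :
    LogJet (hyperS₁ a b c d e m) (logJetS₁ a b c d e (m + 1)) := by
  have z1 : ∀ (α : ℂ) (j : ℕ), rf (1 + α * 0) j ≠ 0 := fun α j => by
    simpa using notPole_one.rf_ne_zero j
  have z2 : ∀ (α : ℂ) (j : ℕ), rf (1 / 2 + α * 0) j ≠ 0 := fun α j => by
    simpa using notPole_half.rf_ne_zero j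
  have o : ∀ (α : ℂ) (j : ℕ), LogJet (fun x => rf (1 + α * x) j) _ :=
    fun α j => LogJet.rf notPole_one α j
  have h : ∀ (α : ℂ) (j : ℕ), LogJet (fun x => rf (1 / 2 + α * x) j) _ :=
    fun α j => LogJet.rf notPole_half α j
  have := (((((((((((LogJet.const ((-1) ^ m / 2)).mul (o (-b) m)).mul (o (a + e) m)).mul
    (o (c + e) m)).mul (o (a - b - c) m)).mul (h (d + e) (m + 1))).mul (h (a - b - d) m)).div
    (o e (m + 1)) (z1 _ _)).div (o (a - c + e) (m + 1)) (z1 _ _)).div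
    (h (a - d + e) (m + 1)) (z2 _ _)).div (h (a - b - c - d) (m + 1)) (z2 _ _)).div
    (o (a - b + e) (2 * (m + 1))) (z1 _ _)
  refine (congrArg (LogJet _) (funext fun k => ?_)).mp this
  simp only [shiftedHarmonic_one_pred m, shiftedHarmonic_half_pred m]
  simp only [shiftedHarmonic_one, shiftedHarmonic_half, logJetS₁]
  ring

theorem hyperS₁_zero (a b c d e : ℂ) (m : ℕ) :
    hyperS₁ a b c d e m 0 =
      -aSeq (m + 1) / (((m + 1 : ℕ) : ℂ) ^ 4 * (2 * ((m + 1 : ℕ) : ℂ) - 1)) := by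
  have h1 := notPole_one.rf_ne_zero m
  have h2 := notPole_half.rf_ne_zero m
  have h3 : (m : ℂ) + 1 ≠ 0 := by exact_mod_cast m.succ_ne_zero
  have h4 : 2 * (m : ℂ) + 1 ≠ 0 := by exact_mod_cast (2 * m).succ_ne_zero
  have e1 : rf 1 (m + 1) = rf 1 m * (m + 1) := by rw [rf_succ]; ring
  have e2 : rf (1 / 2) (m + 1) = rf (1 / 2) m * (2 * m + 1) / 2 := by rw [rf_succ]; ring
  have e3 : (-1 / 4 : ℂ) ^ (m + 1) = -(-1) ^ m / (4 ^ m * 4) := by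
    rw [div_pow, pow_succ, pow_succ]; ring
  have e4 : 2 * ((m : ℂ) + 1) - 1 = 2 * m + 1 := by ring
  simp only [hyperS₁, mul_zero, add_zero, rf_one_two_mul, e1, e2, aSeq, e3]
  push_cast
  rw [e4]
  field_simp
  ring

end

noncomputable section

open Filter Topology Asymptotics

/-! ### Dougall's summation: the contiguous relation -/

theorem wellPoisedTerm_eq_wzCore (a b c d : ℂ) (k : ℕ) :
    wellPoisedTerm a b c d 0 k = wzCore a b c d 0 0 k * (a + 2 * (k + 1)) := by
  rw [← wzF_zero_left, wzF]
  simp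

/-- The parameters of the series, with `e = 0`, for which the contiguous relation holds. -/
structure DougallRegular (a b c d : ℂ) : Prop where
  ha : NotPole (a + 1)
  hb : NotPole (a - b + 1)
  hc : NotPole (a - c + 1)
  hd : NotPole (a - d + 1 / 2)
  hs : -(1 / 2) < (a - b - c - d).re

theorem DougallRegular.admissible {a b c d : ℂ} (h : DougallRegular a b c d) :
    Admissible a b c d 0 := by
  refine ⟨by simpa using notPole_one, ?_, ?_, ?_⟩ <;> rw [add_zero]
  exacts [h.hb, h.hc, h.hd]

theorem DougallRegular.add_one {a b c d : ℂ} (h : DougallRegular a b c d) :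
    DougallRegular (a + 1) b c d := by
  refine ⟨?_, ?_, ?_, ?_, ?_⟩
  · simpa using h.ha.add_nat 1
  · convert h.hb.add_nat 1 using 1; push_cast; ring
  · convert h.hc.add_nat 1 using 1; push_cast; ring
  · convert h.hd.add_nat 1 using 1; push_cast; ring
  · have := h.hs
    simp only [Complex.sub_re, Complex.add_re, Complex.one_re] at this ⊢
    linarith

theorem DougallRegular.ne {a b c d : ℂ} (h : DougallRegular a b c d) :
    a - b - c - d + 1 / 2 ≠ 0 := by
  intro h0
  have h1 := congrArg Complex.re h0
  have := h.hs
  simp only [Complex.sub_re, Complex.add_re, Complex.zero_re] at h1 this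
  norm_num at h1 this
  linarith

/-- The rational certificate of the contiguous relation, multiplied by the summand. -/
def dougallCert (a b c d : ℂ) (k : ℕ) : ℂ :=
  -(b * c) * wzCore a b c d 0 0 k * (k + 1) * (2 * a + k + 3 / 2 - b - c - d) /
    (a - b - c - d + 1 / 2)

/-- The factor in the contiguous relation. -/
def dougallRatio (a b c d : ℂ) : ℂ :=
  (a + 1) * (a - b - c + 1) * (a - b - d + 1 / 2) * (a - c - d + 1 / 2) /
    ((a - b + 1) * (a - c + 1) * (a - d + 1 / 2) * (a - b - c - d + 1 / 2))

/-- Creative telescoping for the shift `a ↦ a + 1`: relative to the common term `X` all four terms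
are rational, and `dougallCert` is the certificate. -/
theorem dougall_term {a b c d : ℂ} (h : DougallRegular a b c d) (k : ℕ) :
    b * c * wellPoisedTerm a b c d 0 k -
      dougallRatio a b c d * (b * c * wellPoisedTerm (a + 1) b c d 0 k) =
        dougallCert a b c d (k + 1) - dougallCert a b c d k := by
  have n1 : ((k : ℂ) + 1 + 1) ≠ 0 := by exact_mod_cast (k + 1).succ_ne_zero
  have a0 : a + 1 ≠ 0 := h.ha.ne_zero
  have b0 : a - b + 1 ≠ 0 := h.hb.ne_zero
  have c0 : a - c + 1 ≠ 0 := h.hc.ne_zero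
  have d0 : a - d + 1 / 2 ≠ 0 := h.hd.ne_zero
  have b1 : a - b + 1 + (k + 1) ≠ 0 := by simpa using h.hb.add_nat_ne (k + 1)
  have c1 : a - c + 1 + (k + 1) ≠ 0 := by simpa using h.hc.add_nat_ne (k + 1)
  have d1 : a - d + 1 / 2 + (k + 1) ≠ 0 := by simpa using h.hd.add_nat_ne (k + 1)
  have s0 := h.ne
  have X1 : wzCore a b c d 0 0 (k + 1) = wzCore a b c d 0 0 k *
      ((a + 1 + k) * (b + 1 + k) * (c + 1 + k) * (d + 1 / 2 + (k + 1)) /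
        ((k + 1 + 1) * (a - b + 1 + (k + 1)) * (a - c + 1 + (k + 1)) *
          (a - d + 1 / 2 + (k + 1)))) := by
    unfold wzCore
    simp only [zero_add, mul_zero, rf_zero, pow_zero, add_zero, mul_one, one_mul]
    rw [div_mul_div_comm]
    simp only [rf_succ _ k, rf_succ _ (k + 1)]
    push_cast
    rw [show (1 : ℂ) + (k + 1) = k + 1 + 1 by ring]
    generalize a + 1 + (k : ℂ) = x₁
    generalize b + 1 + (k : ℂ) = x₂
    generalize c + 1 + (k : ℂ) = x₃
    generalize d + 1 / 2 + ((k : ℂ) + 1) = x₄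
    generalize (k : ℂ) + 1 + 1 = y₁
    generalize a - b + 1 + ((k : ℂ) + 1) = y₂
    generalize a - c + 1 + ((k : ℂ) + 1) = y₃
    generalize a - d + 1 / 2 + ((k : ℂ) + 1) = y₄
    congr 1 <;> ring
  have X2 : wzCore (a + 1) b c d 0 0 k = wzCore a b c d 0 0 k *
      ((a + 1 + k) * (a - b + 1) * (a - c + 1) * (a - d + 1 / 2) /
        ((a + 1) * (a - b + 1 + (k + 1)) * (a - c + 1 + (k + 1)) *
          (a - d + 1 / 2 + (k + 1)))) := by
    have sh : ∀ (x : ℂ) (j : ℕ), x ≠ 0 → rf (x + 1) j = rf x j * (x + j) / x := by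
      intro x j hx
      rw [eq_div_iff hx, ← rf_succ, rf_succ', mul_comm]
    unfold wzCore
    simp only [zero_add, mul_zero, rf_zero, pow_zero, add_zero, mul_one, one_mul]
    rw [show a + 1 - c + 1 = a - c + 1 + 1 by ring, show a + 1 - b + 1 = a - b + 1 + 1 by ring,
      show a + 1 - d + 1 / 2 = a - d + 1 / 2 + 1 by ring, sh _ _ a0, sh _ _ b0, sh _ _ c0,
      sh _ _ d0]
    have r1 := notPole_one.rf_ne_zero (k + 1)
    have r2 := h.hb.rf_ne_zero (k + 1)
    have r3 := h.hc.rf_ne_zero (k + 1)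
    have r4 := h.hd.rf_ne_zero (k + 1)
    push_cast
    field_simp
  rw [wellPoisedTerm_eq_wzCore, wellPoisedTerm_eq_wzCore, dougallCert, dougallCert, X1, X2,
    dougallRatio]
  generalize wzCore a b c d 0 0 k = X
  push_cast
  generalize hr : a - d + 1 / 2 = r at *
  generalize ht : a - b - c - d + 1 / 2 = t at *
  field_simp
  rw [← hr, ← ht]
  ring

/-- The boundary value supplies the initial term `1` of Dougall's series on both sides, which
`wellPoised` omits since it starts one index later. -/
theorem dougallCert_zero {a b c d : ℂ} (h : DougallRegular a b c d) :
    dougallCert a b c d 0 = 1 - dougallRatio a b c d := by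
  have b0 : a - b + 1 ≠ 0 := h.hb.ne_zero
  have c0 : a - c + 1 ≠ 0 := h.hc.ne_zero
  have d0 : a - d + 1 / 2 ≠ 0 := h.hd.ne_zero
  have s0 := h.ne
  simp only [dougallCert, dougallRatio, wzCore, zero_add, mul_zero, rf_zero, pow_zero, add_zero,
    mul_one, one_mul, rf_succ, Nat.cast_zero]
  generalize hr : a - d + 1 / 2 = r at *
  generalize ht : a - b - c - d + 1 / 2 = t at *
  field_simp
  rw [← hr, ← ht]
  ring

theorem tendsto_dougallCert {a b c d : ℂ} (h : DougallRegular a b c d) :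
    Tendsto (dougallCert a b c d) atTop (𝓝 0) := by
  have H := (isBigO_mul_rpow (isBigO_mul_rpow (wzCore_isBigO h.admissible 0)
    (linear_isBigO 1 1)) (linear_isBigO (2 * a + 3 / 2 - b - c - d) 1)).const_mul_left
      (-(b * c) / (a - b - c - d + 1 / 2))
  have H' := H.congr_left (f₂ := dougallCert a b c d) fun k => by
    unfold dougallCert
    ring
  refine H'.trans_tendsto ?_
  have hs : 0 < 2 * (a - b - c - d).re + 1 := by linarith [h.hs]
  refine ((tendsto_rpow_neg_atTop hs).comp tendsto_natCast_atTop_atTop).congr fun k => ?_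
  simp only [Function.comp_apply]
  congr 1
  push_cast
  ring

/-- `1 + b c * wellPoised` is the full very-well-poised `₅F₄` with parameters `a`, `b`, `c`, `d +
1/2`; summing the telescoping relation multiplies it by `dougallRatio` as `a + 1` goes to `a`. -/
theorem dougall_contiguous {a b c d : ℂ} (h : DougallRegular a b c d) :
    1 + b * c * wellPoised a b c d 0 =
      dougallRatio a b c d * (1 + b * c * wellPoised (a + 1) b c d 0) := by
  have s1 := (summable_wellPoisedTerm h.admissible h.hs).hasSum.mul_left (b * c)
  have s2 := ((summable_wellPoisedTerm h.add_one.admissible h.add_one.hs).hasSum.mul_left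
    (b * c)).mul_left (dougallRatio a b c d)
  have s3 := (s1.sub s2).tendsto_sum_nat
  simp only [dougall_term h, Finset.sum_range_sub] at s3
  have s4 := tendsto_nhds_unique s3 ((tendsto_dougallCert h).sub_const _)
  rw [dougallCert_zero h] at s4
  change b * c * wellPoised a b c d 0 -
    dougallRatio a b c d * (b * c * wellPoised (a + 1) b c d 0) = _ at s4
  linear_combination s4

theorem DougallRegular.add_nat {a b c d : ℂ} (h : DougallRegular a b c d) (M : ℕ) :
    DougallRegular (a + M) b c d := by
  induction M with
  | zero => simpa using h
  | succ M ih => simpa [add_assoc] using ih.add_one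

/-- The product of the first `M` factors in Dougall's summation. -/
def dougallProd (a b c d : ℂ) (M : ℕ) : ℂ :=
  rf (1 + a) M * rf (1 + (a - b - c)) M * rf (1 / 2 + (a - b - d)) M *
      rf (1 / 2 + (a - c - d)) M / rf (1 + (a - b)) M / rf (1 + (a - c)) M /
    rf (1 / 2 + (a - d)) M / rf (1 / 2 + (a - b - c - d)) M

/-- For large `M` the remaining series is close to `1`, so the finite products converge to Dougall's
sum and its Gamma evaluation is never needed. -/
theorem dougall_finite {a b c d : ℂ} (h : DougallRegular a b c d) (M : ℕ) :
    1 + b * c * wellPoised a b c d 0 =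
      dougallProd a b c d M * (1 + b * c * wellPoised (a + M) b c d 0) := by
  induction M with
  | zero => simp [dougallProd]
  | succ M ih =>
    rw [ih, dougall_contiguous (h.add_nat M), ← mul_assoc]
    congr 1
    · have f : ∀ x₁ x₂ x₃ x₄ y₁ y₂ y₃ y₄ z₁ z₂ z₃ z₄ w₁ w₂ w₃ w₄ : ℂ,
          x₁ * x₂ * x₃ * x₄ / y₁ / y₂ / y₃ / y₄ * (z₁ * z₂ * z₃ * z₄ / (w₁ * w₂ * w₃ * w₄)) =
          x₁ * z₁ * (x₂ * z₂) * (x₃ * z₃) * (x₄ * z₄) / (y₁ * w₁) / (y₂ * w₂) / (y₃ * w₃) /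
            (y₄ * w₄) := by
        intros
        simp only [div_eq_mul_inv, mul_inv]
        ring
      simp only [dougallProd, dougallRatio, rf_succ]
      rw [show a + M + 1 = 1 + a + M by ring,
        show a + M - b - c + 1 = 1 + (a - b - c) + M by ring,
        show a + M - b - d + 1 / 2 = 1 / 2 + (a - b - d) + M by ring,
        show a + M - c - d + 1 / 2 = 1 / 2 + (a - c - d) + M by ring,
        show a + M - b + 1 = 1 + (a - b) + M by ring,
        show a + M - c + 1 = 1 + (a - c) + M by ring,
        show a + M - d + 1 / 2 = 1 / 2 + (a - d) + M by ring,
        show a + M - b - c - d + 1 / 2 = 1 / 2 + (a - b - c - d) + M by ring]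
      exact f _ _ _ _ _ _ _ _ _ _ _ _ _ _ _ _
    · push_cast
      rw [add_assoc]
end

noncomputable section

open Filter Topology Asymptotics

/-! ### Dougall's summation: the limit of the finite products -/

theorem norm_rf_le {z : ℂ} {m : ℕ} (h : ‖z‖ ≤ m) (n : ℕ) : ‖rf z n‖ ≤ (m.ascFactorial n : ℝ) := by
  induction n with
  | zero => simp
  | succ n ih =>
    rw [rf_succ, norm_mul, Nat.ascFactorial_succ, mul_comm]
    push_cast
    refine mul_le_mul ((norm_add_le _ _).trans ?_) ih (norm_nonneg _) (by positivity)
    simpa using h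

theorem le_norm_rf {z : ℂ} {m : ℕ} (h : (m : ℝ) ≤ z.re) (n : ℕ) :
    (m.ascFactorial n : ℝ) ≤ ‖rf z n‖ := by
  induction n with
  | zero => simp
  | succ n ih =>
    rw [rf_succ, norm_mul, Nat.ascFactorial_succ, mul_comm]
    push_cast
    refine mul_le_mul ih (le_trans ?_ (Complex.re_le_norm _)) (by positivity) (norm_nonneg _)
    simpa using h

/-- All parameters are small. -/
structure SmallParams (a b c d : ℂ) : Prop where
  ha : ‖a‖ ≤ 1 / 16
  hb : ‖b‖ ≤ 1 / 16
  hc : ‖c‖ ≤ 1 / 16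
  hd : ‖d‖ ≤ 1 / 16

theorem SmallParams.re {a b c d : ℂ} (h : SmallParams a b c d) :
    |a.re| ≤ 1 / 16 ∧ |b.re| ≤ 1 / 16 ∧ |c.re| ≤ 1 / 16 ∧ |d.re| ≤ 1 / 16 :=
  ⟨(Complex.abs_re_le_norm a).trans h.ha, (Complex.abs_re_le_norm b).trans h.hb,
    (Complex.abs_re_le_norm c).trans h.hc, (Complex.abs_re_le_norm d).trans h.hd⟩

theorem SmallParams.regular {a b c d : ℂ} (h : SmallParams a b c d) : DougallRegular a b c d := by
  obtain ⟨ha, hb, hc, hd⟩ := h.re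
  rw [abs_le] at ha hb hc hd
  refine ⟨notPole_of_re_pos ?_, notPole_of_re_pos ?_, notPole_of_re_pos ?_, notPole_of_re_pos ?_,
    ?_⟩ <;> simp <;> linarith

/-- The first bound yields a factor `1/M`, the second decay in `k`; one of each is used below. `M ≥
5` permits comparison with the quartic `(k+5).choose 4`. -/
theorem choose_lower {M : ℕ} (hM : 5 ≤ M) (k : ℕ) :
    (M : ℝ) ≤ (M + k).choose (k + 1) ∧ ((k : ℝ) + 2) ^ 4 / 24 ≤ (M + k).choose (k + 1) := by
  constructor
  · have h1 : (M + k).choose k.succ = (M + k).choose (M - 1) := by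
      rw [← Nat.choose_symm (by omega)]; congr 1; omega
    have h2 : M.choose (M - 1) = M := by
      rw [Nat.choose_symm (by omega : 1 ≤ M), Nat.choose_one_right]
    rw [Nat.succ_eq_add_one] at h1
    rw [h1]
    exact_mod_cast h2.symm.le.trans (Nat.choose_le_choose (M - 1) (by omega : M ≤ M + k))
  · have h1 : (5 + k).choose (k + 1) = (k + 1 + 4).choose 4 := by
      rw [← Nat.choose_symm (by omega)]; congr 1 <;> omega
    have h2 : (k + 1 + 1).ascFactorial 4 = Nat.factorial 4 * (k + 1 + 4).choose 4 :=
      Nat.ascFactorial_eq_factorial_mul_choose (k + 1) 4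
    have h3 : (k + 1 + 1) ^ 4 ≤ (k + 1 + 1).ascFactorial 4 := Nat.pow_succ_le_ascFactorial _ _
    have h4 : (k + 2) ^ 4 ≤ 24 * (M + k).choose (k + 1) := by
      calc (k + 2) ^ 4 ≤ 24 * (5 + k).choose (k + 1) := by rw [h1]; rw [h2] at h3; exact h3
        _ ≤ _ := Nat.mul_le_mul_left _ (Nat.choose_le_choose _ (by omega))
    rw [div_le_iff₀ (by norm_num), mul_comm]
    exact_mod_cast h4

/-- With `f = (k+1)!` and `(M)_(k+1) = f q`, where `q` is binomial, the term is at most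
`(M+2k+3)(M+k+1) / (M (M+1) q^2)`. The part without `q` is at most `3 (k+2)^2` and `q^2 ≥ M (k+2)^4
/ 24`, which gives `72 = 3 * 24`. -/
theorem norm_shifted_term_le {a b c d : ℂ} (h : SmallParams a b c d) {M : ℕ} (hM : 5 ≤ M) (k : ℕ) :
    ‖wellPoisedTerm (a + M) b c d 0 k‖ ≤ 72 / M * (1 / ((k : ℝ) + 2) ^ 2) := by
  obtain ⟨ra, rb, rc, rd⟩ := h.re
  obtain ⟨na, nb, nc, nd⟩ := h
  rw [abs_le] at ra rb rc rd
  have hM0 : (5 : ℝ) ≤ M := by exact_mod_cast hM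
  have hk0 : (0 : ℝ) ≤ k := k.cast_nonneg
  set A : ℝ := (M.ascFactorial (k + 1) : ℝ) with hA
  have hA0 : 0 < A := by
    obtain ⟨m, rfl⟩ : ∃ m, M = m + 1 := ⟨M - 1, by omega⟩
    exact Nat.cast_pos.mpr (Nat.ascFactorial_pos m (k + 1))
  have u0 : ‖a + M + 2 * 0 + 2 * k + 2‖ ≤ M + 2 * k + 3 := by
    have : a + M + 2 * 0 + 2 * k + 2 = a + ((M + 2 * k + 2 : ℕ) : ℂ) := by push_cast; ring
    rw [this]
    refine (norm_add_le _ _).trans ?_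
    rw [Complex.norm_natCast]
    push_cast
    linarith
  have u1 : ‖rf (a + M + 0 + 1) k‖ ≤ ((M + 2).ascFactorial k : ℝ) := by
    refine norm_rf_le ?_ k
    have : a + M + 0 + 1 = a + ((M + 1 : ℕ) : ℂ) := by push_cast; ring
    rw [this]
    refine (norm_add_le _ _).trans ?_
    rw [Complex.norm_natCast]
    push_cast
    linarith
  have u2 : ∀ z : ℂ, ‖z‖ ≤ 1 / 16 → ‖rf (z + 0 + 1) k‖ ≤ ((k + 1).factorial : ℝ) := by
    intro z hz
    have e : Nat.ascFactorial 2 k = (k + 1).factorial := by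
      have := Nat.factorial_mul_ascFactorial 1 k
      rw [Nat.factorial_one, one_mul] at this
      rw [this, add_comm]
    rw [← e]
    refine norm_rf_le ((norm_add_le _ _).trans ?_) k
    simp
    linarith
  have u3 : ‖rf (d + 0 + 1 / 2) (k + 1)‖ ≤ ((k + 1).factorial : ℝ) := by
    rw [← Nat.one_ascFactorial]
    refine norm_rf_le ((norm_add_le _ _).trans ?_) _
    rw [add_zero]
    norm_num
    linarith
  have l0 : ((k + 1).factorial : ℝ) ≤ ‖rf (0 + 1) (k + 1)‖ := by
    rw [← Nat.one_ascFactorial]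
    exact le_norm_rf (by simp) _
  have l1 : A ≤ ‖rf (a + M - b + 0 + 1) (k + 1)‖ := le_norm_rf (by simp; linarith) _
  have l2 : A ≤ ‖rf (a + M - c + 0 + 1) (k + 1)‖ := le_norm_rf (by simp; linarith) _
  have l3 : A ≤ ‖rf (a + M - d + 0 + 1 / 2) (k + 1)‖ := le_norm_rf (by simp; linarith) _
  set f : ℝ := ((k + 1).factorial : ℝ) with hf
  have hf0 : 0 < f := Nat.cast_pos.mpr (k + 1).factorial_pos
  have step : ‖wellPoisedTerm (a + M) b c d 0 k‖ ≤
      (M + 2 * k + 3) * ((M + 2).ascFactorial k : ℝ) * f * f * f / (f * A * A * A) := by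
    rw [wellPoisedTerm, norm_div]
    simp only [norm_mul]
    have := u2 b nb
    have := u2 c nc
    gcongr
  have eA : A = f * (M + k).choose (k + 1) := by
    have := Nat.ascFactorial_eq_factorial_mul_choose' M (k + 1)
    rw [hA, this, show M + (k + 1) - 1 = M + k by omega]
    push_cast
    rfl
  have eB : (M : ℝ) * (M + 1) * ((M + 2).ascFactorial k : ℝ) = A * (M + k + 1) := by
    have h1 : M * (M + 1) * (M + 2).ascFactorial k = M.ascFactorial (k + 2) := by
      rw [add_comm k 2, ← Nat.ascFactorial_mul_ascFactorial]
      simp only [Nat.ascFactorial_succ, Nat.ascFactorial_zero]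
      ring
    rw [Nat.ascFactorial_succ] at h1
    rw [hA]
    push_cast [← @Nat.cast_inj ℝ] at h1
    linear_combination h1
  obtain ⟨c1, c2⟩ := choose_lower hM k
  set q : ℝ := ((M + k).choose (k + 1) : ℝ) with hq
  have hq0 : 0 < q := by linarith
  have eB' : ((M + 2).ascFactorial k : ℝ) = f * q * (M + k + 1) / (M * (M + 1)) := by
    rw [eq_div_iff (by positivity), ← eA]
    linear_combination eB
  refine step.trans ?_
  rw [eB', eA]
  have e : (M + 2 * k + 3) * (f * q * (M + k + 1) / (M * (M + 1))) * f * f * f /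
      (f * (f * q) * (f * q) * (f * q)) =
      (M + 2 * k + 3) * (M + k + 1) / (M * (M + 1)) / (q * q) := by
    field_simp
  rw [e]
  have b1 : (M + 2 * k + 3) * (M + k + 1) / (M * (M + 1)) ≤ 3 * ((k : ℝ) + 2) ^ 2 := by
    rw [div_le_iff₀ (by positivity)]
    have i1 : (M + 2 * k + 3 : ℝ) ≤ 3 * ((k + 2) * M) := by nlinarith
    have i2 : (M + k + 1 : ℝ) ≤ (k + 2) * (M + 1) := by nlinarith
    calc (M + 2 * k + 3 : ℝ) * (M + k + 1) ≤ 3 * ((k + 2) * M) * ((k + 2) * (M + 1)) := by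
          gcongr
      _ = _ := by ring
  have b2 : M * (((k : ℝ) + 2) ^ 4 / 24) ≤ q * q := by gcongr
  calc (M + 2 * k + 3) * (M + k + 1) / (M * (M + 1)) / (q * q) ≤
        3 * ((k : ℝ) + 2) ^ 2 / (M * (((k : ℝ) + 2) ^ 4 / 24)) := by gcongr
    _ = 72 / M * (1 / ((k : ℝ) + 2) ^ 2) := by
        field_simp
        norm_num

theorem exists_norm_wellPoised_le : ∃ C : ℝ, 0 < C ∧ ∀ a b c d : ℂ, SmallParams a b c d →
    ∀ M : ℕ, 5 ≤ M → ‖wellPoised (a + M) b c d 0‖ ≤ C / M := by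
  have hs : Summable fun k : ℕ => 1 / ((k : ℝ) + 2) ^ 2 := by
    have := (summable_nat_add_iff 2).mpr (Real.summable_one_div_nat_pow.mpr one_lt_two)
    simpa using this
  have h0 : 0 < ∑' k : ℕ, 1 / ((k : ℝ) + 2) ^ 2 := hs.tsum_pos (fun k => by positivity) 0 (by norm_num)
  refine ⟨72 * ∑' k : ℕ, 1 / ((k : ℝ) + 2) ^ 2, by positivity, fun a b c d h M hM => ?_⟩
  have := tsum_of_norm_bounded (hs.hasSum.mul_left (72 / (M : ℝ)))
    (norm_shifted_term_le h hM)
  refine this.trans (le_of_eq ?_)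
  ring

theorem JetRec.tendsto {t L : ℕ → ℕ → ℂ} {t' L' : ℕ → ℂ} (h : ∀ M, JetRec (t M) (L M))
    (ht : ∀ k, Tendsto (fun M => t M k) atTop (𝓝 (t' k)))
    (hL : ∀ k, Tendsto (fun M => L M k) atTop (𝓝 (L' k))) : JetRec t' L' := fun k =>
  tendsto_nhds_unique ((ht (k + 1)).const_mul _ |>.congr fun M => h M k)
    (tendsto_finsetSum _ fun i _ => (hL i).mul (ht (k - i)))

/-- Weierstrass: locally uniform limits of holomorphic functions may be differentiated term by term.
-/
theorem tendsto_taylor {F : ℕ → ℂ → ℂ} {f : ℂ → ℂ} {U : Set ℂ} (hU : IsOpen U) (h0 : (0 : ℂ) ∈ U)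
    (hF : ∀ M, DifferentiableOn ℂ (F M) U) (h : TendstoLocallyUniformlyOn F f atTop U) (N : ℕ) :
    Tendsto (fun M => taylor (F M) N) atTop (𝓝 (taylor f N)) := by
  refine Tendsto.div_const ?_ _
  induction N generalizing F f with
  | zero => simpa using h.tendsto_at h0
  | succ N ih =>
    simp only [iteratedDeriv_succ']
    exact ih (fun M => (hF M).deriv hU) (h.deriv (.of_forall hF) hU)

/-- The limit of the logarithmic derivative of `dougallProd`. -/
def logJetDougall (a b c d : ℂ) (k : ℕ) : ℂ :=
  if k = 0 then 0 else (-1) ^ k * riemannZeta (k + 1) *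
    (a ^ (k + 1) + (a - b - c) ^ (k + 1) - (a - b) ^ (k + 1) - (a - c) ^ (k + 1) +
      (2 ^ (k + 1) - 1) * ((a - b - d) ^ (k + 1) + (a - c - d) ^ (k + 1) - (a - d) ^ (k + 1) -
        (a - b - c - d) ^ (k + 1)))

theorem tendsto_H {s : ℕ} (hs : 1 < s) :
    Tendsto (fun n => H s n) atTop (𝓝 (riemannZeta s)) := by
  rw [zeta_nat_eq_tsum_of_gt_one hs]
  have h1 : Summable fun n : ℕ => 1 / (n : ℂ) ^ s := by
    have := (Complex.summable_one_div_nat_cpow (p := s)).mpr (by simpa using hs)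
    simpa using this
  have := h1.hasSum.tendsto_sum_nat.comp (tendsto_add_atTop_nat 1)
  refine this.congr fun n => ?_
  rw [Function.comp_apply, Finset.sum_range_succ', H, Finset.range_eq_Ico,
    Finset.sum_Ico_add' (fun j : ℕ => 1 / (j : ℂ) ^ s)]
  simp [show s ≠ 0 by omega]
  rfl

theorem dougallProd_line (a b c d x : ℂ) (M : ℕ) :
    dougallProd (a * x) (b * x) (c * x) (d * x) M =
      rf (1 + a * x) M * rf (1 + (a - b - c) * x) M * rf (1 / 2 + (a - b - d) * x) M *
      rf (1 / 2 + (a - c - d) * x) M / rf (1 + (a - b) * x) M / rf (1 + (a - c) * x) M /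
      rf (1 / 2 + (a - d) * x) M / rf (1 / 2 + (a - b - c - d) * x) M := by
  simp only [dougallProd, sub_mul]

theorem logJet_dougallProd (a b c d : ℂ) (M : ℕ) :
    LogJet (fun x => dougallProd (a * x) (b * x) (c * x) (d * x) M) fun k =>
      (-1) ^ k * ((a ^ (k + 1) + (a - b - c) ^ (k + 1) - (a - b) ^ (k + 1) - (a - c) ^ (k + 1)) *
        H (k + 1) M + ((a - b - d) ^ (k + 1) + (a - c - d) ^ (k + 1) - (a - d) ^ (k + 1) -
        (a - b - c - d) ^ (k + 1)) * (2 ^ (k + 1) * H (k + 1) (2 * M) - H (k + 1) M)) := by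
  have z1 : ∀ α : ℂ, rf (1 + α * 0) M ≠ 0 := fun α => by simpa using notPole_one.rf_ne_zero M
  have z2 : ∀ α : ℂ, rf (1 / 2 + α * 0) M ≠ 0 := fun α => by
    simpa using notPole_half.rf_ne_zero M
  have o : ∀ α : ℂ, LogJet (fun x => rf (1 + α * x) M) _ := fun α => LogJet.rf notPole_one α M
  have h : ∀ α : ℂ, LogJet (fun x => rf (1 / 2 + α * x) M) _ :=
    fun α => LogJet.rf notPole_half α M
  have := (((((((o a).mul (o (a - b - c))).mul (h (a - b - d))).mul (h (a - c - d))).div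
    (o (a - b)) (z1 _)).div (o (a - c)) (z1 _)).div (h (a - d)) (z2 _)).div
    (h (a - b - c - d)) (z2 _)
  simp_rw [dougallProd_line]
  refine (congrArg (LogJet _) (funext fun k => ?_)).mp this
  simp only [shiftedHarmonic_one, shiftedHarmonic_half]
  ring

theorem differentiable_rf_line (c α : ℂ) (n : ℕ) : Differentiable ℂ fun x => rf (c + α * x) n := by
  induction n with
  | zero => simp
  | succ n ih =>
    simp only [rf_succ]
    exact ih.mul (by fun_prop)

theorem eventually_smallParams (a b c d : ℂ) :
    ∀ᶠ x : ℂ in 𝓝 0, SmallParams (a * x) (b * x) (c * x) (d * x) := by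
  have h : ∀ z : ℂ, ∀ᶠ x : ℂ in 𝓝 0, ‖z * x‖ ≤ 1 / 16 := by
    intro z
    have : Tendsto (fun x : ℂ => ‖z * x‖) (𝓝 0) (𝓝 ‖z * 0‖) :=
      (continuous_const.mul continuous_id).norm.tendsto 0
    rw [mul_zero, norm_zero] at this
    exact this.eventually_le_const (by norm_num)
  filter_upwards [h a, h b, h c, h d] with x h1 h2 h3 h4
  exact ⟨h1, h2, h3, h4⟩

/-- Near `0` the finite products converge uniformly to Dougall's sum, so their Taylor coefficients
converge; their logarithmic jets converge to `logJetDougall`. The recursion linking the two survives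
the limit. -/
theorem jetRec_dougall (a b c d : ℂ) : JetRec
    (taylor fun x => 1 + b * x * (c * x) * wellPoised (a * x) (b * x) (c * x) (d * x) 0)
    (logJetDougall a b c d) := by
  refine JetRec.tendsto (fun M => (logJet_dougallProd a b c d M).jetRec) (fun N => ?_) fun k => ?_
  · have hW : AnalyticAt ℂ (fun x => 1 + b * x * (c * x) *
        wellPoised (a * x) (b * x) (c * x) (d * x) 0) 0 := by
      have h1 : AnalyticAt ℂ (fun x : ℂ => (![a * x, b * x, c * x, d * x, 0] : Fin 5 → ℂ)) 0 := by
        rw [analyticAt_pi_iff]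
        intro i
        fin_cases i <;> simp <;> fun_prop
      have h2 := AnalyticAt.fun_comp (g := uncurry5 wellPoised) (f := fun x : ℂ =>
        (![a * x, b * x, c * x, d * x, 0] : Fin 5 → ℂ)) (x := 0) (by
          convert analyticAt_wellPoised using 1
          ext i; fin_cases i <;> simp) h1
      have h3 : AnalyticAt ℂ (fun x => wellPoised (a * x) (b * x) (c * x) (d * x) 0) 0 := h2
      fun_prop
    obtain ⟨C, hC, hb⟩ := exists_norm_wellPoised_le
    obtain ⟨ε, hε, hball⟩ := Metric.eventually_nhds_iff_ball.mp
      ((eventually_smallParams a b c d).and (hW.continuousAt.norm.eventually_le_const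
        (lt_add_one _)))
    set D : ℂ → ℂ := fun x => 1 + b * x * (c * x) * wellPoised (a * x) (b * x) (c * x) (d * x) 0
    refine tendsto_taylor (U := Metric.ball 0 ε) Metric.isOpen_ball (Metric.mem_ball_self hε)
      (fun M x hx => ?_) ?_ N
    · simp_rw [dougallProd_line]
      obtain ⟨h1, h2, h3, h4, h5⟩ := (hball x hx).1.regular
      have n1 : rf (1 + (a - b) * x) M ≠ 0 := by
        convert h2.rf_ne_zero M using 2; ring
      have n2 : rf (1 + (a - c) * x) M ≠ 0 := by
        convert h3.rf_ne_zero M using 2; ring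
      have n3 : rf (1 / 2 + (a - d) * x) M ≠ 0 := by
        convert h4.rf_ne_zero M using 2; ring
      have n4 : rf (1 / 2 + (a - b - c - d) * x) M ≠ 0 := by
        refine (notPole_of_re_pos ?_).rf_ne_zero M
        have e : 1 / 2 + (a - b - c - d) * x = a * x - b * x - c * x - d * x + 1 / 2 := by ring
        have e' : (1 / 2 : ℂ).re = 1 / 2 := by norm_num
        rw [e, Complex.add_re, e']
        linarith
      have g := fun α => (differentiable_rf_line 1 α M).differentiableAt (x := x)
      have g' := fun α => (differentiable_rf_line (1 / 2) α M).differentiableAt (x := x)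
      exact ((((((((g a).fun_mul (g _)).fun_mul (g' _)).fun_mul (g' _)).fun_div (g _) n1).fun_div
        (g _) n2).fun_div (g' _) n3).fun_div (g' _) n4).differentiableWithinAt
    · refine TendstoUniformlyOn.tendstoLocallyUniformlyOn ?_
      rw [Metric.tendstoUniformlyOn_iff]
      intro δ hδ
      have t1 : Tendsto (fun M : ℕ => C / (M : ℝ)) atTop (𝓝 0) :=
        tendsto_const_div_atTop_nhds_zero_nat C
      have t2 : Tendsto (fun M : ℕ => 2 * (‖D 0‖ + 1) * (C / (M : ℝ))) atTop (𝓝 0) := by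
        simpa using t1.const_mul (2 * (‖D 0‖ + 1))
      filter_upwards [t1.eventually_le_const (show (0 : ℝ) < 1 / 2 by norm_num),
        t2.eventually_lt_const hδ, eventually_ge_atTop 5] with M i1 i2 i3 x hx
      obtain ⟨hs, hD⟩ := hball x hx
      have eD : D x = dougallProd (a * x) (b * x) (c * x) (d * x) M *
          (1 + b * x * (c * x) * wellPoised (a * x + M) (b * x) (c * x) (d * x) 0) :=
        dougall_finite hs.regular M
      have hw : ‖b * x * (c * x) * wellPoised (a * x + M) (b * x) (c * x) (d * x) 0‖ ≤
          C / (M : ℝ) := by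
        rw [norm_mul, norm_mul]
        have h1 : ‖b * x‖ * ‖c * x‖ ≤ 1 := by
          have := hs.hb
          have := hs.hc
          nlinarith [norm_nonneg (b * x), norm_nonneg (c * x)]
        exact (mul_le_of_le_one_left (norm_nonneg _) h1).trans (hb _ _ _ _ hs M i3)
      generalize b * x * (c * x) * wellPoised (a * x + M) (b * x) (c * x) (d * x) 0 = w at *
      generalize dougallProd (a * x) (b * x) (c * x) (d * x) M = R at *
      -- The product is bounded because `R * (1 + w)` is the bounded function `D` and `‖1 + w‖ ≥
      -- 1/2`.
      have hR : ‖R‖ ≤ 2 * (‖D 0‖ + 1) := by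
        have h1 : ‖R‖ * ‖1 + w‖ ≤ ‖D 0‖ + 1 := by rw [← norm_mul, ← eD]; exact hD
        have h2 : 1 / 2 ≤ ‖1 + w‖ := by
          have := norm_sub_le (1 + w) w
          rw [add_sub_cancel_right, norm_one] at this
          linarith
        nlinarith [norm_nonneg R]
      rw [eD, dist_eq_norm, show R * (1 + w) - R = R * w by ring, norm_mul]
      refine lt_of_le_of_lt ?_ i2
      gcongr
  · rcases Nat.eq_zero_or_pos k with rfl | hk
    -- For `k = 0` the harmonic sums diverge, but both of their coefficients vanish identically.
    · refine tendsto_const_nhds.congr fun M => ?_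
      simp [logJetDougall]
      ring
    · have h1 := tendsto_H (show 1 < k + 1 by omega)
      have h2 := h1.comp (tendsto_id.const_mul_atTop' (show 0 < 2 by norm_num))
      have := ((h1.const_mul (a ^ (k + 1) + (a - b - c) ^ (k + 1) - (a - b) ^ (k + 1) -
        (a - c) ^ (k + 1))).add (((h2.const_mul (2 ^ (k + 1))).sub h1).const_mul
        ((a - b - d) ^ (k + 1) + (a - c - d) ^ (k + 1) - (a - d) ^ (k + 1) -
        (a - b - c - d) ^ (k + 1)))).const_mul ((-1) ^ k)
      refine (congrArg (fun z => Tendsto _ _ (𝓝 z)) ?_).mp this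
      simp only [logJetDougall, if_neg hk.ne']
      push_cast
      ring
end

noncomputable section

open Filter Topology Asymptotics

/-! ### Taylor coefficients of the very-well-poised series on lines -/

/-- The `N`-th Taylor coefficient of the series on the line spanned by `(a, b, c, d, e)`. -/
def lineW (a b c d e : ℚ) (N : ℕ) : ℂ := taylor (onLine wellPoised ![a, b, c, d, e]) N

/-- The substitution fixes `a + 2e` and interchanges `(a+e+1)_k` with `(b+e+1)_k` and `(e+1)_(k+1)`
with `(a-b+e+1)_(k+1)`, so every term is unchanged. It brings a line with `e = b - a` to `e = 0`. -/
theorem wellPoised_swap_left (a b c d e : ℂ) :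
    wellPoised a b c d e = wellPoised (2 * b - a) b (b + c - a) (b + d - a) (a - b + e) := by
  unfold wellPoised
  refine tsum_congr fun k => ?_
  unfold wellPoisedTerm
  congr 1 <;> ring_nf

theorem wellPoised_swap_right (a b c d e : ℂ) :
    wellPoised a b c d e = wellPoised (2 * c - a) (b + c - a) c (c + d - a) (a - c + e) := by
  unfold wellPoised
  refine tsum_congr fun k => ?_
  unfold wellPoisedTerm
  congr 1 <;> ring_nf

theorem lineW_swap_left (a b c d e : ℚ) (N : ℕ) :
    lineW a b c d e N = lineW (2 * b - a) b (b + c - a) (b + d - a) (a - b + e) N := by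
  unfold lineW
  congr 1
  funext x
  simp only [onLine, Matrix.cons_val]
  rw [wellPoised_swap_left]
  push_cast
  congr 1 <;> ring

theorem lineW_swap_right (a b c d e : ℚ) (N : ℕ) :
    lineW a b c d e N = lineW (2 * c - a) (b + c - a) c (c + d - a) (a - c + e) N := by
  unfold lineW
  congr 1
  funext x
  simp only [onLine, Matrix.cons_val]
  rw [wellPoised_swap_right]
  push_cast
  congr 1 <;> ring

theorem analyticAt_onLine_wellPoised (v : Fin 5 → ℚ) : AnalyticAt ℂ (onLine wellPoised v) 0 := by
  have h1 : AnalyticAt ℂ (fun x : ℂ => fun i => x * (v i : ℂ)) 0 := by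
    rw [analyticAt_pi_iff]
    intro i
    fun_prop
  refine AnalyticAt.fun_comp (g := uncurry5 wellPoised) (f := fun x : ℂ => fun i => x * (v i : ℂ))
    (x := 0) ?_ h1
  convert analyticAt_wellPoised using 1
  ext i
  simp

/-- On a line the factor `b x * c x` shifts the Taylor index by two. Recovering `lineW` requires
division by `b c`, so both must be nonzero in the evaluations that follow. -/
theorem exists_jetRec_lineW (a b c d : ℚ) : ∃ t : ℕ → ℂ, JetRec t (logJetDougall a b c d) ∧
    t 0 = 1 ∧ ∀ N, t (N + 2) = b * c * lineW a b c d 0 N := by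
  refine ⟨_, jetRec_dougall a b c d, by simp [taylor_zero], fun N => ?_⟩
  have hW := analyticAt_onLine_wellPoised ![a, b, c, d, 0]
  have h1 : AnalyticAt ℂ (fun x => x * onLine wellPoised ![a, b, c, d, 0] x) 0 :=
    analyticAt_id.mul hW
  have h2 : AnalyticAt ℂ (fun x => x * (x * onLine wellPoised ![a, b, c, d, 0] x)) 0 :=
    analyticAt_id.mul h1
  have h3 : AnalyticAt ℂ (fun x => (b * c : ℂ) * (x * (x * onLine wellPoised ![a, b, c, d, 0] x)))
    0 := analyticAt_const.mul h2
  have e : (fun x : ℂ => 1 + b * x * (c * x) * wellPoised (a * x) (b * x) (c * x) (d * x) 0) =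
      fun x => 1 + (b * c : ℂ) * (x * (x * onLine wellPoised ![a, b, c, d, 0] x)) := by
    funext x
    simp only [onLine, Matrix.cons_val, mul_comm x, Rat.cast_zero, zero_mul]
    ring
  rw [e, taylor_add analyticAt_const h3, taylor_const, if_neg (by omega), zero_add,
    taylor_const_mul, taylor_id_mul h1 (N + 1), taylor_id_mul hW N]
  rfl

/-- The combination of power sums that occurs in `logJetDougall`. -/
def powerSumDougall (a b c d : ℂ) (s : ℕ) : ℂ :=
  a ^ s + (a - b - c) ^ s - (a - b) ^ s - (a - c) ^ s +
    (2 ^ s - 1) * ((a - b - d) ^ s + (a - c - d) ^ s - (a - d) ^ s - (a - b - c - d) ^ s)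

theorem logJetDougall_zero (a b c d : ℂ) : logJetDougall a b c d 0 = 0 := if_pos rfl

theorem logJetDougall_succ (a b c d : ℂ) (k : ℕ) : logJetDougall a b c d (k + 1) =
    (-1) ^ (k + 1) * riemannZeta (k + 2 : ℕ) * powerSumDougall a b c d (k + 2) := by
  rw [logJetDougall, if_neg k.succ_ne_zero, powerSumDougall]
  push_cast
  ring_nf

/-! ### Zeta values at `6` and `8`. -/

theorem bernoulli'_six : bernoulli' 6 = 1 / 42 := by
  rw [bernoulli'_def]
  norm_num [Finset.sum_range_succ, bernoulli'_two, bernoulli'_three, bernoulli'_four,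
    bernoulli'_eq_zero_of_odd (n := 5) (by decide) (by norm_num), Nat.choose]

theorem bernoulli'_eight : bernoulli' 8 = -1 / 30 := by
  rw [bernoulli'_def]
  norm_num [Finset.sum_range_succ, bernoulli'_two, bernoulli'_three, bernoulli'_four,
    bernoulli'_eq_zero_of_odd (n := 5) (by decide) (by norm_num), bernoulli'_six,
    bernoulli'_eq_zero_of_odd (n := 7) (by decide) (by norm_num), Nat.choose]

theorem riemannZeta_six : riemannZeta 6 = (Real.pi : ℂ) ^ 6 / 945 := by
  have := riemannZeta_two_mul_nat (k := 3) (by norm_num)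
  have hb : bernoulli 6 = 1 / 42 := by
    rw [bernoulli_eq_bernoulli'_of_ne_one (by decide), bernoulli'_six]
  norm_num [hb, Nat.factorial] at this
  rw [this]
  ring

theorem riemannZeta_eight : riemannZeta 8 = (Real.pi : ℂ) ^ 8 / 9450 := by
  have := riemannZeta_two_mul_nat (k := 4) (by norm_num)
  have hb : bernoulli 8 = -1 / 30 := by
    rw [bernoulli_eq_bernoulli'_of_ne_one (by decide), bernoulli'_eight]
  norm_num [hb, Nat.factorial] at this
  rw [this]
  ring

section Dougall

variable {a b c d : ℚ}

theorem lineW_dougall_aux {N : ℕ} {w : ℂ} (hb : b ≠ 0) (hc : c ≠ 0)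
    (h : (b * c : ℂ) * lineW a b c d 0 N = w) : lineW a b c d 0 N = w / (b * c) := by
  have h1 : (b : ℂ) ≠ 0 := by exact_mod_cast hb
  have h2 : (c : ℂ) ≠ 0 := by exact_mod_cast hc
  rw [eq_div_iff (mul_ne_zero h1 h2), ← h, mul_comm]

theorem lineW_zero (hb : b ≠ 0) (hc : c ≠ 0) : lineW a b c d 0 0 =
    -powerSumDougall a b c d 2 * ((Real.pi : ℂ) ^ 2 / 12) / (b * c) := by
  obtain ⟨t, h, h0, ht⟩ := exists_jetRec_lineW a b c d
  refine lineW_dougall_aux hb hc ?_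
  rw [← ht, h.two, h0, logJetDougall_zero, logJetDougall_succ]
  norm_num [riemannZeta_two]
  ring

theorem lineW_one (hb : b ≠ 0) (hc : c ≠ 0) : lineW a b c d 0 1 =
    powerSumDougall a b c d 3 * (riemannZeta 3 / 3) / (b * c) := by
  obtain ⟨t, h, h0, ht⟩ := exists_jetRec_lineW a b c d
  refine lineW_dougall_aux hb hc ?_
  rw [← ht, h.three, h0, logJetDougall_zero, logJetDougall_succ, logJetDougall_succ]
  norm_num
  ring

theorem lineW_two (hb : b ≠ 0) (hc : c ≠ 0) : lineW a b c d 0 2 =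
    (powerSumDougall a b c d 2 ^ 2 / 288 - powerSumDougall a b c d 4 / 360) * (Real.pi : ℂ) ^ 4 /
      (b * c) := by
  obtain ⟨t, h, h0, ht⟩ := exists_jetRec_lineW a b c d
  refine lineW_dougall_aux hb hc ?_
  rw [← ht, h.four, h0, logJetDougall_zero, logJetDougall_succ, logJetDougall_succ,
    logJetDougall_succ]
  norm_num [riemannZeta_two, riemannZeta_four]
  ring

theorem lineW_three (hb : b ≠ 0) (hc : c ≠ 0) : lineW a b c d 0 3 =
    (powerSumDougall a b c d 5 / 5 * riemannZeta 5 -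
      powerSumDougall a b c d 2 * powerSumDougall a b c d 3 / 36 *
        ((Real.pi : ℂ) ^ 2 * riemannZeta 3)) / (b * c) := by
  obtain ⟨t, h, h0, ht⟩ := exists_jetRec_lineW a b c d
  refine lineW_dougall_aux hb hc ?_
  rw [← ht, h.five (logJetDougall_zero _ _ _ _), h0, logJetDougall_succ, logJetDougall_succ,
    logJetDougall_succ]
  norm_num [riemannZeta_two]
  ring

theorem lineW_four (hb : b ≠ 0) (hc : c ≠ 0) : lineW a b c d 0 4 =
    ((-powerSumDougall a b c d 6 / 5670 +
      powerSumDougall a b c d 2 * powerSumDougall a b c d 4 / 4320 -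
      powerSumDougall a b c d 2 ^ 3 / 10368) * (Real.pi : ℂ) ^ 6 +
      powerSumDougall a b c d 3 ^ 2 / 18 * riemannZeta 3 ^ 2) / (b * c) := by
  obtain ⟨t, h, h0, ht⟩ := exists_jetRec_lineW a b c d
  refine lineW_dougall_aux hb hc ?_
  rw [← ht, h.six (logJetDougall_zero _ _ _ _), h0, logJetDougall_succ, logJetDougall_succ,
    logJetDougall_succ, logJetDougall_succ]
  norm_num [riemannZeta_two, riemannZeta_four, riemannZeta_six]
  ring

end Dougall

/-! ### Lines on which the terms of the series are rational. -/

theorem wellPoisedTerm_rational {s u : ℂ} (h0 : NotPole (s + 1)) (h1 : NotPole (s - u + 1))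
    (h2 : NotPole (s + u + 1)) (h3 : NotPole (s + 1 / 2)) (k : ℕ) :
    wellPoisedTerm 0 u (-u) 0 s k = 2 * ((k + 1 + (s - u))⁻¹ * (k + 1 + (s + u))⁻¹) := by
  have r0 := h0.rf_ne_zero k
  have r1 := h1.rf_ne_zero k
  have r2 := h2.rf_ne_zero k
  have r3 := h3.rf_ne_zero (k + 1)
  have n0 := h0.add_nat_ne k
  have n1 := h1.add_nat_ne k
  have n2 := h2.add_nat_ne k
  have e1 : k + 1 + (s - u) = s - u + 1 + k := by ring
  have e2 : k + 1 + (s + u) = s + u + 1 + k := by ring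
  rw [wellPoisedTerm, e1, e2]
  simp only [zero_add, zero_sub, neg_neg, neg_add_eq_sub, sub_zero, add_comm u s]
  generalize rf (s + 1 / 2) (k + 1) = R at *
  simp only [rf_succ _ k]
  field_simp
  ring

theorem taylor_sum {ι : Type*} (s : Finset ι) {f : ι → ℂ → ℂ} (hf : ∀ i ∈ s, AnalyticAt ℂ (f i) 0)
    (N : ℕ) : taylor (fun x => ∑ i ∈ s, f i x) N = ∑ i ∈ s, taylor (f i) N := by
  unfold taylor
  rw [iteratedDeriv_fun_sum fun i hi => (hf i hi).contDiffAt, Finset.sum_div]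

/-- The `k`-th term is `2 / ((k+1+(s-1)x)(k+1+(s+1)x))`, whose `N`-th coefficient is a constant over
`(k+1)^(N+2)`. The majorant `8/(k+1)^2` on a small disc justifies termwise expansion. -/
theorem lineW_rational (s : ℚ) (N : ℕ) : lineW 0 1 (-1) 0 s N =
    2 * (-1) ^ N * (∑ i ∈ Finset.range (N + 1), ((s : ℂ) - 1) ^ i * (s + 1) ^ (N - i)) *
      riemannZeta (N + 2 : ℕ) := by
  set T : ℕ → ℂ → ℂ := fun k x =>
    2 * (((k + 1 : ℂ) + (s - 1) * x)⁻¹ * ((k + 1 : ℂ) + (s + 1) * x)⁻¹) with hT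
  have hk : ∀ k : ℕ, (k + 1 : ℂ) ≠ 0 := fun k => by exact_mod_cast k.succ_ne_zero
  have hi : ∀ (k : ℕ) (α : ℂ), AnalyticAt ℂ (fun x => ((k + 1 : ℂ) + α * x)⁻¹) 0 := fun k α =>
    AnalyticAt.inv (by fun_prop) (by simpa using hk k)
  obtain ⟨ε, hε, hball⟩ : ∃ ε > 0, ∀ x ∈ Metric.ball (0 : ℂ) ε,
      ‖((s : ℂ) - 1) * x‖ ≤ 1 / 4 ∧ ‖((s : ℂ) + 1) * x‖ ≤ 1 / 4 := by
    have h : ∀ z : ℂ, ∀ᶠ x : ℂ in 𝓝 0, ‖z * x‖ ≤ 1 / 4 := by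
      intro z
      have : Tendsto (fun x : ℂ => ‖z * x‖) (𝓝 0) (𝓝 ‖z * 0‖) :=
        (continuous_const.mul continuous_id).norm.tendsto 0
      rw [mul_zero, norm_zero] at this
      exact this.eventually_le_const (by norm_num)
    exact Metric.eventually_nhds_iff_ball.mp ((h _).and (h _))
  have low : ∀ (k : ℕ) (z : ℂ), ‖z‖ ≤ 1 / 4 → ((k : ℝ) + 1) / 2 ≤ ‖(k + 1 : ℂ) + z‖ := by
    intro k z hz
    have h1 := norm_sub_norm_le (k + 1 : ℂ) (-z)
    rw [norm_neg, sub_neg_eq_add] at h1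
    have h2 : ‖(k + 1 : ℂ)‖ = (k : ℝ) + 1 := by
      rw [← Nat.cast_succ, Complex.norm_natCast]; push_cast; rfl
    have := k.cast_nonneg (α := ℝ)
    linarith
  have eT : onLine wellPoised ![0, 1, -1, 0, s] =ᶠ[𝓝 0] fun x => ∑' k, T k x := by
    filter_upwards [Metric.ball_mem_nhds 0 hε] with x hx
    obtain ⟨b1, b2⟩ := hball x hx
    have b0 : ‖x * (s : ℂ)‖ ≤ 1 / 4 := by
      have e : x * (s : ℂ) = ((s - 1) * x + (s + 1) * x) / 2 := by ring
      have := norm_add_le (((s : ℂ) - 1) * x) ((s + 1) * x)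
      rw [e, norm_div, Complex.norm_ofNat]
      linarith
    have np : ∀ z : ℂ, ‖z‖ ≤ 1 / 4 → NotPole (z + 1) ∧ NotPole (z + 1 / 2) := by
      intro z hz
      have := (abs_le.mp ((Complex.abs_re_le_norm z).trans hz)).1
      constructor <;> refine notPole_of_re_pos ?_ <;> norm_num <;> linarith
    rw [onLine]
    simp only [Matrix.cons_val, Rat.cast_zero, Rat.cast_one, Rat.cast_neg, mul_zero, mul_one,
      mul_neg]
    refine tsum_congr fun k => ?_
    rw [wellPoisedTerm_rational (np _ b0).1 _ _ (np _ b0).2]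
    · simp only [hT]
      ring_nf
    · convert (np _ b1).1 using 1; ring
    · convert (np _ b2).1 using 1; ring
  have hs : Summable fun k : ℕ => 8 * (1 / ((k : ℝ) + 1) ^ 2) := by
    refine Summable.mul_left _ ?_
    have := (summable_nat_add_iff 1).mpr (Real.summable_one_div_nat_pow.mpr one_lt_two)
    simpa using this
  have hu := tendstoUniformlyOn_tsum_nat (f := T) (s := Metric.ball 0 ε) hs fun k x hx => by
    obtain ⟨b1, b2⟩ := hball x hx
    have h1 := low k _ b1
    have h2 := low k _ b2
    rw [hT, norm_mul, norm_mul, norm_inv, norm_inv, Complex.norm_ofNat]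
    have : (0 : ℝ) < ((k : ℝ) + 1) / 2 := by positivity
    calc 2 * (‖(k + 1 : ℂ) + (s - 1) * x‖⁻¹ * ‖(k + 1 : ℂ) + (s + 1) * x‖⁻¹) ≤
          2 * ((((k : ℝ) + 1) / 2)⁻¹ * (((k : ℝ) + 1) / 2)⁻¹) := by gcongr
      _ = _ := by field_simp; norm_num
  have h1 := tendsto_taylor Metric.isOpen_ball (Metric.mem_ball_self hε) (fun M x hx => ?_)
    hu.tendstoLocallyUniformlyOn N
  · rw [lineW, taylor_congr eT]
    refine tendsto_nhds_unique h1 ?_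
    have h2 := (tendsto_H (show 1 < N + 2 by omega)).const_mul
      (2 * (-1) ^ N * (∑ i ∈ Finset.range (N + 1), ((s : ℂ) - 1) ^ i * (s + 1) ^ (N - i)))
    refine h2.congr fun M => ?_
    rw [taylor_sum _ fun k _ => analyticAt_const.fun_mul ((hi k _).fun_mul (hi k _)),
      ← shiftedHarmonic_one, shiftedHarmonic, Finset.mul_sum]
    refine Finset.sum_congr rfl fun k _ => ?_
    rw [taylor_const_mul, taylor_mul (hi k _) (hi k _), Finset.mul_sum, Finset.sum_mul,
      Finset.mul_sum]
    refine Finset.sum_congr rfl fun i hiN => ?_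
    rw [Finset.mem_range] at hiN
    rw [taylor_inv_linear (hk k), taylor_inv_linear (hk k)]
    obtain ⟨j, rfl⟩ : ∃ j, N = i + j := ⟨N - i, by omega⟩
    rw [Nat.add_sub_cancel_left, add_comm 1 (k : ℂ), div_mul_div_comm, ← pow_add,
      show i + 1 + (j + 1) = i + j + 2 by ring]
    ring
  · obtain ⟨b1, b2⟩ := hball x hx
    have : (0 : ℝ) < 1 / 4 := by norm_num
    have ne : ∀ (k : ℕ) (z : ℂ), ‖z‖ ≤ 1 / 4 → (k + 1 : ℂ) + z ≠ 0 := fun k z hz => by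
      have h1 := low k z hz
      have : (0 : ℝ) < ((k : ℝ) + 1) / 2 := by positivity
      exact norm_pos_iff.mp (by linarith)
    refine DifferentiableWithinAt.fun_sum fun k _ => DifferentiableAt.differentiableWithinAt ?_
    refine DifferentiableAt.const_mul (DifferentiableAt.fun_mul ?_ ?_) _
    · exact DifferentiableAt.fun_inv (by fun_prop) (ne k _ b1)
    · exact DifferentiableAt.fun_inv (by fun_prop) (ne k _ b2)

end

noncomputable section

open Filter Topology

/-! ### Taylor coefficients of the summand on lines -/

/-- The `N`-th Taylor coefficient of `S₁` on the line spanned by `(a, b, c, d, e)`. -/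
def lineS (a b c d e : ℚ) (N : ℕ) : ℕ+ → ℂ :=
  fun n => taylor (onLine (fun a b c d e => S₁ a b c d e n) ![a, b, c, d, e]) N

theorem lineS_mem (a b c d e : ℚ) (N : ℕ) : lineS a b c d e N ∈ V S₁ N :=
  taylor_onLine_mem_V _ N

theorem hasSum_lineS (a b c d e : ℚ) (N : ℕ) : HasSum (lineS a b c d e N) (lineW a b c d e N) :=
  hasSum_taylor_onLine _ N

/-- Up to sign, `logJetS₁` in terms of `ν = 1 / n`, `μ = 1 / (2 n - 1)` and harmonic numbers `h`
and `k`. -/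
def jetS₁ (a b c d e ν μ h k : ℂ) (s : ℕ) : ℂ :=
  ((-b) ^ s + (a + e) ^ s + (c + e) ^ s + (a - b - c) ^ s) * (h - ν ^ s) +
    ((d + e) ^ s - (a - d + e) ^ s - (a - b - c - d) ^ s) * (2 ^ s * k - h) +
    (a - b - d) ^ s * (2 ^ s * k - h - 2 ^ s * μ ^ s) - (e ^ s + (a - c + e) ^ s) * h -
    (a - b + e) ^ s * k

theorem logJetS₁_eq (a b c d e : ℂ) (n k : ℕ) : logJetS₁ a b c d e n k =
    (-1) ^ k * jetS₁ a b c d e (1 / n) (1 / (2 * n - 1)) (H (k + 1) n) (H (k + 1) (2 * n))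
      (k + 1) := by
  simp only [logJetS₁, jetS₁, div_pow, one_pow]
  ring

/-- `P₁coeffOne` divided by `n ^ 4`, with `ν = 1 / n`. -/
def lineP₁ (a b c d e ν : ℂ) : ℂ :=
  ν ^ 3 * (-3 * a + 2 * b + c - 4 * e) + ν ^ 2 * (3 * (6 * a - 4 * b - 2 * c - 2 * d + 6 * e))

/-- `P₁coeffTwo` divided by `n ^ 4`, with `ν = 1 / n`. -/
def lineP₂ (a b c d e ν : ℂ) : ℂ :=
  ν ^ 4 * (-a ^ 2 + a * (b + c - 2 * e) + e * (2 * b + c - e)) +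
    ν ^ 3 * (10 * a ^ 2 - a * (14 * b + 6 * c + 6 * d - 22 * e) + 4 * b ^ 2 +
      2 * b * (2 * c + 2 * d - 8 * e) + 2 * c * d - 8 * c * e - 8 * d * e + 10 * e ^ 2)

theorem lineS_spec (a b c d e : ℚ) (n : ℕ+) : ∃ t : ℕ → ℂ,
    JetRec t (logJetS₁ a b c d e n) ∧ t 0 = -aSeq n / ((n : ℂ) ^ 4 * (2 * n - 1)) ∧
    lineS a b c d e 0 n = (10 * (n : ℂ) ^ 3 - 3 * (n : ℂ) ^ 2) * t 0 ∧
    lineS a b c d e 1 n = (10 * (n : ℂ) ^ 3 - 3 * (n : ℂ) ^ 2) * t 1 +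
      P₁coeffOne a b c d e n * t 0 ∧
    lineS a b c d e 2 n = (10 * (n : ℂ) ^ 3 - 3 * (n : ℂ) ^ 2) * t 2 +
      P₁coeffOne a b c d e n * t 1 + P₁coeffTwo a b c d e n * t 0 ∧
    ∀ N, lineS a b c d e (N + 3) n = (10 * (n : ℂ) ^ 3 - 3 * (n : ℂ) ^ 2) * t (N + 3) +
      P₁coeffOne a b c d e n * t (N + 2) + P₁coeffTwo a b c d e n * t (N + 1) +
      P₁coeffThree a b c d e * t N := by
  obtain ⟨m, hm⟩ := Nat.exists_eq_succ_of_ne_zero n.ne_zero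
  rw [Nat.succ_eq_add_one] at hm
  have h := logJet_hyperS₁ a b c d e m
  have hl : onLine (fun a b c d e => S₁ a b c d e n) ![a, b, c, d, e] = fun x =>
      ((10 * (n : ℂ) ^ 3 - 3 * (n : ℂ) ^ 2) + P₁coeffOne a b c d e n * x +
        P₁coeffTwo a b c d e n * x ^ 2 + P₁coeffThree a b c d e * x ^ 3) *
        hyperS₁ a b c d e m x := by
    funext x
    rw [onLine, hm, ← S₁_line]
    rfl
  unfold lineS
  rw [hl]
  obtain ⟨h0, h1, h2⟩ := taylor_cubic_mul_low h.1 (10 * (n : ℂ) ^ 3 - 3 * (n : ℂ) ^ 2)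
    (P₁coeffOne a b c d e n) (P₁coeffTwo a b c d e n) (P₁coeffThree a b c d e)
  refine ⟨_, hm ▸ h.jetRec, ?_, h0, h1, h2, taylor_cubic_mul h.1 _ _ _ _⟩
  rw [taylor_zero, hyperS₁_zero, hm]

section

variable (a b c d e : ℚ) (n : ℕ+)

/-- `jetS₁` on the line spanned by `(a, b, c, d, e)`. -/
def lineJ (n : ℕ) (s : ℕ) : ℂ :=
  jetS₁ a b c d e (1 / n) (1 / (2 * n - 1)) (H s n) (H s (2 * n)) s

theorem logJetS₁_rat (n k : ℕ) :
    logJetS₁ a b c d e n k = (-1) ^ k * lineJ a b c d e n (k + 1) :=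
  logJetS₁_eq a b c d e n k

theorem two_mul_sub_one_ne : 2 * (n : ℂ) - 1 ≠ 0 := by
  obtain ⟨m, hm⟩ := Nat.exists_eq_succ_of_ne_zero n.ne_zero
  rw [hm]
  push_cast
  rw [show 2 * ((m : ℂ) + 1) - 1 = 2 * m + 1 by ring]
  exact_mod_cast (2 * m).succ_ne_zero

/-- `1/n` and `1/(2n-1)` are algebraically dependent; summands are compared as polynomials in them
modulo this relation. -/
theorem inv_relation : 2 * (1 / (2 * (n : ℂ) - 1)) - 1 / (n : ℂ) -
    1 / (n : ℂ) * (1 / (2 * (n : ℂ) - 1)) = 0 := by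
  have hn : (n : ℂ) ≠ 0 := by exact_mod_cast n.ne_zero
  have hm := two_mul_sub_one_ne n
  field_simp
  ring

theorem lineS_zero : lineS a b c d e 0 n = -aSeq n * (1 / (2 * (n : ℂ) - 1)) * (10 * (1 / (n : ℂ)) - 3 * (1 / (n : ℂ)) ^ 2) := by
  obtain ⟨t, h, h0, l, -⟩ := lineS_spec a b c d e n
  have hn : (n : ℂ) ≠ 0 := by exact_mod_cast n.ne_zero
  have hm := two_mul_sub_one_ne n
  rw [l, h0]
  field_simp

theorem lineS_one : lineS a b c d e 1 n = -aSeq n * (1 / (2 * (n : ℂ) - 1)) *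
    ((10 * (1 / (n : ℂ)) - 3 * (1 / (n : ℂ)) ^ 2) * lineJ a b c d e n 1 + lineP₁ a b c d e (1 / (n : ℂ))) := by
  obtain ⟨t, h, h0, -, l, -⟩ := lineS_spec a b c d e n
  have hn : (n : ℂ) ≠ 0 := by exact_mod_cast n.ne_zero
  have hm := two_mul_sub_one_ne n
  rw [l, h.one, h0, logJetS₁_rat]
  norm_num only
  generalize lineJ _ _ _ _ _ _ 1 = x
  simp only [lineP₁, P₁coeffOne]
  field_simp
  ring

theorem lineS_two : lineS a b c d e 2 n = -aSeq n * (1 / (2 * (n : ℂ) - 1)) *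
    ((10 * (1 / (n : ℂ)) - 3 * (1 / (n : ℂ)) ^ 2) * ((lineJ a b c d e n 1 ^ 2 - lineJ a b c d e n 2) / 2) + lineP₁ a b c d e (1 / (n : ℂ)) * lineJ a b c d e n 1 +
      lineP₂ a b c d e (1 / (n : ℂ))) := by
  obtain ⟨t, h, h0, -, -, l, -⟩ := lineS_spec a b c d e n
  have hn : (n : ℂ) ≠ 0 := by exact_mod_cast n.ne_zero
  have hm := two_mul_sub_one_ne n
  rw [l, h.two, h.one, h0, logJetS₁_rat, logJetS₁_rat]
  norm_num only
  generalize lineJ _ _ _ _ _ _ 1 = x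
  generalize lineJ _ _ _ _ _ _ 2 = y
  simp only [lineP₁, P₁coeffOne, lineP₂, P₁coeffTwo]
  field_simp
  ring

theorem lineS_three : lineS a b c d e 3 n = -aSeq n * (1 / (2 * (n : ℂ) - 1)) *
    ((10 * (1 / (n : ℂ)) - 3 * (1 / (n : ℂ)) ^ 2) * ((lineJ a b c d e n 1 ^ 3 - 3 * lineJ a b c d e n 1 * lineJ a b c d e n 2 + 2 * lineJ a b c d e n 3) / 6) +
      lineP₁ a b c d e (1 / (n : ℂ)) * ((lineJ a b c d e n 1 ^ 2 - lineJ a b c d e n 2) / 2) + lineP₂ a b c d e (1 / (n : ℂ)) * lineJ a b c d e n 1 +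
      (1 / (n : ℂ)) ^ 4 * P₁coeffThree a b c d e) := by
  obtain ⟨t, h, h0, -, -, -, l⟩ := lineS_spec a b c d e n
  have hn : (n : ℂ) ≠ 0 := by exact_mod_cast n.ne_zero
  have hm := two_mul_sub_one_ne n
  rw [l 0, h.three, h.two, h.one, h0, logJetS₁_rat, logJetS₁_rat, logJetS₁_rat]
  norm_num only
  generalize lineJ _ _ _ _ _ _ 1 = x
  generalize lineJ _ _ _ _ _ _ 2 = y
  generalize lineJ _ _ _ _ _ _ 3 = z
  generalize P₁coeffThree _ _ _ _ _ = p₃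
  simp only [lineP₁, P₁coeffOne, lineP₂, P₁coeffTwo]
  field_simp
  ring

theorem lineS_four : lineS a b c d e 4 n = -aSeq n * (1 / (2 * (n : ℂ) - 1)) *
    ((10 * (1 / (n : ℂ)) - 3 * (1 / (n : ℂ)) ^ 2) * ((lineJ a b c d e n 1 ^ 4 - 6 * lineJ a b c d e n 1 ^ 2 * lineJ a b c d e n 2 + 3 * lineJ a b c d e n 2 ^ 2 +
        8 * lineJ a b c d e n 1 * lineJ a b c d e n 3 - 6 * lineJ a b c d e n 4) / 24) +
      lineP₁ a b c d e (1 / (n : ℂ)) * ((lineJ a b c d e n 1 ^ 3 - 3 * lineJ a b c d e n 1 * lineJ a b c d e n 2 + 2 * lineJ a b c d e n 3) / 6) +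
      lineP₂ a b c d e (1 / (n : ℂ)) * ((lineJ a b c d e n 1 ^ 2 - lineJ a b c d e n 2) / 2) + (1 / (n : ℂ)) ^ 4 * P₁coeffThree a b c d e * lineJ a b c d e n 1) := by
  obtain ⟨t, h, h0, -, -, -, l⟩ := lineS_spec a b c d e n
  have hn : (n : ℂ) ≠ 0 := by exact_mod_cast n.ne_zero
  have hm := two_mul_sub_one_ne n
  rw [l 1, h.four, h.three, h.two, h.one, h0, logJetS₁_rat, logJetS₁_rat, logJetS₁_rat, logJetS₁_rat]
  norm_num only
  generalize lineJ _ _ _ _ _ _ 1 = x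
  generalize lineJ _ _ _ _ _ _ 2 = y
  generalize lineJ _ _ _ _ _ _ 3 = z
  generalize lineJ _ _ _ _ _ _ 4 = w
  generalize P₁coeffThree _ _ _ _ _ = p₃
  have e1 : P₁coeffOne a b c d e n = n ^ 4 * lineP₁ a b c d e (1 / (n : ℂ)) := by
    simp only [lineP₁, P₁coeffOne]
    field_simp
  have e2 : P₁coeffTwo a b c d e n = n ^ 4 * lineP₂ a b c d e (1 / (n : ℂ)) := by
    simp only [lineP₂, P₁coeffTwo]
    field_simp
  rw [e1, e2]
  field_simp
  ring

/-- With all odd jets zero, `t 3` and `t 5` vanish, so only the even jets and two coefficients of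
the cubic survive. -/
theorem lineS_six (h1 : lineJ a b c d e n 1 = 0) (h3 : lineJ a b c d e n 3 = 0) (h5 : lineJ a b c d e n 5 = 0) :
    lineS a b c d e 6 n = -aSeq n * (1 / (2 * (n : ℂ) - 1)) *
      ((10 * (1 / (n : ℂ)) - 3 * (1 / (n : ℂ)) ^ 2) * (-lineJ a b c d e n 6 / 6 + lineJ a b c d e n 2 * lineJ a b c d e n 4 / 8 - lineJ a b c d e n 2 ^ 3 / 48) +
        lineP₂ a b c d e (1 / (n : ℂ)) * ((3 * lineJ a b c d e n 2 ^ 2 - 6 * lineJ a b c d e n 4) / 24)) := by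
  obtain ⟨t, h, h0, -, -, -, l⟩ := lineS_spec a b c d e n
  have hn : (n : ℂ) ≠ 0 := by exact_mod_cast n.ne_zero
  have hm := two_mul_sub_one_ne n
  have hz : logJetS₁ a b c d e n 0 = 0 := by rw [logJetS₁_rat, zero_add, h1, mul_zero]
  rw [l 3, h.six hz, h.five hz, h.four, h.three, h0, logJetS₁_rat, logJetS₁_rat, logJetS₁_rat,
    logJetS₁_rat, logJetS₁_rat, logJetS₁_rat]
  norm_num only
  rw [h1, h3, h5]
  generalize lineJ _ _ _ _ _ _ 2 = y
  generalize lineJ _ _ _ _ _ _ 4 = w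
  generalize lineJ _ _ _ _ _ _ 6 = z
  have e2 : P₁coeffTwo a b c d e n = n ^ 4 * lineP₂ a b c d e (1 / (n : ℂ)) := by
    simp only [lineP₂, P₁coeffTwo]
    field_simp
  rw [e2]
  field_simp
  ring

end

/-- Each list entry is a weight followed by a direction. Linearity turns an identity into two finite
checks, one of the summand for each `n` and one of the value. -/
theorem CoeffIdentity.of_lines {N : ℕ} {g : ℕ → ℂ} {s : ℂ} (l : List (ℚ × ℚ × ℚ × ℚ × ℚ × ℚ))
    (hg : ∀ n : ℕ+, aTimes g n =
      (l.map fun (q, a, b, c, d, e) => (q : ℂ) * lineS a b c d e N n).sum)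
    (hs : s = (l.map fun (q, a, b, c, d, e) => (q : ℂ) * lineW a b c d e N).sum) :
    aTimes g ∈ V S₁ N ∧ HasSum (aTimes g) s := by
  have hf : aTimes g = fun n => (l.map fun (q, a, b, c, d, e) =>
      (q : ℂ) * lineS a b c d e N n).sum := funext hg
  rw [hf, hs]
  clear hf hs hg
  induction l with
  | nil =>
    simp only [List.map_nil, List.sum_nil]
    exact ⟨zero_mem _, hasSum_zero⟩
  | cons p l ih =>
    obtain ⟨q, a, b, c, d, e⟩ := p
    simp only [List.map_cons, List.sum_cons]
    refine ⟨add_mem ?_ ih.1, ((hasSum_lineS a b c d e N).mul_left _).add ih.2⟩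
    convert (V S₁ N).smul_mem q (lineS_mem a b c d e N) using 1
    funext n
    rw [Pi.smul_apply, Rat.smul_def]

end

noncomputable section

/-! ### The identities -/

theorem summand_rational :
    aTimes (fun n => (10 * n - 3) / (n ^ 2 * (2 * n - 1))) ∈ V S₁ 0 ∧
    HasSum (aTimes (fun n => (10 * n - 3) / (n ^ 2 * (2 * n - 1))))
      (-(Real.pi : ℂ) ^ 2 / 3) := by
  -- In degree `0` the summand does not depend on the direction; this one has `b c ≠ 0`, as
  -- `lineW_zero` requires.
  refine CoeffIdentity.of_lines
    [(-1, 0, 1, -1, 0, 0)] (fun n => ?_) ?_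
  · have hn : (n : ℂ) ≠ 0 := by exact_mod_cast n.ne_zero
    have hm := two_mul_sub_one_ne n
    have hg : aTimes (fun n => (10 * n - 3) / (n ^ 2 * (2 * n - 1))) n =
        aSeq n * ((10 * (1 / (n : ℂ)) - 3 * (1 / (n : ℂ)) ^ 2) * (1 / (2 * (n : ℂ) - 1))) := by
      simp only [aTimes]
      field_simp
    rw [hg]
    simp only [List.map_cons, List.map_nil, List.sum_cons, List.sum_nil,
      lineS_zero]
    clear hg
    generalize 1 / (n : ℂ) = ν at *
    generalize 1 / (2 * (n : ℂ) - 1) = μ at *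
    push_cast
    ring
  · simp only [List.map_cons, List.map_nil, List.sum_cons, List.sum_nil]
    simp (disch := norm_num) only [lineW_zero, powerSumDougall]
    push_cast
    ring

theorem summand_inv_cube :
    aTimes (fun n => 5 / (n : ℂ) ^ 3) ∈ V S₁ 1 ∧
    HasSum (aTimes (fun n => 5 / (n : ℂ) ^ 3))
      (-2 * riemannZeta 3) := by
  -- The weights solve the linear system given by comparing monomials in `1/n`, `1/(2n-1)` and
  -- harmonic numbers. The directions are ones on which `lineW` can be evaluated.
  refine CoeffIdentity.of_lines
    [(-2, 0, 1, -1, -1, 0), (5 / 2, 0, 1, 0, -1, 1)] (fun n => ?_) ?_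
  · have hn : (n : ℂ) ≠ 0 := by exact_mod_cast n.ne_zero
    have hm := two_mul_sub_one_ne n
    have hr := inv_relation n
    have hg : aTimes (fun n => 5 / (n : ℂ) ^ 3) n =
        aSeq n * (5 * (1 / (n : ℂ)) ^ 3) := by
      simp only [aTimes]
      field_simp
    rw [hg]
    simp only [List.map_cons, List.map_nil, List.sum_cons, List.sum_nil,
      lineS_one, lineJ, jetS₁, lineP₁]
    clear hg
    generalize 1 / (n : ℂ) = ν at *
    generalize 1 / (2 * (n : ℂ) - 1) = μ at *
    push_cast
    -- The two sides agree only modulo the relation between `ν` and `μ`.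
    linear_combination aSeq n * (-5 * ν ^ 2) * hr
  -- Here `e = b - a` and `c = 0`; the symmetry leads to `e = 0` with `b c ≠ 0`.
  · have w1 : lineW 0 1 0 (-1) 1 1 =
        lineW 2 1 1 0 0 1 := by
      rw [lineW_swap_left]
      norm_num only
    simp only [List.map_cons, List.map_nil, List.sum_cons, List.sum_nil]
    rw [w1]
    simp (disch := norm_num) only [lineW_one, powerSumDougall]
    push_cast
    ring

theorem summand_H_one :
    aTimes (fun n => (10 * n - 3) * H 1 n / (3 * n ^ 2 * (2 * n - 1))
        - 4 * (3 * n - 1) / (3 * n ^ 2 * (2 * n - 1) ^ 2)) ∈ V S₁ 1 ∧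
    HasSum (aTimes (fun n => (10 * n - 3) * H 1 n / (3 * n ^ 2 * (2 * n - 1))
        - 4 * (3 * n - 1) / (3 * n ^ 2 * (2 * n - 1) ^ 2)))
      (riemannZeta 3 / 5) := by
  refine CoeffIdentity.of_lines
    [(1 / 2, 0, 1, -1, 0, 0), (-3 / 10, 0, 1, -1, -1, 0), (-1 / 3, 0, 1, 1, 0, 0)] (fun n => ?_) ?_
  · have hn : (n : ℂ) ≠ 0 := by exact_mod_cast n.ne_zero
    have hm := two_mul_sub_one_ne n
    have hr := inv_relation n
    have hg : aTimes (fun n => (10 * n - 3) * H 1 n / (3 * n ^ 2 * (2 * n - 1))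
        - 4 * (3 * n - 1) / (3 * n ^ 2 * (2 * n - 1) ^ 2)) n =
        aSeq n * ((10 * (1 / (n : ℂ)) - 3 * (1 / (n : ℂ)) ^ 2) * (1 / (2 * (n : ℂ) - 1)) * H
          1 n / 3 - 4 * (3 * (1 / (n : ℂ)) - (1 / (n : ℂ)) ^ 2) * (1 / (2 * (n : ℂ) - 1)) ^ 2
          / 3) := by
      simp only [aTimes]
      field_simp
    rw [hg]
    simp only [List.map_cons, List.map_nil, List.sum_cons, List.sum_nil,
      lineS_one, lineJ, jetS₁, lineP₁]
    clear hg
    generalize 1 / (n : ℂ) = ν at *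
    generalize 1 / (2 * (n : ℂ) - 1) = μ at *
    push_cast
    linear_combination aSeq n * (-1/3 * ν * μ) * hr
  · simp only [List.map_cons, List.map_nil, List.sum_cons, List.sum_nil]
    simp (disch := norm_num) only [lineW_one, powerSumDougall]
    push_cast
    ring

theorem summand_H_one_two_mul :
    aTimes (fun n => (10 * n - 3) * H 1 (2 * n) / (3 * n ^ 2 * (2 * n - 1))
        - 2 / (3 * n ^ 2 * (2 * n - 1))) ∈ V S₁ 1 ∧
    HasSum (aTimes (fun n => (10 * n - 3) * H 1 (2 * n) / (3 * n ^ 2 * (2 * n - 1))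
        - 2 / (3 * n ^ 2 * (2 * n - 1))))
      (-16 * riemannZeta 3 / 15) := by
  refine CoeffIdentity.of_lines
    [(-1 / 15, 0, 1, -1, -1, 0), (1 / 6, 0, 1, 0, -1, 1)] (fun n => ?_) ?_
  · have hn : (n : ℂ) ≠ 0 := by exact_mod_cast n.ne_zero
    have hm := two_mul_sub_one_ne n
    have hg : aTimes (fun n => (10 * n - 3) * H 1 (2 * n) / (3 * n ^ 2 * (2 * n - 1))
        - 2 / (3 * n ^ 2 * (2 * n - 1))) n =
        aSeq n * ((10 * (1 / (n : ℂ)) - 3 * (1 / (n : ℂ)) ^ 2) * (1 / (2 * (n : ℂ) - 1)) * H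
          1 (2 * n) / 3 - 2 * (1 / (n : ℂ)) ^ 2 * (1 / (2 * (n : ℂ) - 1)) / 3) := by
      simp only [aTimes]
      field_simp
    rw [hg]
    simp only [List.map_cons, List.map_nil, List.sum_cons, List.sum_nil,
      lineS_one, lineJ, jetS₁, lineP₁]
    clear hg
    generalize 1 / (n : ℂ) = ν at *
    generalize 1 / (2 * (n : ℂ) - 1) = μ at *
    push_cast
    ring
  · have w1 : lineW 0 1 0 (-1) 1 1 =
        lineW 2 1 1 0 0 1 := by
      rw [lineW_swap_left]
      norm_num only
    simp only [List.map_cons, List.map_nil, List.sum_cons, List.sum_nil]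
    rw [w1]
    simp (disch := norm_num) only [lineW_one, powerSumDougall]
    push_cast
    ring

/-! ### Identities of degree 2. -/

theorem summand_H_two :
    aTimes (fun n => (10 * n - 3) * H 2 n / (3 * n ^ 2 * (2 * n - 1))
        - (18 * n - 7) / (3 * n ^ 4 * (2 * n - 1))) ∈ V S₁ 2 ∧
    HasSum (aTimes (fun n => (10 * n - 3) * H 2 n / (3 * n ^ 2 * (2 * n - 1))
        - (18 * n - 7) / (3 * n ^ 4 * (2 * n - 1))))
      ((Real.pi : ℂ) ^ 4 / 135) := by
  -- On this line the first jet vanishes and the second involves only `H 2 n`, so a single line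
  -- produces the whole summand.
  refine CoeffIdentity.of_lines
    [(1 / 3, 2, 1, 0, 1, -1)] (fun n => ?_) ?_
  · have hn : (n : ℂ) ≠ 0 := by exact_mod_cast n.ne_zero
    have hm := two_mul_sub_one_ne n
    have hg : aTimes (fun n => (10 * n - 3) * H 2 n / (3 * n ^ 2 * (2 * n - 1))
        - (18 * n - 7) / (3 * n ^ 4 * (2 * n - 1))) n =
        aSeq n * ((10 * (1 / (n : ℂ)) - 3 * (1 / (n : ℂ)) ^ 2) * (1 / (2 * (n : ℂ) - 1)) * H
          2 n / 3 - (18 * (1 / (n : ℂ)) ^ 3 - 7 * (1 / (n : ℂ)) ^ 4) * (1 / (2 * (n : ℂ) -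
          1)) / 3) := by
      simp only [aTimes]
      field_simp
    rw [hg]
    simp only [List.map_cons, List.map_nil, List.sum_cons, List.sum_nil,
      lineS_two, lineJ, jetS₁, lineP₁, lineP₂]
    clear hg
    generalize 1 / (n : ℂ) = ν at *
    generalize 1 / (2 * (n : ℂ) - 1) = μ at *
    push_cast
    ring
  · have w1 : lineW 2 1 0 1 (-1) 2 =
        lineW 0 1 (-1) 0 0 2 := by
      rw [lineW_swap_left]
      norm_num only
    simp only [List.map_cons, List.map_nil, List.sum_cons, List.sum_nil]
    rw [w1]
    simp (disch := norm_num) only [lineW_two, powerSumDougall]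
    push_cast
    ring

theorem summand_H_two_two_mul :
    aTimes (fun n => (10 * n - 3) * H 2 (2 * n) / (3 * n ^ 2 * (2 * n - 1))
        - (9 * n - 4) / (3 * n ^ 4 * (2 * n - 1))) ∈ V S₁ 2 ∧
    HasSum (aTimes (fun n => (10 * n - 3) * H 2 (2 * n) / (3 * n ^ 2 * (2 * n - 1))
        - (9 * n - 4) / (3 * n ^ 4 * (2 * n - 1))))
      (-(Real.pi : ℂ) ^ 4 / 180) := by
  refine CoeffIdentity.of_lines
    [(-1 / 12, 1, 1, 1, 0, 0), (1 / 4, 2, 1, 0, 1, -1)] (fun n => ?_) ?_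
  · have hn : (n : ℂ) ≠ 0 := by exact_mod_cast n.ne_zero
    have hm := two_mul_sub_one_ne n
    have hg : aTimes (fun n => (10 * n - 3) * H 2 (2 * n) / (3 * n ^ 2 * (2 * n - 1))
        - (9 * n - 4) / (3 * n ^ 4 * (2 * n - 1))) n =
        aSeq n * ((10 * (1 / (n : ℂ)) - 3 * (1 / (n : ℂ)) ^ 2) * (1 / (2 * (n : ℂ) - 1)) * H
          2 (2 * n) / 3 - (9 * (1 / (n : ℂ)) ^ 3 - 4 * (1 / (n : ℂ)) ^ 4) * (1 / (2 * (n : ℂ)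
          - 1)) / 3) := by
      simp only [aTimes]
      field_simp
    rw [hg]
    simp only [List.map_cons, List.map_nil, List.sum_cons, List.sum_nil,
      lineS_two, lineJ, jetS₁, lineP₁, lineP₂]
    clear hg
    generalize 1 / (n : ℂ) = ν at *
    generalize 1 / (2 * (n : ℂ) - 1) = μ at *
    push_cast
    ring
  · have w1 : lineW 2 1 0 1 (-1) 2 =
        lineW 0 1 (-1) 0 0 2 := by
      rw [lineW_swap_left]
      norm_num only
    simp only [List.map_cons, List.map_nil, List.sum_cons, List.sum_nil]
    rw [w1]
    simp (disch := norm_num) only [lineW_two, powerSumDougall]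
    push_cast
    ring

theorem summand_H_one_sq :
    aTimes (fun n => (10 * n - 3) * H 1 n ^ 2 / (3 * n ^ 2 * (2 * n - 1))
        - 8 * (3 * n - 1) * H 1 n / (3 * n ^ 2 * (2 * n - 1) ^ 2)
        + 4 * (34 * n ^ 3 - 6 * n ^ 2 - 7 * n + 2) / (15 * n ^ 4 * (2 * n - 1) ^ 3)) ∈ V S₁ 2 ∧
    HasSum (aTimes (fun n => (10 * n - 3) * H 1 n ^ 2 / (3 * n ^ 2 * (2 * n - 1))
        - 8 * (3 * n - 1) * H 1 n / (3 * n ^ 2 * (2 * n - 1) ^ 2)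
        + 4 * (34 * n ^ 3 - 6 * n ^ 2 - 7 * n + 2) / (15 * n ^ 4 * (2 * n - 1) ^ 3)))
      (-41 * (Real.pi : ℂ) ^ 4 / 2700) := by
  refine CoeffIdentity.of_lines
    [(1 / 10, 0, 1, -2, 1, 1), (-19 / 30, 0, 1, 0, 0, 1), (1 / 15, 4, 2, 3, 1, 0)] (fun n => ?_) ?_
  · have hn : (n : ℂ) ≠ 0 := by exact_mod_cast n.ne_zero
    have hm := two_mul_sub_one_ne n
    have hr := inv_relation n
    have hg : aTimes (fun n => (10 * n - 3) * H 1 n ^ 2 / (3 * n ^ 2 * (2 * n - 1))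
        - 8 * (3 * n - 1) * H 1 n / (3 * n ^ 2 * (2 * n - 1) ^ 2)
        + 4 * (34 * n ^ 3 - 6 * n ^ 2 - 7 * n + 2) / (15 * n ^ 4 * (2 * n - 1) ^ 3)) n =
        aSeq n * ((10 * (1 / (n : ℂ)) - 3 * (1 / (n : ℂ)) ^ 2) * (1 / (2 * (n : ℂ) - 1)) * H
          1 n ^ 2 / 3 - 8 * (3 * (1 / (n : ℂ)) - (1 / (n : ℂ)) ^ 2) * (1 / (2 * (n : ℂ) - 1))
          ^ 2 * H 1 n / 3 + 4 * (34 * (1 / (n : ℂ)) - 6 * (1 / (n : ℂ)) ^ 2 - 7 * (1 / (n :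
          ℂ)) ^ 3 + 2 * (1 / (n : ℂ)) ^ 4) * (1 / (2 * (n : ℂ) - 1)) ^ 3 / 15) := by
      simp only [aTimes]
      field_simp
    rw [hg]
    simp only [List.map_cons, List.map_nil, List.sum_cons, List.sum_nil,
      lineS_two, lineJ, jetS₁, lineP₁, lineP₂]
    clear hg
    generalize 1 / (n : ℂ) = ν at *
    generalize 1 / (2 * (n : ℂ) - 1) = μ at *
    push_cast
    -- The reduction modulo `hr` is made separately in each coefficient of the harmonic number.
    linear_combination aSeq n * (-2/3 * ν * μ * H 1 n + 6/5 * ν * μ ^ 2 + 4/15 * ν ^ 2 * μ +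
      4/5 * ν ^ 2 * μ ^ 2 + 8/15 * ν ^ 3 * μ - 8/15 * ν ^ 3 * μ ^ 2) * hr
  · have w1 : lineW 0 1 (-2) 1 1 2 =
        lineW 2 1 (-1) 2 0 2 := by
      rw [lineW_swap_left]
      norm_num only
    have w2 : lineW 0 1 0 0 1 2 =
        lineW 2 1 1 1 0 2 := by
      rw [lineW_swap_left]
      norm_num only
    simp only [List.map_cons, List.map_nil, List.sum_cons, List.sum_nil]
    rw [w1, w2]
    simp (disch := norm_num) only [lineW_two, powerSumDougall]
    push_cast
    ring

theorem summand_H_one_two_mul_sq :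
    aTimes (fun n => (10 * n - 3) * H 1 (2 * n) ^ 2 / (3 * n ^ 2 * (2 * n - 1))
        - 4 * H 1 (2 * n) / (3 * n ^ 2 * (2 * n - 1))
        + (37 * n - 16) / (15 * n ^ 4 * (2 * n - 1))) ∈ V S₁ 2 ∧
    HasSum (aTimes (fun n => (10 * n - 3) * H 1 (2 * n) ^ 2 / (3 * n ^ 2 * (2 * n - 1))
        - 4 * H 1 (2 * n) / (3 * n ^ 2 * (2 * n - 1))
        + (37 * n - 16) / (15 * n ^ 4 * (2 * n - 1))))
      (-19 * (Real.pi : ℂ) ^ 4 / 900) := by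
  refine CoeffIdentity.of_lines
    [(-1 / 8, 2, 1, -1, 1, -1), (-1 / 120, 2, 2, -1, 0, 0), (2 / 15, 0, 1, 1, -1, 0)] (fun n => ?_) ?_
  · have hn : (n : ℂ) ≠ 0 := by exact_mod_cast n.ne_zero
    have hm := two_mul_sub_one_ne n
    have hg : aTimes (fun n => (10 * n - 3) * H 1 (2 * n) ^ 2 / (3 * n ^ 2 * (2 * n - 1))
        - 4 * H 1 (2 * n) / (3 * n ^ 2 * (2 * n - 1))
        + (37 * n - 16) / (15 * n ^ 4 * (2 * n - 1))) n =
        aSeq n * ((10 * (1 / (n : ℂ)) - 3 * (1 / (n : ℂ)) ^ 2) * (1 / (2 * (n : ℂ) - 1)) * H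
          1 (2 * n) ^ 2 / 3 - 4 * (1 / (n : ℂ)) ^ 2 * (1 / (2 * (n : ℂ) - 1)) * H 1 (2 * n) /
          3 + (37 * (1 / (n : ℂ)) ^ 3 - 16 * (1 / (n : ℂ)) ^ 4) * (1 / (2 * (n : ℂ) - 1)) / 15) := by
      simp only [aTimes]
      field_simp
    rw [hg]
    simp only [List.map_cons, List.map_nil, List.sum_cons, List.sum_nil,
      lineS_two, lineJ, jetS₁, lineP₁, lineP₂]
    clear hg
    generalize 1 / (n : ℂ) = ν at *
    generalize 1 / (2 * (n : ℂ) - 1) = μ at *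
    push_cast
    ring
  · have w1 : lineW 2 1 (-1) 1 (-1) 2 =
        lineW 0 1 (-2) 0 0 2 := by
      rw [lineW_swap_left]
      norm_num only
    simp only [List.map_cons, List.map_nil, List.sum_cons, List.sum_nil]
    rw [w1]
    simp (disch := norm_num) only [lineW_two, powerSumDougall]
    push_cast
    ring

/-! ### Identities of degree 3. -/

theorem summand_H_three :
    aTimes (fun n => (10 * n - 3) * H 3 n / (3 * n ^ 2 * (2 * n - 1))
        - (38 * n - 17) / (3 * n ^ 5 * (2 * n - 1))) ∈ V S₁ 3 ∧
    HasSum (aTimes (fun n => (10 * n - 3) * H 3 n / (3 * n ^ 2 * (2 * n - 1))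
        - (38 * n - 17) / (3 * n ^ 5 * (2 * n - 1))))
      (-(16 / 3) * riemannZeta 5 + 2 / 3 * (Real.pi : ℂ) ^ 2 * riemannZeta 3) := by
  -- The weights also have to cancel all products of harmonic numbers that are absent from the
  -- summand, hence the number of lines.
  refine CoeffIdentity.of_lines
    [(10 / 21, 2, 1, -1, 1, -1), (-1 / 14, 4, 2, 0, 1, -2), (145 / 84, 0, 1, -2, 0,
      0), (-265 / 504, 2, 3, -1, 2, 0), (111 / 56, 2, 3, 1, 2, 0), (25 / 24, 0, 1, 1,
      0, 0), (-20 / 7, 0, 1, 1, -2, 1), (-5 / 42, 0, 1, 1, -1, 1), (-53 / 14, 1, 1,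
      1, 1, 0), (-179 / 56, 0, 1, -1, 0, 0), (-355 / 252, 2, 3, 2, 2, 0)] (fun n => ?_) ?_
  · have hn : (n : ℂ) ≠ 0 := by exact_mod_cast n.ne_zero
    have hm := two_mul_sub_one_ne n
    have hg : aTimes (fun n => (10 * n - 3) * H 3 n / (3 * n ^ 2 * (2 * n - 1))
        - (38 * n - 17) / (3 * n ^ 5 * (2 * n - 1))) n =
        aSeq n * ((10 * (1 / (n : ℂ)) - 3 * (1 / (n : ℂ)) ^ 2) * (1 / (2 * (n : ℂ) - 1)) * H
          3 n / 3 - (38 * (1 / (n : ℂ)) ^ 4 - 17 * (1 / (n : ℂ)) ^ 5) * (1 / (2 * (n : ℂ) -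
          1)) / 3) := by
      simp only [aTimes]
      field_simp
    rw [hg]
    simp only [List.map_cons, List.map_nil, List.sum_cons, List.sum_nil,
      lineS_three, lineJ, jetS₁, lineP₁, lineP₂, P₁coeffThree]
    clear hg
    generalize 1 / (n : ℂ) = ν at *
    generalize 1 / (2 * (n : ℂ) - 1) = μ at *
    push_cast
    ring
  · have w1 : lineW 2 1 (-1) 1 (-1) 3 =
        lineW 0 1 (-2) 0 0 3 := by
      rw [lineW_swap_left]
      norm_num only
    have w2 : lineW 4 2 0 1 (-2) 3 =
        lineW 0 2 (-2) (-1) 0 3 := by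
      rw [lineW_swap_left]
      norm_num only
    have w3 : lineW 0 1 1 (-2) 1 3 =
        lineW 2 1 2 (-1) 0 3 := by
      rw [lineW_swap_left]
      norm_num only
    have w4 : lineW 0 1 1 (-1) 1 3 =
        lineW 2 1 2 0 0 3 := by
      rw [lineW_swap_left]
      norm_num only
    simp only [List.map_cons, List.map_nil, List.sum_cons, List.sum_nil]
    rw [w1, w2, w3, w4]
    simp (disch := norm_num) only [lineW_three, powerSumDougall]
    push_cast
    ring

theorem summand_H_three_two_mul :
    aTimes (fun n => (10 * n - 3) * H 3 (2 * n) / (3 * n ^ 2 * (2 * n - 1))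
        + (32 * n - 17) / (12 * n ^ 5 * (2 * n - 1))) ∈ V S₁ 3 ∧
    HasSum (aTimes (fun n => (10 * n - 3) * H 3 (2 * n) / (3 * n ^ 2 * (2 * n - 1))
        + (32 * n - 17) / (12 * n ^ 5 * (2 * n - 1))))
      (8 / 3 * riemannZeta 5 - 7 / 18 * (Real.pi : ℂ) ^ 2 * riemannZeta 3) := by
  refine CoeffIdentity.of_lines
    [(-331 / 2016, 2, 1, 2, 1, 0), (-643 / 6048, 0, 1, -2, -1, 0), (-3119 / 12096, 0,
      1, -1, 0, 0), (-1937 / 6048, 0, 1, 1, -1, 1), (5 / 504, 0, 2, -2, 1, 0), (163 /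
      1008, 0, 1, -1, -1, 0), (397 / 1728, 0, 1, 1, 0, 0), (-5 / 1512, 0, 2, -1, 1,
      2), (5 / 864, 2, -1, 2, 0, 0), (-235 / 756, 0, 1, 1, -1, 0), (31 / 504, 0, 1,
      0, -1, 1), (-2699 / 24192, 0, 1, 2, 0, 0), (2839 / 24192, 0, 1, -2, 0, 0)] (fun n => ?_) ?_
  · have hn : (n : ℂ) ≠ 0 := by exact_mod_cast n.ne_zero
    have hm := two_mul_sub_one_ne n
    have hg : aTimes (fun n => (10 * n - 3) * H 3 (2 * n) / (3 * n ^ 2 * (2 * n - 1))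
        + (32 * n - 17) / (12 * n ^ 5 * (2 * n - 1))) n =
        aSeq n * ((10 * (1 / (n : ℂ)) - 3 * (1 / (n : ℂ)) ^ 2) * (1 / (2 * (n : ℂ) - 1)) * H
          3 (2 * n) / 3 + (32 * (1 / (n : ℂ)) ^ 4 - 17 * (1 / (n : ℂ)) ^ 5) * (1 / (2 * (n :
          ℂ) - 1)) / 12) := by
      simp only [aTimes]
      field_simp
    rw [hg]
    simp only [List.map_cons, List.map_nil, List.sum_cons, List.sum_nil,
      lineS_three, lineJ, jetS₁, lineP₁, lineP₂, P₁coeffThree]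
    clear hg
    generalize 1 / (n : ℂ) = ν at *
    generalize 1 / (2 * (n : ℂ) - 1) = μ at *
    push_cast
    ring
  · have w1 : lineW 0 1 1 (-1) 1 3 =
        lineW 2 1 2 0 0 3 := by
      rw [lineW_swap_left]
      norm_num only
    have w2 : lineW 0 2 (-1) 1 2 3 =
        lineW 4 2 1 3 0 3 := by
      rw [lineW_swap_left]
      norm_num only
    have w3 : lineW 0 1 0 (-1) 1 3 =
        lineW 2 1 1 0 0 3 := by
      rw [lineW_swap_left]
      norm_num only
    simp only [List.map_cons, List.map_nil, List.sum_cons, List.sum_nil]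
    rw [w1, w2, w3]
    simp (disch := norm_num) only [lineW_three, powerSumDougall]
    push_cast
    ring

theorem summand_H_two_two_mul_div_cube :
    aTimes (fun n => H 2 (2 * n) / n ^ 3 - 32 / (5 * n ^ 5)) ∈ V S₁ 3 ∧
    HasSum (aTimes (fun n => H 2 (2 * n) / n ^ 3 - 32 / (5 * n ^ 5)))
      (-(41 / 5) * riemannZeta 5 + 14 / 15 * (Real.pi : ℂ) ^ 2 * riemannZeta 3) := by
  -- The same thirteen directions as for `summand_H_three_two_mul`, with other weights.
  refine CoeffIdentity.of_lines
    [(1087 / 1680, 2, 1, 2, 1, 0), (347 / 1008, 0, 1, -2, -1, 0), (1699 / 2016, 0, 1,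
      -1, 0, 0), (5969 / 5040, 0, 1, 1, -1, 1), (-1 / 84, 0, 2, -2, 1, 0), (-83 /
      168, 0, 1, -1, -1, 0), (-233 / 288, 0, 1, 1, 0, 0), (1 / 252, 0, 2, -1, 1, 2),
      (-1 / 144, 2, -1, 2, 0, 0), (823 / 630, 0, 1, 1, -1, 0), (-73 / 420, 0, 1, 0,
      -1, 1), (1615 / 4032, 0, 1, 2, 0, 0), (-1643 / 4032, 0, 1, -2, 0, 0)] (fun n => ?_) ?_
  · have hn : (n : ℂ) ≠ 0 := by exact_mod_cast n.ne_zero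
    have hm := two_mul_sub_one_ne n
    have hr := inv_relation n
    have hg : aTimes (fun n => H 2 (2 * n) / n ^ 3 - 32 / (5 * n ^ 5)) n =
        aSeq n * (H 2 (2 * n) * (1 / (n : ℂ)) ^ 3 - 32 * (1 / (n : ℂ)) ^ 5 / 5) := by
      simp only [aTimes]
      field_simp
    rw [hg]
    simp only [List.map_cons, List.map_nil, List.sum_cons, List.sum_nil,
      lineS_three, lineJ, jetS₁, lineP₁, lineP₂, P₁coeffThree]
    clear hg
    generalize 1 / (n : ℂ) = ν at *
    generalize 1 / (2 * (n : ℂ) - 1) = μ at *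
    push_cast
    linear_combination aSeq n * (-ν ^ 2 * H 2 (2 * n) + 32/5 * ν ^ 4) * hr
  · have w1 : lineW 0 1 1 (-1) 1 3 =
        lineW 2 1 2 0 0 3 := by
      rw [lineW_swap_left]
      norm_num only
    have w2 : lineW 0 2 (-1) 1 2 3 =
        lineW 4 2 1 3 0 3 := by
      rw [lineW_swap_left]
      norm_num only
    have w3 : lineW 0 1 0 (-1) 1 3 =
        lineW 2 1 1 0 0 3 := by
      rw [lineW_swap_left]
      norm_num only
    simp only [List.map_cons, List.map_nil, List.sum_cons, List.sum_nil]
    rw [w1, w2, w3]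
    simp (disch := norm_num) only [lineW_three, powerSumDougall]
    push_cast
    ring

/-! ### Identities of degree 4. -/

theorem summand_H_four :
    aTimes (fun n => (10 * n - 3) * H 4 n / (3 * n ^ 2 * (2 * n - 1))
        - 4 * (7 * n - 3) / (3 * n ^ 6 * (2 * n - 1))) ∈ V S₁ 4 ∧
    HasSum (aTimes (fun n => (10 * n - 3) * H 4 n / (3 * n ^ 2 * (2 * n - 1))
        - 4 * (7 * n - 3) / (3 * n ^ 6 * (2 * n - 1))))
      ((Real.pi : ℂ) ^ 6 / 1215 + 8 / 15 * riemannZeta 3 ^ 2) := by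
  refine CoeffIdentity.of_lines
    [(-2539 / 17010, 0, 1, 2, 0, 0), (-1889 / 945, 1, 1, 1, 0, 0), (-1 / 1134, 0, 2,
      1, 1, 2), (-25 / 54, 2, 1, 0, 1, -1), (-4429 / 42525, 0, 2, 1, 0, 0), (158 /
      315, 0, 1, 1, -1, 1), (-257 / 2835, 0, 1, -1, -1, 0), (-1 / 9, 2, 2, 1, -1, 0),
      (-17 / 26460, 2, 0, -1, -1, -3), (-1 / 630, 2, 1, -1, 2, 0), (-1 / 54, 0, 1,
      -1, 0, -3), (17671 / 34020, 0, 1, -1, 0, 0), (-181 / 2835, 0, 1, 2, -1, 0),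
      (188 / 2835, 0, 1, -2, -1, 0), (-13 / 810, 0, 1, 2, -1, 1), (-29 / 882, 0, 2,
      -1, -1, 0), (197 / 567, 0, 0, 1, 0, 1), (59 / 630, 0, 1, -1, 0, -1), (7673 /
      5670, 0, 1, 1, 0, 0), (82 / 315, 1, 1, 1, 1, 0), (17 / 45, 2, 1, 0, 1, 0),
      (-3499 / 28350, 0, 1, -2, 0, 0)] (fun n => ?_) ?_
  · have hn : (n : ℂ) ≠ 0 := by exact_mod_cast n.ne_zero
    have hm := two_mul_sub_one_ne n
    have hg : aTimes (fun n => (10 * n - 3) * H 4 n / (3 * n ^ 2 * (2 * n - 1))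
        - 4 * (7 * n - 3) / (3 * n ^ 6 * (2 * n - 1))) n =
        aSeq n * ((10 * (1 / (n : ℂ)) - 3 * (1 / (n : ℂ)) ^ 2) * (1 / (2 * (n : ℂ) - 1)) * H
          4 n / 3 - 4 * (7 * (1 / (n : ℂ)) ^ 5 - 3 * (1 / (n : ℂ)) ^ 6) * (1 / (2 * (n : ℂ) -
          1)) / 3) := by
      simp only [aTimes]
      field_simp
    rw [hg]
    simp only [List.map_cons, List.map_nil, List.sum_cons, List.sum_nil,
      lineS_four, lineJ, jetS₁, lineP₁, lineP₂, P₁coeffThree]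
    clear hg
    generalize 1 / (n : ℂ) = ν at *
    generalize 1 / (2 * (n : ℂ) - 1) = μ at *
    push_cast
    ring
  · have w1 : lineW 0 2 1 1 2 4 =
        lineW 4 2 3 3 0 4 := by
      rw [lineW_swap_left]
      norm_num only
    have w2 : lineW 2 1 0 1 (-1) 4 =
        lineW 0 1 (-1) 0 0 4 := by
      rw [lineW_swap_left]
      norm_num only
    have w3 : lineW 0 1 1 (-1) 1 4 =
        lineW 2 1 2 0 0 4 := by
      rw [lineW_swap_left]
      norm_num only
    -- Here `e = c - a`, so the symmetry in `c` is the one that reaches `e = 0`.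
    have w4 : lineW 2 0 (-1) (-1) (-3) 4 =
        lineW (-4) (-3) (-1) (-4) 0 4 := by
      rw [lineW_swap_right]
      norm_num only
    -- `e` is none of `0`, `b - a`, `c - a`, but `a = d = 0` and `c = -b`, so the terms are
    -- rational.
    have w5 : lineW 0 1 (-1) 0 (-3) 4 = 992 / 945 * (Real.pi : ℂ) ^ 6 := by
      rw [lineW_rational]
      norm_num [Finset.sum_range_succ, riemannZeta_six]
      ring
    have w6 : lineW 0 1 2 (-1) 1 4 =
        lineW 2 1 3 0 0 4 := by
      rw [lineW_swap_left]
      norm_num only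
    have w7 : lineW 0 0 1 0 1 4 =
        lineW 2 1 1 1 0 4 := by
      rw [lineW_swap_right]
      norm_num only
    have w8 : lineW 0 1 (-1) 0 (-1) 4 = 32 / 945 * (Real.pi : ℂ) ^ 6 := by
      rw [lineW_rational]
      norm_num [Finset.sum_range_succ, riemannZeta_six]
      ring
    -- Although `e = 0`, division by `b c` is impossible because `c = 0`; the symmetry leads to a
    -- line with rational terms.
    have w9 : lineW 2 1 0 1 0 4 = 32 / 945 * (Real.pi : ℂ) ^ 6 := by
      rw [lineW_swap_left]
      norm_num only
      rw [lineW_rational]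
      norm_num [Finset.sum_range_succ, riemannZeta_six]
      ring
    simp only [List.map_cons, List.map_nil, List.sum_cons, List.sum_nil]
    rw [w1, w2, w3, w4, w5, w6, w7, w8, w9]
    simp (disch := norm_num) only [lineW_four, powerSumDougall]
    push_cast
    ring

theorem summand_H_four_two_mul :
    aTimes (fun n => H 3 (2 * n) / n ^ 3
        + 4 * (10 * n - 3) * H 4 (2 * n) / (5 * n ^ 2 * (2 * n - 1))
        + (6 * n - 5) / (20 * n ^ 6 * (2 * n - 1))) ∈ V S₁ 4 ∧
    HasSum (aTimes (fun n => H 3 (2 * n) / n ^ 3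
        + 4 * (10 * n - 3) * H 4 (2 * n) / (5 * n ^ 2 * (2 * n - 1))
        + (6 * n - 5) / (20 * n ^ 6 * (2 * n - 1))))
      (-(3 * riemannZeta 3 ^ 2) / 10 - 23 * (Real.pi : ℂ) ^ 6 / 7560) := by
  refine CoeffIdentity.of_lines
    [(23 / 480, 2, 1, 0, 1, -1), (11 / 560, 2, 1, -1, 2, 0), (13 / 84, 0, 1, -1, -1,
      0), (-41 / 1680, 0, 1, 2, -1, 0), (-73 / 1120, 0, 1, -1, 0, -1), (1 / 192, 2,
      -1, -1, 2, 0), (-1 / 224, 0, 2, -1, -1, 0), (809 / 4200, 0, 1, -2, 0, 0), (-11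
      / 448, 0, 0, 1, 1, 1), (113 / 840, 0, 2, -1, 0, 0), (-9 / 560, 0, 1, -2, 1, 0),
      (-2407 / 1680, 0, 1, -1, 0, 0), (31 / 1440, 0, 1, 2, -1, 1), (1 / 2016, 0, 2,
      1, 1, 2), (59 / 840, 1, 1, 1, 1, 0), (431 / 1120, 0, 1, 1, 0, 0), (1 / 96, 0,
      1, -1, 0, -3), (38 / 105, 1, 1, 1, 0, 0), (-19 / 80, 2, 1, 0, 1, 0), (-191 /
      2800, 0, 2, 1, 0, 0), (-29 / 560, 0, 1, -2, -1, 0), (-81 / 560, 0, 1, 1, -1, 1)] (fun n => ?_) ?_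
  · have hn : (n : ℂ) ≠ 0 := by exact_mod_cast n.ne_zero
    have hm := two_mul_sub_one_ne n
    have hr := inv_relation n
    have hg : aTimes (fun n => H 3 (2 * n) / n ^ 3
        + 4 * (10 * n - 3) * H 4 (2 * n) / (5 * n ^ 2 * (2 * n - 1))
        + (6 * n - 5) / (20 * n ^ 6 * (2 * n - 1))) n =
        aSeq n * (H 3 (2 * n) * (1 / (n : ℂ)) ^ 3 + 4 * (10 * (1 / (n : ℂ)) - 3 * (1 / (n :
          ℂ)) ^ 2) * (1 / (2 * (n : ℂ) - 1)) * H 4 (2 * n) / 5 + (6 * (1 / (n : ℂ)) ^ 5 - 5 *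
          (1 / (n : ℂ)) ^ 6) * (1 / (2 * (n : ℂ) - 1)) / 20) := by
      simp only [aTimes]
      field_simp
    rw [hg]
    simp only [List.map_cons, List.map_nil, List.sum_cons, List.sum_nil,
      lineS_four, lineJ, jetS₁, lineP₁, lineP₂, P₁coeffThree]
    clear hg
    generalize 1 / (n : ℂ) = ν at *
    generalize 1 / (2 * (n : ℂ) - 1) = μ at *
    push_cast
    linear_combination aSeq n * (-ν ^ 2 * H 3 (2 * n)) * hr
  · have w1 : lineW 2 1 0 1 (-1) 4 =
        lineW 0 1 (-1) 0 0 4 := by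
      rw [lineW_swap_left]
      norm_num only
    have w2 : lineW 0 1 (-1) 0 (-1) 4 = 32 / 945 * (Real.pi : ℂ) ^ 6 := by
      rw [lineW_rational]
      norm_num [Finset.sum_range_succ, riemannZeta_six]
      ring
    have w3 : lineW 0 0 1 1 1 4 =
        lineW 2 1 1 2 0 4 := by
      rw [lineW_swap_right]
      norm_num only
    have w4 : lineW 0 1 2 (-1) 1 4 =
        lineW 2 1 3 0 0 4 := by
      rw [lineW_swap_left]
      norm_num only
    have w5 : lineW 0 2 1 1 2 4 =
        lineW 4 2 3 3 0 4 := by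
      rw [lineW_swap_left]
      norm_num only
    have w6 : lineW 0 1 (-1) 0 (-3) 4 = 992 / 945 * (Real.pi : ℂ) ^ 6 := by
      rw [lineW_rational]
      norm_num [Finset.sum_range_succ, riemannZeta_six]
      ring
    have w7 : lineW 2 1 0 1 0 4 = 32 / 945 * (Real.pi : ℂ) ^ 6 := by
      rw [lineW_swap_left]
      norm_num only
      rw [lineW_rational]
      norm_num [Finset.sum_range_succ, riemannZeta_six]
      ring
    have w8 : lineW 0 1 1 (-1) 1 4 =
        lineW 2 1 2 0 0 4 := by
      rw [lineW_swap_left]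
      norm_num only
    simp only [List.map_cons, List.map_nil, List.sum_cons, List.sum_nil]
    rw [w1, w2, w3, w4, w5, w6, w7, w8]
    simp (disch := norm_num) only [lineW_four, powerSumDougall]
    push_cast
    ring

theorem summand_H_one_mul_H_two_two_mul :
    aTimes (fun n => 10 * H 1 n * H 2 (2 * n) / n ^ 3
        - 64 * H 1 n / n ^ 5 - 3 * H 2 (2 * n) / n ^ 4
        - 10 * H 3 (2 * n) / n ^ 3 + 2 / n ^ 6) ∈ V S₁ 4 ∧
    HasSum (aTimes (fun n => 10 * H 1 n * H 2 (2 * n) / n ^ 3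
        - 64 * H 1 n / n ^ 5 - 3 * H 2 (2 * n) / n ^ 4
        - 10 * H 3 (2 * n) / n ^ 3 + 2 / n ^ 6))
      (23 * (Real.pi : ℂ) ^ 6 / 378 - 92 * riemannZeta 3 ^ 2 / 5) := by
  refine CoeffIdentity.of_lines
    [(533 / 240, 0, 2, -1, -2, 0), (529 / 60, 1, 1, 1, 1, 0), (2015 / 144, 0, 1, 1,
      0, 0), (-2 / 5, 0, 1, 1, 0, 1), (4093 / 960, 0, 1, -1, 2, 0), (5099 / 240, 0,
      1, -1, -1, 0), (4379 / 360, 0, 2, -1, 0, 0), (-4079 / 960, 0, 1, -1, -2, 0),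
      (-1 / 30, 0, 2, 0, 1, 2), (13 / 48, 0, 1, 0, -1, 1), (-382 / 225, 0, 1, -2, 0,
      0), (15 / 2, 0, 1, -2, 1, 0), (-8299 / 240, 0, 1, -1, 1, 0), (1043 / 120, 0, 0,
      1, 0, 1), (367 / 20, 1, 1, 1, 0, 0), (-19991 / 480, 0, 1, -1, 0, 0), (-463 /
      80, 2, 1, 0, 1, -1), (-69 / 80, 0, 1, 1, -2, 0), (-3311 / 1200, 0, 2, 1, 0, 0),
      (-1 / 15, 0, 1, -1, 0, 1), (-737 / 80, 0, 2, -1, -1, 0), (-103 / 80, 0, 1, 1,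
      1, 1), (-417 / 80, 0, 1, 1, -1, 1), (-473 / 80, 0, 1, -1, 0, -1), (13 / 6, 0,
      1, -1, 0, -2), (7 / 30, 2, -1, 2, 2, 0), (-5 / 12, 0, 1, -1, 0, -3)] (fun n => ?_) ?_
  · have hn : (n : ℂ) ≠ 0 := by exact_mod_cast n.ne_zero
    have hm := two_mul_sub_one_ne n
    have hr := inv_relation n
    have hg : aTimes (fun n => 10 * H 1 n * H 2 (2 * n) / n ^ 3
        - 64 * H 1 n / n ^ 5 - 3 * H 2 (2 * n) / n ^ 4
        - 10 * H 3 (2 * n) / n ^ 3 + 2 / n ^ 6) n =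
        aSeq n * (10 * H 1 n * H 2 (2 * n) * (1 / (n : ℂ)) ^ 3 - 64 * H 1 n * (1 / (n : ℂ)) ^
          5 - 3 * H 2 (2 * n) * (1 / (n : ℂ)) ^ 4 - 10 * H 3 (2 * n) * (1 / (n : ℂ)) ^ 3 + 2
          * (1 / (n : ℂ)) ^ 6) := by
      simp only [aTimes]
      field_simp
    rw [hg]
    simp only [List.map_cons, List.map_nil, List.sum_cons, List.sum_nil,
      lineS_four, lineJ, jetS₁, lineP₁, lineP₂, P₁coeffThree]
    clear hg
    generalize 1 / (n : ℂ) = ν at *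
    generalize 1 / (2 * (n : ℂ) - 1) = μ at *
    push_cast
    linear_combination aSeq n * (10 * ν ^ 2 * H 3 (2 * n) - 10 * ν ^ 2 * H 1 n * H 2 (2 * n) +
      10 * ν ^ 2 * μ * H 2 (2 * n) + 3 * ν ^ 3 * H 2 (2 * n) + 64 * ν ^ 4 * H 1 n - 64 * ν ^
      4 * μ - 2 * ν ^ 5) * hr
  · have w1 : lineW 0 1 1 0 1 4 =
        lineW 2 1 2 1 0 4 := by
      rw [lineW_swap_left]
      norm_num only
    have w2 : lineW 0 2 0 1 2 4 =
        lineW 4 2 2 3 0 4 := by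
      rw [lineW_swap_left]
      norm_num only
    have w3 : lineW 0 1 0 (-1) 1 4 =
        lineW 2 1 1 0 0 4 := by
      rw [lineW_swap_left]
      norm_num only
    have w4 : lineW 0 0 1 0 1 4 =
        lineW 2 1 1 1 0 4 := by
      rw [lineW_swap_right]
      norm_num only
    have w5 : lineW 2 1 0 1 (-1) 4 =
        lineW 0 1 (-1) 0 0 4 := by
      rw [lineW_swap_left]
      norm_num only
    have w6 : lineW 0 1 (-1) 0 1 4 = 32 / 945 * (Real.pi : ℂ) ^ 6 := by
      rw [lineW_rational]
      norm_num [Finset.sum_range_succ, riemannZeta_six]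
      ring
    have w7 : lineW 0 1 1 1 1 4 =
        lineW 2 1 2 2 0 4 := by
      rw [lineW_swap_left]
      norm_num only
    have w8 : lineW 0 1 1 (-1) 1 4 =
        lineW 2 1 2 0 0 4 := by
      rw [lineW_swap_left]
      norm_num only
    have w9 : lineW 0 1 (-1) 0 (-1) 4 = 32 / 945 * (Real.pi : ℂ) ^ 6 := by
      rw [lineW_rational]
      norm_num [Finset.sum_range_succ, riemannZeta_six]
      ring
    have w10 : lineW 0 1 (-1) 0 (-2) 4 = 242 / 945 * (Real.pi : ℂ) ^ 6 := by
      rw [lineW_rational]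
      norm_num [Finset.sum_range_succ, riemannZeta_six]
      ring
    have w11 : lineW 0 1 (-1) 0 (-3) 4 = 992 / 945 * (Real.pi : ℂ) ^ 6 := by
      rw [lineW_rational]
      norm_num [Finset.sum_range_succ, riemannZeta_six]
      ring
    simp only [List.map_cons, List.map_nil, List.sum_cons, List.sum_nil]
    rw [w1, w2, w3, w4, w5, w6, w7, w8, w9, w10, w11]
    simp (disch := norm_num) only [lineW_four, powerSumDougall]
    push_cast
    ring

/-! ### The identity of degree 6. -/

theorem summand_H_two_cube :
    aTimes (fun n => -(2 * (-15 + 34 * n)) / (n ^ 8 * (-1 + 2 * n))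
        + 2 * (-11 + 26 * n) * H 2 n / (n ^ 6 * (-1 + 2 * n))
        - (-7 + 18 * n) * (H 2 n ^ 2 - H 4 n) / (n ^ 4 * (-1 + 2 * n))
        + (-3 + 10 * n) * (H 2 n ^ 3 - 3 * H 2 n * H 4 n
            + 2 * H 6 n) / (3 * n ^ 2 * (-1 + 2 * n))) ∈ V S₁ 6 ∧
    HasSum (aTimes (fun n => -(2 * (-15 + 34 * n)) / (n ^ 8 * (-1 + 2 * n))
        + 2 * (-11 + 26 * n) * H 2 n / (n ^ 6 * (-1 + 2 * n))
        - (-7 + 18 * n) * (H 2 n ^ 2 - H 4 n) / (n ^ 4 * (-1 + 2 * n))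
        + (-3 + 10 * n) * (H 2 n ^ 3 - 3 * H 2 n * H 4 n
            + 2 * H 6 n) / (3 * n ^ 2 * (-1 + 2 * n))))
      (2 * (Real.pi : ℂ) ^ 8 / 4725) := by
  refine CoeffIdentity.of_lines
    [(2, 2, 1, 0, 1, -1)] (fun n => ?_) ?_
  · have hn : (n : ℂ) ≠ 0 := by exact_mod_cast n.ne_zero
    have hm := two_mul_sub_one_ne n
    have hg : aTimes (fun n => -(2 * (-15 + 34 * n)) / (n ^ 8 * (-1 + 2 * n))
        + 2 * (-11 + 26 * n) * H 2 n / (n ^ 6 * (-1 + 2 * n))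
        - (-7 + 18 * n) * (H 2 n ^ 2 - H 4 n) / (n ^ 4 * (-1 + 2 * n))
        + (-3 + 10 * n) * (H 2 n ^ 3 - 3 * H 2 n * H 4 n
            + 2 * H 6 n) / (3 * n ^ 2 * (-1 + 2 * n))) n =
        aSeq n * (-2 * (34 * (1 / (n : ℂ)) ^ 7 - 15 * (1 / (n : ℂ)) ^ 8) * (1 / (2 * (n : ℂ)
          - 1)) + 2 * (26 * (1 / (n : ℂ)) ^ 5 - 11 * (1 / (n : ℂ)) ^ 6) * (1 / (2 * (n : ℂ) -
          1)) * H 2 n - (18 * (1 / (n : ℂ)) ^ 3 - 7 * (1 / (n : ℂ)) ^ 4) * (1 / (2 * (n : ℂ)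
          - 1)) * (H 2 n ^ 2 - H 4 n) + (10 * (1 / (n : ℂ)) - 3 * (1 / (n : ℂ)) ^ 2) * (1 /
          (2 * (n : ℂ) - 1)) * (H 2 n ^ 3 - 3 * H 2 n * H 4 n + 2 * H 6 n) / 3) := by
      simp only [aTimes]
      rw [show -1 + 2 * (n : ℂ) = 2 * n - 1 by ring]
      field_simp
      ring
    -- The linear forms take the values `0` and `±1` on this line, and the jet of order `s` is `(1 +
    -- (-1)^s) (H s n - 2/n^s)`, which vanishes for odd `s`.
    have h1 : lineJ 2 1 0 1 (-1) n 1 = 0 := by norm_num [lineJ, jetS₁]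
    have h3 : lineJ 2 1 0 1 (-1) n 3 = 0 := by norm_num [lineJ, jetS₁]
    have h5 : lineJ 2 1 0 1 (-1) n 5 = 0 := by norm_num [lineJ, jetS₁]
    have hl := lineS_six 2 1 0 1 (-1) n h1 h3 h5
    rw [hg]
    simp only [List.map_cons, List.map_nil, List.sum_cons, List.sum_nil,
      hl, lineJ, jetS₁, lineP₂]
    clear hg hl h1 h3 h5
    generalize 1 / (n : ℂ) = ν at *
    generalize 1 / (2 * (n : ℂ) - 1) = μ at *
    push_cast
    ring
  -- After the symmetry the series is the sum of `2 / ((k+1)^2 - x^2)`, whose sixth coefficient is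
  -- `2 ζ(8)`.
  · have w1 : lineW 2 1 0 1 (-1) 6 = 1 / 4725 * (Real.pi : ℂ) ^ 8 := by
      rw [lineW_swap_left]
      norm_num only
      rw [lineW_rational]
      norm_num [Finset.sum_range_succ, riemannZeta_eight]
      ring
    simp only [List.map_cons, List.map_nil, List.sum_cons, List.sum_nil]
    rw [w1]
    push_cast
    ring

end

noncomputable section

/-! ### The spans in degrees `0` and `1` -/

theorem aSeq_ne_zero (n : ℕ) : aSeq n ≠ 0 :=
  div_ne_zero (mul_ne_zero (pow_ne_zero _ (by norm_num)) (notPole_one.rf_ne_zero n))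
    (notPole_half.rf_ne_zero n)

theorem coeff_degree_zero {r : Fin 5 → ℕ} (h : ∑ i, r i = 0) :
    (fun n : ℕ+ => coeff (fun a b c d e => S₁ a b c d e n) r) = lineS 0 0 0 0 0 0 := by
  have hr : ∀ i, r i = 0 := fun i => Finset.sum_eq_zero_iff.mp h i (Finset.mem_univ i)
  funext n
  simp [coeff, lineS, taylor_zero, onLine, hr]

theorem V_zero_le {W : Submodule ℚ (ℕ+ → ℂ)} (h : lineS 0 0 0 0 0 0 ∈ W) : V S₁ 0 ≤ W := by
  refine Submodule.span_le.mpr ?_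
  rintro g ⟨r, hr, rfl⟩
  rw [coeff_degree_zero hr]
  exact h

theorem onLine_eq (f : ℂ → ℂ → ℂ → ℂ → ℂ → ℂ) (v : Fin 5 → ℚ) :
    onLine f v = fun x : ℂ => f (x * v 0) (x * v 1) (x * v 2) (x * v 3) (x * v 4) := rfl

/-- A degree-one coefficient is the first Taylor coefficient along a coordinate axis, so the five
axes generate. -/
theorem V_one_le {W : Submodule ℚ (ℕ+ → ℂ)} (ha : lineS 1 0 0 0 0 1 ∈ W)
    (hb : lineS 0 1 0 0 0 1 ∈ W) (hc : lineS 0 0 1 0 0 1 ∈ W) (hd : lineS 0 0 0 1 0 1 ∈ W)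
    (he : lineS 0 0 0 0 1 1 ∈ W) : V S₁ 1 ≤ W := by
  refine Submodule.span_le.mpr ?_
  rintro g ⟨r, hr, rfl⟩
  rw [Fin.sum_univ_five] at hr
  have key : (r 0 = 1 ∧ r 1 = 0 ∧ r 2 = 0 ∧ r 3 = 0 ∧ r 4 = 0) ∨
      (r 0 = 0 ∧ r 1 = 1 ∧ r 2 = 0 ∧ r 3 = 0 ∧ r 4 = 0) ∨
      (r 0 = 0 ∧ r 1 = 0 ∧ r 2 = 1 ∧ r 3 = 0 ∧ r 4 = 0) ∨
      (r 0 = 0 ∧ r 1 = 0 ∧ r 2 = 0 ∧ r 3 = 1 ∧ r 4 = 0) ∨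
      (r 0 = 0 ∧ r 1 = 0 ∧ r 2 = 0 ∧ r 3 = 0 ∧ r 4 = 1) := by omega
  rcases key with h | h | h | h | h
  · refine (congrArg (· ∈ W) (funext fun n => ?_)).mpr ha
    simp [coeff, lineS, taylor, onLine_eq, h, Fin.prod_univ_five]
  · refine (congrArg (· ∈ W) (funext fun n => ?_)).mpr hb
    simp [coeff, lineS, taylor, onLine_eq, h, Fin.prod_univ_five]
  · refine (congrArg (· ∈ W) (funext fun n => ?_)).mpr hc
    simp [coeff, lineS, taylor, onLine_eq, h, Fin.prod_univ_five]
  · refine (congrArg (· ∈ W) (funext fun n => ?_)).mpr hd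
    simp [coeff, lineS, taylor, onLine_eq, h, Fin.prod_univ_five]
  · refine (congrArg (· ∈ W) (funext fun n => ?_)).mpr he
    simp [coeff, lineS, taylor, onLine_eq, h, Fin.prod_univ_five]

theorem V_zero_eq : V S₁ 0 =
    Submodule.span ℚ {aTimes fun n => (10 * n - 3) / (n ^ 2 * (2 * n - 1))} := by
  refine le_antisymm (V_zero_le ?_) ?_
  · rw [Submodule.mem_span_singleton]
    refine ⟨-1, ?_⟩
    funext n
    have hn : (n : ℂ) ≠ 0 := by exact_mod_cast n.ne_zero
    have hm := two_mul_sub_one_ne n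
    rw [lineS_zero, Pi.smul_apply, Rat.smul_def, aTimes]
    push_cast
    field_simp
  · rw [Submodule.span_singleton_le_iff_mem]
    exact summand_rational.1

theorem finrank_V_zero : Module.finrank ℚ (V S₁ 0) = 1 := by
  rw [V_zero_eq]
  refine finrank_span_singleton fun h => ?_
  have := congrFun h 1
  norm_num [aTimes, aSeq_ne_zero] at this

/-- The three functions that span `V S₁ 1`. -/
def basisOne : Fin 3 → ℕ+ → ℂ :=
  ![aTimes fun n => 5 / (n : ℂ) ^ 3,
    aTimes fun n => (10 * n - 3) * H 1 n / (3 * n ^ 2 * (2 * n - 1))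
      - 4 * (3 * n - 1) / (3 * n ^ 2 * (2 * n - 1) ^ 2),
    aTimes fun n => (10 * n - 3) * H 1 (2 * n) / (3 * n ^ 2 * (2 * n - 1))
      - 2 / (3 * n ^ 2 * (2 * n - 1))]

theorem range_basisOne : Set.range basisOne =
    {aTimes fun n => 5 / (n : ℂ) ^ 3,
      aTimes fun n => (10 * n - 3) * H 1 n / (3 * n ^ 2 * (2 * n - 1))
        - 4 * (3 * n - 1) / (3 * n ^ 2 * (2 * n - 1) ^ 2),
      aTimes fun n => (10 * n - 3) * H 1 (2 * n) / (3 * n ^ 2 * (2 * n - 1))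
        - 2 / (3 * n ^ 2 * (2 * n - 1))} := by
  rw [basisOne, Matrix.range_cons, Matrix.range_cons, Matrix.range_cons, Matrix.range_empty,
    Set.union_empty]
  rfl

theorem linearIndependent_basisOne : LinearIndependent ℚ basisOne := by
  rw [Fintype.linearIndependent_iff]
  intro q hq
  have H1 : H 1 1 = 1 := by norm_num [H]
  have H2 : H 1 2 = 3 / 2 := by norm_num [H, Finset.sum_Icc_succ_top]
  have H3 : H 1 3 = 11 / 6 := by norm_num [H, Finset.sum_Icc_succ_top]
  have H4 : H 1 4 = 25 / 12 := by norm_num [H, Finset.sum_Icc_succ_top]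
  have H6 : H 1 6 = 49 / 20 := by norm_num [H, Finset.sum_Icc_succ_top]
  have ev : ∀ n : ℕ+, (q 0 : ℂ) * (5 / (n : ℂ) ^ 3) +
      q 1 * ((10 * n - 3) * H 1 n / (3 * n ^ 2 * (2 * n - 1))
        - 4 * (3 * n - 1) / (3 * n ^ 2 * (2 * n - 1) ^ 2)) +
      q 2 * ((10 * n - 3) * H 1 (2 * n) / (3 * n ^ 2 * (2 * n - 1))
        - 2 / (3 * n ^ 2 * (2 * n - 1))) = 0 := by
    intro n
    have := congrFun hq n
    simp only [Fin.sum_univ_three, basisOne, Pi.add_apply, Pi.smul_apply, Rat.smul_def, aTimes,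
      Matrix.cons_val, Pi.zero_apply] at this
    refine mul_left_cancel₀ (aSeq_ne_zero n) ?_
    linear_combination this
  have q1 := ev 1
  have q2 := ev 2
  have q3 := ev 3
  simp only [PNat.val_ofNat, Nat.reduceMul, mul_one, H1, H2, H3, H4, H6, Nat.cast_one,
    Nat.cast_ofNat] at q1 q2 q3
  -- The multipliers are the rows of the inverse of the matrix of values at `n = 1, 2, 3`, with
  -- `a_n` divided out.
  have z0 : (q 0 : ℂ) = 0 := by
    linear_combination (-4642/9115) * q1 + (20664/1823) * q2 + (-34830/1823) * q3
  have z1 : (q 1 : ℂ) = 0 := by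
    linear_combination (-14591/10938) * q1 + (35988/1823) * q2 + (-55800/1823) * q3
  have z2 : (q 2 : ℂ) = 0 := by
    linear_combination (5987/5469) * q1 + (-32232/1823) * q2 + (54900/1823) * q3
  intro i
  fin_cases i
  exacts [by exact_mod_cast z0, by exact_mod_cast z1, by exact_mod_cast z2]

theorem V_one_eq : V S₁ 1 = Submodule.span ℚ (Set.range basisOne) := by
  refine le_antisymm ?_ ?_
  · have key : ∀ a b c d e x y z : ℚ, (∀ n : ℕ+, lineS a b c d e 1 n =
        (x : ℂ) * basisOne 0 n + y * basisOne 1 n + z * basisOne 2 n) →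
        lineS a b c d e 1 ∈ Submodule.span ℚ (Set.range basisOne) := by
      intro a b c d e x y z h
      have hm : ∀ i, basisOne i ∈ Submodule.span ℚ (Set.range basisOne) := fun i =>
        Submodule.subset_span ⟨i, rfl⟩
      convert add_mem (add_mem (Submodule.smul_mem _ x (hm 0)) (Submodule.smul_mem _ y (hm 1)))
        (Submodule.smul_mem _ z (hm 2)) using 1
      funext n
      rw [h]
      simp only [Pi.add_apply, Pi.smul_apply, Rat.smul_def]
    have val : ∀ n : ℕ+, basisOne 0 n = aSeq n * (5 * (1 / (n : ℂ)) ^ 3) ∧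
        basisOne 1 n = aSeq n * ((10 * (1 / (n : ℂ)) - 3 * (1 / (n : ℂ)) ^ 2) *
          (1 / (2 * (n : ℂ) - 1)) * H 1 n / 3 -
          4 * (3 * (1 / (n : ℂ)) - (1 / (n : ℂ)) ^ 2) * (1 / (2 * (n : ℂ) - 1)) ^ 2 / 3) ∧
        basisOne 2 n = aSeq n * ((10 * (1 / (n : ℂ)) - 3 * (1 / (n : ℂ)) ^ 2) *
          (1 / (2 * (n : ℂ) - 1)) * H 1 (2 * n) / 3 -
          2 * (1 / (n : ℂ)) ^ 2 * (1 / (2 * (n : ℂ) - 1)) / 3) := by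
      intro n
      have hn : (n : ℂ) ≠ 0 := by exact_mod_cast n.ne_zero
      have hm := two_mul_sub_one_ne n
      simp only [basisOne, Matrix.cons_val, aTimes]
      refine ⟨?_, ?_, ?_⟩ <;> field_simp
    -- Coordinates in `basisOne` of the coefficients of `a`, `b`, `c`, `d`, `e`, in this order.
    refine V_one_le (key _ _ _ _ _ (3 / 5) (-6) 9 fun n => ?_)
      (key _ _ _ _ _ (-4 / 5) 6 (-3) fun n => ?_) (key _ _ _ _ _ (1 / 5) 0 (-6) fun n => ?_)
      (key _ _ _ _ _ 0 6 (-12) fun n => ?_) (key _ _ _ _ _ (2 / 5) 0 3 fun n => ?_)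
    all_goals
      rw [(val n).1, (val n).2.1, (val n).2.2, lineS_one]
      have hr := inv_relation n
      simp only [lineJ, jetS₁, lineP₁]
      generalize 1 / (n : ℂ) = ν at *
      generalize 1 / (2 * (n : ℂ) - 1) = μ at *
      push_cast
    · linear_combination aSeq n * (-2 * ν * μ + 3 * ν ^ 2) * hr
    · linear_combination aSeq n * (2 * ν * μ - 4 * ν ^ 2) * hr
    · linear_combination aSeq n * ν ^ 2 * hr
    · linear_combination aSeq n * (2 * ν * μ) * hr
    · linear_combination aSeq n * (2 * ν ^ 2) * hr
  · rw [Submodule.span_le, range_basisOne]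
    rintro g (rfl | rfl | rfl)
    exacts [summand_inv_cube.1, summand_H_one.1, summand_H_one_two_mul.1]

theorem finrank_V_one : Module.finrank ℚ (V S₁ 1) = 3 := by
  rw [V_one_eq, finrank_span_eq_card linearIndependent_basisOne, Fintype.card_fin]

theorem CoeffIdentity.of_left {N : ℕ} {g : ℕ → ℂ} {s : ℂ}
    (h : aTimes g ∈ V S₁ N ∧ HasSum (aTimes g) s) : CoeffIdentity N g s :=
  ⟨(le_sup_left : V S₁ N ≤ V S₁ N ⊔ V S₂ N) h.1, h.2⟩

end
end DougallII

/-! ### Assembly of the theorem. -/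

theorem mainTheorem6 :
    -- the WZ-pair
    (∀ a b c d e : ℂ, DougallII.Admissible a b c d e → DougallII.GammaRegular a b c d e →
      (∀ n k : ℕ, DougallII.F a b c d e (n + 1) k - DougallII.F a b c d e n k =
        DougallII.G a b c d e n (k + 1) - DougallII.G a b c d e n k) ∧
      (∀ k : ℕ, DougallII.F a b c d e 0 k =
        DougallII.gammaFactor a b c d e * DougallII.wellPoisedTerm a b c d e k) ∧
      (-(1 / 2) < (a - b - c - d).re →
        Summable (fun k : ℕ => DougallII.F a b c d e 0 k) ∧
        HasSum (fun n : ℕ+ => DougallII.G a b c d e ((n : ℕ) - 1) 0)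
          (∑' k : ℕ, DougallII.F a b c d e 0 k))) ∧
    -- the five-parameter identity
    (∀ a b c d e : ℂ, DougallII.Admissible a b c d e → -(1 / 2) < (a - b - c - d).re →
      Summable (fun k : ℕ => DougallII.wellPoisedTerm a b c d e k) ∧
      HasSum (fun n : ℕ+ => DougallII.S₁ a b c d e n) (DougallII.wellPoised a b c d e)) ∧
    -- comparison of the power series coefficients at the origin
    AnalyticAt ℂ (fun p : Fin 5 → ℂ => DougallII.wellPoised (p 0) (p 1) (p 2) (p 3) (p 4)) 0 ∧
    (∀ r : Fin 5 → ℕ,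
      HasSum (fun n : ℕ+ => DougallII.coeff (fun a b c d e => DougallII.S₁ a b c d e n) r)
        (DougallII.coeff DougallII.wellPoised r)) ∧
    -- degree 0
    (Module.finrank ℚ (DougallII.V DougallII.S₁ 0) = 1 ∧
      DougallII.V DougallII.S₁ 0 =
        Submodule.span ℚ {DougallII.aTimes fun n => (10 * n - 3) / (n ^ 2 * (2 * n - 1))} ∧
      HasSum (DougallII.aTimes fun n => (10 * n - 3) / (n ^ 2 * (2 * n - 1)))
        (-(Real.pi : ℂ) ^ 2 / 3)) ∧
    -- degree 1
    (Module.finrank ℚ (DougallII.V DougallII.S₁ 1) = 3 ∧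
      DougallII.V DougallII.S₁ 1 = Submodule.span ℚ
        {DougallII.aTimes fun n => 5 / (n : ℂ) ^ 3,
         DougallII.aTimes fun n => (10 * n - 3) * DougallII.H 1 n / (3 * n ^ 2 * (2 * n - 1))
           - 4 * (3 * n - 1) / (3 * n ^ 2 * (2 * n - 1) ^ 2),
         DougallII.aTimes fun n =>
           (10 * n - 3) * DougallII.H 1 (2 * n) / (3 * n ^ 2 * (2 * n - 1))
           - 2 / (3 * n ^ 2 * (2 * n - 1))} ∧
      HasSum (DougallII.aTimes fun n => 5 / (n : ℂ) ^ 3) (-2 * riemannZeta 3) ∧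
      HasSum
        (DougallII.aTimes fun n => (10 * n - 3) * DougallII.H 1 n / (3 * n ^ 2 * (2 * n - 1))
          - 4 * (3 * n - 1) / (3 * n ^ 2 * (2 * n - 1) ^ 2))
        (riemannZeta 3 / 5) ∧
      HasSum
        (DougallII.aTimes fun n =>
          (10 * n - 3) * DougallII.H 1 (2 * n) / (3 * n ^ 2 * (2 * n - 1))
          - 2 / (3 * n ^ 2 * (2 * n - 1)))
        (-16 * riemannZeta 3 / 15)) ∧
    -- degree 2
    DougallII.CoeffIdentity 2
      (fun n => (10 * n - 3) * DougallII.H 2 n / (3 * n ^ 2 * (2 * n - 1))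
        - (18 * n - 7) / (3 * n ^ 4 * (2 * n - 1)))
      ((Real.pi : ℂ) ^ 4 / 135) ∧
    DougallII.CoeffIdentity 2
      (fun n => (10 * n - 3) * DougallII.H 2 (2 * n) / (3 * n ^ 2 * (2 * n - 1))
        - (9 * n - 4) / (3 * n ^ 4 * (2 * n - 1)))
      (-(Real.pi : ℂ) ^ 4 / 180) ∧
    DougallII.CoeffIdentity 2
      (fun n => (10 * n - 3) * DougallII.H 1 n ^ 2 / (3 * n ^ 2 * (2 * n - 1))
        - 8 * (3 * n - 1) * DougallII.H 1 n / (3 * n ^ 2 * (2 * n - 1) ^ 2)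
        + 4 * (34 * n ^ 3 - 6 * n ^ 2 - 7 * n + 2) / (15 * n ^ 4 * (2 * n - 1) ^ 3))
      (-41 * (Real.pi : ℂ) ^ 4 / 2700) ∧
    DougallII.CoeffIdentity 2
      (fun n => (10 * n - 3) * DougallII.H 1 (2 * n) ^ 2 / (3 * n ^ 2 * (2 * n - 1))
        - 4 * DougallII.H 1 (2 * n) / (3 * n ^ 2 * (2 * n - 1))
        + (37 * n - 16) / (15 * n ^ 4 * (2 * n - 1)))
      (-19 * (Real.pi : ℂ) ^ 4 / 900) ∧
    -- degree 3
    DougallII.CoeffIdentity 3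
      (fun n => (10 * n - 3) * DougallII.H 3 n / (3 * n ^ 2 * (2 * n - 1))
        - (38 * n - 17) / (3 * n ^ 5 * (2 * n - 1)))
      (-(16 / 3) * riemannZeta 5 + 2 / 3 * (Real.pi : ℂ) ^ 2 * riemannZeta 3) ∧
    DougallII.CoeffIdentity 3
      (fun n => (10 * n - 3) * DougallII.H 3 (2 * n) / (3 * n ^ 2 * (2 * n - 1))
        + (32 * n - 17) / (12 * n ^ 5 * (2 * n - 1)))
      (8 / 3 * riemannZeta 5 - 7 / 18 * (Real.pi : ℂ) ^ 2 * riemannZeta 3) ∧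
    DougallII.CoeffIdentity 3
      (fun n => DougallII.H 2 (2 * n) / n ^ 3 - 32 / (5 * n ^ 5))
      (-(41 / 5) * riemannZeta 5 + 14 / 15 * (Real.pi : ℂ) ^ 2 * riemannZeta 3) ∧
    -- degree 4
    DougallII.CoeffIdentity 4
      (fun n => (10 * n - 3) * DougallII.H 4 n / (3 * n ^ 2 * (2 * n - 1))
        - 4 * (7 * n - 3) / (3 * n ^ 6 * (2 * n - 1)))
      ((Real.pi : ℂ) ^ 6 / 1215 + 8 / 15 * riemannZeta 3 ^ 2) ∧
    DougallII.CoeffIdentity 4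
      (fun n => DougallII.H 3 (2 * n) / n ^ 3
        + 4 * (10 * n - 3) * DougallII.H 4 (2 * n) / (5 * n ^ 2 * (2 * n - 1))
        + (6 * n - 5) / (20 * n ^ 6 * (2 * n - 1)))
      (-(3 * riemannZeta 3 ^ 2) / 10 - 23 * (Real.pi : ℂ) ^ 6 / 7560) ∧
    DougallII.CoeffIdentity 4
      (fun n => 10 * DougallII.H 1 n * DougallII.H 2 (2 * n) / n ^ 3
        - 64 * DougallII.H 1 n / n ^ 5 - 3 * DougallII.H 2 (2 * n) / n ^ 4
        - 10 * DougallII.H 3 (2 * n) / n ^ 3 + 2 / n ^ 6)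
      (23 * (Real.pi : ℂ) ^ 6 / 378 - 92 * riemannZeta 3 ^ 2 / 5) ∧
    -- degree 6
    DougallII.CoeffIdentity 6
      (fun n => -(2 * (-15 + 34 * n)) / (n ^ 8 * (-1 + 2 * n))
        + 2 * (-11 + 26 * n) * DougallII.H 2 n / (n ^ 6 * (-1 + 2 * n))
        - (-7 + 18 * n) * (DougallII.H 2 n ^ 2 - DougallII.H 4 n) / (n ^ 4 * (-1 + 2 * n))
        + (-3 + 10 * n) * (DougallII.H 2 n ^ 3 - 3 * DougallII.H 2 n * DougallII.H 4 n
            + 2 * DougallII.H 6 n) / (3 * n ^ 2 * (-1 + 2 * n)))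
      (2 * (Real.pi : ℂ) ^ 8 / 4725) := by
  refine ⟨fun a b c d e h h' => ⟨DougallII.F_sub_F h h', DougallII.F_zero_left h h',
    DougallII.hasSum_G h h'⟩, fun a b c d e h hre => ⟨DougallII.summable_wellPoisedTerm h hre,
    DougallII.hasSum_S₁ h hre⟩, DougallII.analyticAt_wellPoised, DougallII.hasSum_coeff,
    ⟨DougallII.finrank_V_zero, DougallII.V_zero_eq, DougallII.summand_rational.2⟩,
    ⟨DougallII.finrank_V_one, ?_, DougallII.summand_inv_cube.2, DougallII.summand_H_one.2,
      DougallII.summand_H_one_two_mul.2⟩, ?_, ?_, ?_, ?_, ?_, ?_, ?_, ?_, ?_, ?_, ?_⟩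
  · rw [DougallII.V_one_eq, DougallII.range_basisOne]
  · exact DougallII.CoeffIdentity.of_left DougallII.summand_H_two
  · exact DougallII.CoeffIdentity.of_left DougallII.summand_H_two_two_mul
  · exact DougallII.CoeffIdentity.of_left DougallII.summand_H_one_sq
  · exact DougallII.CoeffIdentity.of_left DougallII.summand_H_one_two_mul_sq
  · exact DougallII.CoeffIdentity.of_left DougallII.summand_H_three
  · exact DougallII.CoeffIdentity.of_left DougallII.summand_H_three_two_mul
  · exact DougallII.CoeffIdentity.of_left DougallII.summand_H_two_two_mul_div_cube
  · exact DougallII.CoeffIdentity.of_left DougallII.summand_H_four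
  · exact DougallII.CoeffIdentity.of_left DougallII.summand_H_four_two_mul
  · exact DougallII.CoeffIdentity.of_left DougallII.summand_H_one_mul_H_two_two_mul
  · exact DougallII.CoeffIdentity.of_left DougallII.summand_H_two_cube
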